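/- **Setting.** Fix a non-empty family $\mathcal G$ of graphs: all directed paths ($n\ge 1$ nodes), all directed cycles ($n\ge 3$ nodes), or all of both. An LCL problem $\Pi$ without input on $\mathcal G$ has a finite set $\Gamma$ of output labels, and its solutions on $G=(V,E)\in\mathcal G$ are the labelings $\lambda\colon V\to\Gamma$ for which $\psi(G,\lambda,v)$ is "happy" at every node $v$; here $\psi$ is a verifier of some radius $r$, i.e. $\psi(G,\lambda,v)$ depends only on the isomorphism type of the labeled radius-$r$ neighborhood of $v$. Write $n=|V|$. *Mendability.* For a partial labeling $\lambda\colon V\to\Gamma\cup\{\bot\}$, the relaxed verifier $\psi^*$ is happy at $v$ if some node within distance $r$ of $v$ is labeled $\bot$, or else if $\psi$ is happy at $v$. The verifier $\psi$ is $T$-mendable if for every $G\in\mathcal G$, every partial labeling $\lambda$ accepted by $\psi^*$ and every $v\in V$ there is a partial labeling $\mu$ accepted by $\psi^*$ such that $\mu(v)\ne\bot$, $\mu(u)=\bot$ implies $\lambda(u)=\bot$, and $\mu(u)\neq\lambda(u)$ implies that $u$ is within distance $T(n)$ of $v$. A problem is $T$-mendable if it has a $T$-mendable verifier of some radius. *Solvability.*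 A problem is $T$-solvable if a deterministic algorithm in the LOCAL model finds a solution in $T(n)$ rounds; nodes know $n$ and have unique identifiers from $\{1,\dots,n^c\}$, for a fixed constant $c\ge 1$. It is $O(f)$-solvable if it is $T$-solvable for some $T=O(f)$. Two problems have the same round complexity if for every $f$ with $f(n)\ge 1$ for all large $n$, one is $O(f)$-solvable if and only if the other is. *Diagram.* The diagram of a radius-$r$ verifier $\psi$ has the words of length $2r$ over $\Gamma$ as states, and an edge from $a_1\cdots a_{2r}$ to $a_2\cdots a_{2r+1}$ whenever $\psi$ is happy at the center of a directed path of $2r+1$ nodes (inside a graph of $\mathcal G$ with at least $2r+2$ nodes) labeled $a_1,\dots,a_{2r+1}$ in order. A state is flexible if for all sufficiently large $k$ there is a closed walk of length $k$ through it. It is usable if on every sufficiently large $G\in\mathcal G$ some solution of $\Pi$ contains it as the word read along $2r$ consecutive nodes (for directed cycles, every flexible state is usable). **Theorem.** Let $\Pi$ be an $O(\log^* n)$-solvable LCL problem without input on $\mathcal G$, and let $\psi$ be any verifier for $\Pi$, of radius $r$. Then there is an LCL problem $\Pi'$ on $\mathcal G$ with the same label set such that 1. every solution of $\Pi'$ is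 a solution of $\Pi$; 2. $\Pi'$ has the same round complexity as $\Pi$; 3. $\Pi'$ is $O(1)$-mendable, i.e. $T$-mendable for some constant $T$; 4. $\Pi'$ is induced by a smallest strongly connected part $C$ of the diagram of $\psi$ containing a usable flexible state. That is: if $\Pi$ is not $O(1)$-solvable, $C$ is a strongly connected component that contains a usable flexible state, of minimum size among such components; if $\Pi$ is $O(1)$-solvable, $C$ is a single usable flexible state with a self-loop. And there is a constant $N$ such that on every $G\in\mathcal G$ with at least $N$ nodes the solutions of $\Pi'$ are exactly the solutions of $\Pi$ in which every word read along $2r$ consecutive nodes, all at distance at least $N$ from the endpoints of $G$ (if there are any), belongs to $C$. -/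

import Mathlib

open Filter Asymptotics

namespace LocalMending

/-! ### Directed paths and directed cycles -/

/-- The two kinds of graphs considered. -/
inductive Kind where
  | path
  | cycle

/-- The directed path on `n ≥ 1` nodes or the directed cycle on `n ≥ 3` nodes; all notions below
are invariant under isomorphism, so one copy of each graph is enough. -/
structure Inst where
  kind : Kind
  n : ℕ
  valid : match kind with
    | Kind.path => 1 ≤ n
    | Kind.cycle => 3 ≤ n

/-- The nodes, numbered along the direction of the edges. -/
abbrev Inst.V (G : Inst) : Type := Fin G.n

/-- The out-neighbour of a node, if there is one. -/
def Inst.succ (G : Inst) (v : G.V) : Option G.V :=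
  match G.kind with
  | Kind.path => if h : v.val + 1 < G.n then some ⟨v.val + 1, h⟩ else none
  | Kind.cycle => some ⟨(v.val + 1) % G.n, Nat.mod_lt _ v.pos⟩

/-- The in-neighbour of a node, if there is one. -/
def Inst.pred (G : Inst) (v : G.V) : Option G.V :=
  match G.kind with
  | Kind.path => if v.val = 0 then none else some ⟨v.val - 1, by have := v.isLt; omega⟩
  | Kind.cycle => some ⟨(v.val + (G.n - 1)) % G.n, Nat.mod_lt _ v.pos⟩

/-- `succ` and `pred` describe the same set of directed edges. -/
theorem Inst.pred_eq_some_iff (G : Inst) (u v : G.V) :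
    G.pred v = some u ↔ G.succ u = some v := by
  obtain ⟨k, n, hn⟩ := G
  cases k with
  | path =>
    have hu := u.isLt
    have hv := v.isLt
    simp only [Inst.V] at u v hu hv
    simp only [Inst.pred, Inst.succ]
    split_ifs <;> simp [Fin.ext_iff] <;> omega
  | cycle =>
    have hu := u.isLt
    have hv := v.isLt
    simp only [Inst.V] at u v hu hv hn
    simp only [Inst.pred, Inst.succ, Option.some.injEq, Fin.ext_iff]
    have h1 : (v.val + (n - 1)) % n = if v.val = 0 then n - 1 else v.val - 1 := by
      split_ifs with h
      · rw [h, Nat.zero_add, Nat.mod_eq_of_lt (by omega)]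
      · rw [show v.val + (n - 1) = (v.val - 1) + n by omega, Nat.add_mod_right,
          Nat.mod_eq_of_lt (by omega)]
    have h2 : (u.val + 1) % n = if u.val + 1 = n then 0 else u.val + 1 := by
      split_ifs with h
      · rw [h, Nat.mod_self]
      · rw [Nat.mod_eq_of_lt (by omega)]
    rw [h1, h2]
    split_ifs <;> omega

/-- The underlying undirected graph. -/
def Inst.graph (G : Inst) : SimpleGraph G.V :=
  SimpleGraph.fromRel fun u v => G.succ u = some v

/-- Graph distance (edges may be traversed in both directions). -/
noncomputable def Inst.dist (G : Inst) (u v : G.V) : ℕ := G.graph.dist u v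

/-- The endpoints of a path; a cycle has none. -/
def Inst.IsEnd (G : Inst) (v : G.V) : Prop := G.pred v = none ∨ G.succ v = none

/-! ### Locally verifiable problems without input -/

/-- A problem is given by its solutions on each graph. -/
def Problem (Γ : Type*) := (G : Inst) → (G.V → Γ) → Prop

/-- A verifier; `ψ G l v` says that `ψ` is happy at the node `v` for the output labeling `l`. -/
def Verifier (Γ : Type*) := (G : Inst) → (G.V → Γ) → G.V → Prop

/-- The labeled radius-`r` neighbourhoods of `v` in `G` and of `v'` in `G'` are isomorphic. -/
def SameNeighborhood {Γ : Type*} (r : ℕ) (G : Inst) (l : G.V → Γ) (v : G.V)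
    (G' : Inst) (l' : G'.V → Γ) (v' : G'.V) : Prop :=
  ∃ e : {u : G.V // G.dist v u ≤ r} ≃ {u : G'.V // G'.dist v' u ≤ r},
    (∀ a, a.val = v ↔ (e a).val = v') ∧
    (∀ a b, G.succ a.val = some b.val ↔ G'.succ (e a).val = some (e b).val) ∧
    ∀ a, l a.val = l' (e a).val

/-- `ψ` is a local verifier of radius `r` on the graph family given by `K`. -/
def IsLocal {Γ : Type*} (K : Set Kind) (r : ℕ) (ψ : Verifier Γ) : Prop :=
  ∀ (G : Inst) (l : G.V → Γ) (v : G.V) (G' : Inst) (l' : G'.V → Γ) (v' : G'.V),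
    G.kind ∈ K → G'.kind ∈ K → SameNeighborhood r G l v G' l' v' → (ψ G l v ↔ ψ G' l' v')

/-- `ψ` is a radius-`r` verifier for the problem `P` on the graph family given by `K`. -/
def IsVerifierFor {Γ : Type*} (K : Set Kind) (r : ℕ) (ψ : Verifier Γ) (P : Problem Γ) : Prop :=
  IsLocal K r ψ ∧ ∀ G : Inst, G.kind ∈ K → ∀ l : G.V → Γ, P G l ↔ ∀ v, ψ G l v

/-- `P` is an LCL problem (the label set is finite in all uses; degrees are at most two). -/
def IsLCL {Γ : Type*} (K : Set Kind) (P : Problem Γ) : Prop :=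
  ∃ (r : ℕ) (ψ : Verifier Γ), IsVerifierFor K r ψ P

/-! ### Mendability -/

/-- The relaxed verifier on partial labelings; `none` is the empty label `⊥`. -/
def Relaxed {Γ : Type*} (r : ℕ) (ψ : Verifier Γ) (G : Inst) (l : G.V → Option Γ) (v : G.V) :
    Prop :=
  (∃ u, G.dist v u ≤ r ∧ l u = none) ∨
    ∃ l' : G.V → Γ, (∀ u, G.dist v u ≤ r → l u = some (l' u)) ∧ ψ G l' v

/-- `m` is a `t`-mend of `l` at the node `v`. -/
structure IsMend {Γ : Type*} (r : ℕ) (ψ : Verifier Γ) (G : Inst) (t : ℕ) (l m : G.V → Option Γ)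
    (v : G.V) : Prop where
  accepted : ∀ u, Relaxed r ψ G m u
  filled : m v ≠ none
  no_new_hole : ∀ u, m u = none → l u = none
  near : ∀ u, m u ≠ l u → G.dist v u ≤ t

/-- A radius-`r` verifier is `T`-mendable. -/
def VerifierMendable {Γ : Type*} (K : Set Kind) (r : ℕ) (ψ : Verifier Γ) (T : ℕ → ℕ) : Prop :=
  ∀ G : Inst, G.kind ∈ K → ∀ l : G.V → Option Γ, (∀ u, Relaxed r ψ G l u) →
    ∀ v : G.V, ∃ m : G.V → Option Γ, IsMend r ψ G (T G.n) l m v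

/-- A problem is `T`-mendable if some local verifier for it is. -/
def Mendable {Γ : Type*} (K : Set Kind) (P : Problem Γ) (T : ℕ → ℕ) : Prop :=
  ∃ (r : ℕ) (ψ : Verifier Γ), IsVerifierFor K r ψ P ∧ VerifierMendable K r ψ T

/-! ### The LOCAL model -/

/-- A deterministic synchronous message-passing algorithm. Initially a node knows the number of
nodes, its identifier, and whether it has an in-neighbour and an out-neighbour. In a round it sends
a message to each neighbour, receives the messages of its neighbours (`none` where there is no
neighbour), and updates its state. States and messages are unbounded. -/
structure LocalAlgorithm (Γ : Type*) where
  State : Type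
  Msg : Type
  init : (n ident : ℕ) → (hasPred hasSucc : Bool) → State
  toPred : State → Msg
  toSucc : State → Msg
  update : State → (fromPred fromSucc : Option Msg) → State
  output : State → Γ

/-- The state of each node after `t` rounds, when the identifiers are `ident`. -/
def LocalAlgorithm.stateAt {Γ : Type*} (A : LocalAlgorithm Γ) (G : Inst) (ident : G.V → ℕ) :
    ℕ → G.V → A.State
  | 0, v => A.init G.n (ident v) (G.pred v).isSome (G.succ v).isSome
  | t + 1, v => A.update (A.stateAt G ident t v)
      ((G.pred v).map fun u => A.toSucc (A.stateAt G ident t u))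
      ((G.succ v).map fun u => A.toPred (A.stateAt G ident t u))

/-- `P` is solvable in `T(n)` rounds, with unique identifiers from `{1, …, n ^ c}`. -/
def Solvable {Γ : Type*} (K : Set Kind) (c : ℕ) (P : Problem Γ) (T : ℕ → ℕ) : Prop :=
  ∃ A : LocalAlgorithm Γ, ∀ G : Inst, G.kind ∈ K → ∀ ident : G.V → ℕ,
    Function.Injective ident → (∀ v, 1 ≤ ident v ∧ ident v ≤ G.n ^ c) →
      P G fun v => A.output (A.stateAt G ident (T G.n) v)

/-- `P` is `O(f)`-solvable. -/
def SolvableO {Γ : Type*} (K : Set Kind) (c : ℕ) (P : Problem Γ) (f : ℕ → ℝ) : Prop :=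
  ∃ T : ℕ → ℕ, (fun n => (T n : ℝ)) =O[atTop] f ∧ Solvable K c P T

/-- The iterated logarithm: how often `log₂` has to be applied to `n` to get a value at most `1`.
Rounding each iterate up to an integer does not change this number. -/
noncomputable def logStar (n : ℕ) : ℕ := sInf {k : ℕ | (Nat.clog 2)^[k] n ≤ 1}

/-- Two problems have the same round complexity up to constant factors. -/
def SameComplexity {Γ : Type*} (K : Set Kind) (c : ℕ) (P P' : Problem Γ) : Prop :=
  ∀ f : ℕ → ℝ, (∀ᶠ n in atTop, 1 ≤ f n) → (SolvableO K c P f ↔ SolvableO K c P' f)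

/-! ### The diagram of a radius-`r` verifier -/

/-- `e` lists consecutive nodes, in the direction of the edges. -/
def Inst.IsWindow (G : Inst) {m : ℕ} (e : Fin m → G.V) : Prop :=
  ∀ i j : Fin m, j.val = i.val + 1 → G.succ (e i) = some (e j)

/-- `w` labels a feasible radius-`r` neighbourhood, namely one that is a directed path with `r`
nodes on each side of its centre. -/
def Feasible {Γ : Type*} (K : Set Kind) (r : ℕ) (ψ : Verifier Γ) (w : Fin (2 * r + 1) → Γ) : Prop :=
  ∃ G : Inst, G.kind ∈ K ∧ 2 * r + 2 ≤ G.n ∧ ∃ (e : Fin (2 * r + 1) → G.V) (l : G.V → Γ),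
    G.IsWindow e ∧ (∀ i, l (e i) = w i) ∧ ψ G l (e ⟨r, by omega⟩)

/-- The edges of the diagram. Its states are the words of length `2 * r`, and a feasible
neighbourhood is an edge from its first `2 * r` labels to its last `2 * r` labels. -/
def DiagramEdge {Γ : Type*} (K : Set Kind) (r : ℕ) (ψ : Verifier Γ) (s s' : Fin (2 * r) → Γ) :
    Prop :=
  ∃ w : Fin (2 * r + 1) → Γ, Feasible K r ψ w ∧
    (∀ i : Fin (2 * r), w i.castSucc = s i) ∧ ∀ i : Fin (2 * r), w i.succ = s' i

/-- From some length on, there are closed walks of every length through `s`. -/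
def IsFlexible {S : Type*} (E : S → S → Prop) (s : S) : Prop :=
  ∃ k₀ : ℕ, ∀ k > k₀, ∃ p : ℕ → S, p 0 = s ∧ p k = s ∧ ∀ i < k, E (p i) (p (i + 1))

/-- The strongly connected component of `s`. -/
def component {S : Type*} (E : S → S → Prop) (s : S) : Set S :=
  {s' | Relation.ReflTransGen E s s' ∧ Relation.ReflTransGen E s' s}

/-- The word `s` occurs in some solution on every sufficiently large graph of the family. (On
cycles this holds for every flexible state; on paths it says that the state is compatible with the
constraints at the two ends.) -/
def IsUsable {Γ : Type*} (K : Set Kind) (P : Problem Γ) {m : ℕ} (s : Fin m → Γ) : Prop :=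
  ∃ N : ℕ, ∀ G : Inst, G.kind ∈ K → N ≤ G.n →
    ∃ (l : G.V → Γ) (e : Fin m → G.V), P G l ∧ G.IsWindow e ∧ ∀ i, l (e i) = s i

/-- `C` is a smallest strongly connected part of the diagram with a usable flexible state: a
smallest strongly connected component with such a state or, if the problem is `O(1)`-solvable, a
single state with a self-loop. -/
def IsSmallestFlexiblePart {Γ : Type*} (K : Set Kind) (c : ℕ) (P : Problem Γ) (r : ℕ)
    (ψ : Verifier Γ) (C : Set (Fin (2 * r) → Γ)) : Prop :=
  ∃ s : Fin (2 * r) → Γ, IsFlexible (DiagramEdge K r ψ) s ∧ IsUsable K P s ∧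
    (SolvableO K c P (fun _ => 1) → DiagramEdge K r ψ s s ∧ C = {s}) ∧
    (¬ SolvableO K c P (fun _ => 1) → C = component (DiagramEdge K r ψ) s ∧
      ∀ s' : Fin (2 * r) → Γ, IsFlexible (DiagramEdge K r ψ) s' → IsUsable K P s' →
        C.ncard ≤ (component (DiagramEdge K r ψ) s').ncard)

/-- On all sufficiently large graphs, `P'` is the restriction of `P` to the labelings whose words
of length `m`, except near the ends of a path, belong to `C`. -/
def IsInducedBy {Γ : Type*} (K : Set Kind) (P P' : Problem Γ) {m : ℕ} (C : Set (Fin m → Γ)) :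
    Prop :=
  ∃ N : ℕ, ∀ G : Inst, G.kind ∈ K → N ≤ G.n → ∀ l : G.V → Γ, P' G l ↔ P G l ∧
    ∀ e : Fin m → G.V, G.IsWindow e → (∀ u, G.IsEnd u → ∀ i, N ≤ G.dist u (e i)) →
      (fun i => l (e i)) ∈ C

end LocalMending

open LocalMending

namespace LocalMending

/-! ### Integer coordinates on paths and cycles -/

/-! Away from the ends of a path, a solution is a walk in the diagram of `ψ`. Fix a usable flexible
state `s` and let `C` be its strongly connected component, or just `{s}` if `s` is a constant word
with a self-loop. Flexibility makes `C` primitive: any two of its states are joined inside `C` by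
walks of every large length (`isPrimitive_component`). `Restricted` adds to `ψ` the demand that
words away from the ends lie in `C`, and this makes repairs local. To mend at a node, go a constant
distance to either side and stop at a kept word of `C`, at a hole, or at the end of a path; then
join the two stopping words by a walk in `C` of exactly the right length (`exists_mend`). Next to a
hole any word of `C` may be written, since nodes that see a hole are exempt. At an end a fixed
segment bordered by `s` is used; it exists because `s` is usable.

For the complexity it must be shown that an algorithm for the original problem yields one for the
restricted problem. If the original problem is solvable in constant time, a Ramsey-type argument on
increasing identifiers (`exists_shift_eq`) forces a long constant run of labels, hence a usable
state with a self-loop (`exists_const_of_fast`), and repeating its label between two end segments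
takes constant time. Otherwise no constant word is both feasible and usable, and this turns every
algorithm into a colouring. Execute it on every `d`-th node only, and let each node record the
labels of itself and of the next `2 * r` sampled nodes. If two nodes at distance `d` had the same
record, the labels would be constant along `2 * r + 2` sampled nodes, which is excluded
(`stepColor_ne`). The records for all `d ≤ a` form a colouring with constantly many colours in which
nodes at distance at most `a` differ. A greedy independent set then gives anchors with bounded gaps,
which are filled by closed walks at `s` (`exists_solver`). Every running time is thus preserved up
to constants, without a classification of the possible complexities.

A usable flexible state exists because an algorithm cannot tell whether two far apart blocks of
identifiers have been moved by one position, which gives closed walks of two consecutive lengths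
(`exists_flexible_usable`). The `log*` bound is used only through its being sublinear. -/

theorem Inst.n_pos (G : Inst) : 0 < G.n := by
  obtain ⟨k, n, hn⟩ := G
  cases k <;> simp only at hn ⊢ <;> omega

theorem Inst.three_le_of_cycle (G : Inst) (h : G.kind = Kind.cycle) : 3 ≤ G.n := by
  obtain ⟨k, n, hn⟩ := G
  subst h
  exact hn

/-- The node with integer coordinate `i`, if there is one; coordinates on a cycle are periodic. -/
def Inst.node (G : Inst) (i : ℤ) : Option G.V :=
  match G.kind with
  | Kind.path => if h : 0 ≤ i ∧ i < G.n then some ⟨i.toNat, by omega⟩ else none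
  | Kind.cycle => some ⟨(i % G.n).toNat, by
      have h0 : (0 : ℤ) < G.n := by exact_mod_cast G.n_pos
      have h1 := Int.emod_nonneg i h0.ne'
      have h2 := Int.emod_lt_of_pos i h0
      omega⟩

theorem Inst.node_path {G : Inst} (hG : G.kind = Kind.path) {i : ℤ} {u : G.V} :
    G.node i = some u ↔ i = u.val := by
  unfold Inst.node
  have := u.isLt
  rw [hG]
  simp only
  split_ifs with h
  · simp only [Option.some.injEq, Fin.ext_iff]
    omega
  · simp only [false_iff]
    omega

theorem Inst.node_cycle {G : Inst} (hG : G.kind = Kind.cycle) {i : ℤ} {u : G.V} :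
    G.node i = some u ↔ i % G.n = u.val := by
  unfold Inst.node
  have h0 : (0 : ℤ) < G.n := by exact_mod_cast G.n_pos
  have h1 := Int.emod_nonneg i h0.ne'
  rw [hG]
  simp only [Option.some.injEq, Fin.ext_iff]
  omega

theorem Inst.node_path_isSome {G : Inst} (hG : G.kind = Kind.path) {i : ℤ} :
    (G.node i).isSome ↔ 0 ≤ i ∧ i < G.n := by
  rw [Option.isSome_iff_exists]
  simp only [Inst.node_path hG]
  constructor
  · rintro ⟨u, rfl⟩
    have := u.isLt
    omega
  · rintro ⟨h1, h2⟩
    exact ⟨⟨i.toNat, by omega⟩, by simp only; omega⟩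

theorem Inst.node_cycle_isSome {G : Inst} (hG : G.kind = Kind.cycle) (i : ℤ) :
    (G.node i).isSome := by
  unfold Inst.node
  rw [hG]
  rfl

theorem Inst.node_of_range {G : Inst} {i : ℤ} (h0 : 0 ≤ i) (h1 : i < G.n) :
    G.node i = some ⟨i.toNat, by omega⟩ := by
  cases hG : G.kind with
  | path => rw [Inst.node_path hG]; simp only; omega
  | cycle => rw [Inst.node_cycle hG, Int.emod_eq_of_lt h0 h1]; simp only; omega

@[simp] theorem Inst.node_val (G : Inst) (v : G.V) : G.node (v.val : ℤ) = some v := by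
  rw [Inst.node_of_range (by omega) (by exact_mod_cast v.isLt)]
  simp

theorem Inst.succ_eq_node {G : Inst} {i : ℤ} {u : G.V} (h : G.node i = some u) :
    G.succ u = G.node (i + 1) := by
  have hu := u.isLt
  cases hG : G.kind with
  | path =>
    rw [Inst.node_path hG] at h
    subst h
    have : G.succ u = if h : u.val + 1 < G.n then some ⟨u.val + 1, h⟩ else none := by
      unfold Inst.succ
      rw [hG]
    rw [this]
    split_ifs with h
    · rw [eq_comm, Inst.node_path hG]
      push_cast; rfl
    · rw [eq_comm, ← Option.not_isSome_iff_eq_none, Inst.node_path_isSome hG]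
      omega
  | cycle =>
    rw [Inst.node_cycle hG] at h
    have : G.succ u = some ⟨(u.val + 1) % G.n, Nat.mod_lt _ u.pos⟩ := by
      unfold Inst.succ
      rw [hG]
    rw [this, eq_comm, Inst.node_cycle hG]
    push_cast
    rw [← h, Int.emod_add_emod]

theorem Inst.pred_eq_node {G : Inst} {i : ℤ} {u : G.V} (h : G.node i = some u) :
    G.pred u = G.node (i - 1) := by
  have hu := u.isLt
  cases hG : G.kind with
  | path =>
    rw [Inst.node_path hG] at h
    subst h
    have : G.pred u = if u.val = 0 then none else some ⟨u.val - 1, by omega⟩ := by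
      unfold Inst.pred
      rw [hG]
    rw [this]
    split_ifs with h
    · rw [eq_comm, ← Option.not_isSome_iff_eq_none, Inst.node_path_isSome hG]
      omega
    · rw [eq_comm, Inst.node_path hG]
      simp only
      omega
  | cycle =>
    rw [Inst.node_cycle hG] at h
    have : G.pred u = some ⟨(u.val + (G.n - 1)) % G.n, Nat.mod_lt _ u.pos⟩ := by
      unfold Inst.pred
      rw [hG]
    rw [this, eq_comm, Inst.node_cycle hG]
    have h1 : ((u.val + (G.n - 1) : ℕ) : ℤ) = (u.val : ℤ) - 1 + G.n := by omega
    simp only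
    rw [Int.natCast_mod, h1, Int.add_emod_right, ← h, Int.emod_sub_emod]

theorem Inst.node_inj {G : Inst} {i j : ℤ} {u : G.V} (hi : G.node i = some u)
    (hj : G.node j = some u) (h : |i - j| < G.n) : i = j := by
  cases hG : G.kind with
  | path =>
    rw [Inst.node_path hG] at hi hj
    omega
  | cycle =>
    rw [Inst.node_cycle hG] at hi hj
    have h1 : (i - j) % G.n = 0 := Int.emod_eq_emod_iff_emod_sub_eq_zero.1 (hi.trans hj.symm)
    have h2 := Int.eq_zero_of_abs_lt_dvd (Int.dvd_of_emod_eq_zero h1) h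
    omega

theorem Inst.node_add_n {G : Inst} (hG : G.kind = Kind.cycle) (i : ℤ) :
    G.node (i + G.n) = G.node i := by
  have h := Inst.node_cycle_isSome hG i
  obtain ⟨u, hu⟩ := Option.isSome_iff_exists.1 h
  rw [hu, Inst.node_cycle hG, Int.add_emod_right, ← Inst.node_cycle hG, hu]

theorem Inst.node_isSome_mid {G : Inst} {i j k : ℤ} (hi : (G.node i).isSome)
    (hk : (G.node k).isSome) (h1 : i ≤ j) (h2 : j ≤ k) : (G.node j).isSome := by
  cases hG : G.kind with
  | path =>
    rw [Inst.node_path_isSome hG] at *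
    omega
  | cycle => exact Inst.node_cycle_isSome hG j

theorem Inst.succ_eq_some_iff_node {G : Inst} {i : ℤ} {u w : G.V} (h : G.node i = some u) :
    G.succ u = some w ↔ G.node (i + 1) = some w := by
  rw [Inst.succ_eq_node h]

/-! ### Distances -/

theorem Inst.adj_of_node {G : Inst} {i : ℤ} {u w : G.V} (hu : G.node i = some u)
    (hw : G.node (i + 1) = some w) : G.graph.Adj u w := by
  rw [Inst.graph, SimpleGraph.fromRel_adj]
  refine ⟨?_, Or.inl ((Inst.succ_eq_some_iff_node hu).2 hw)⟩
  rintro rfl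
  cases hG : G.kind with
  | path =>
    rw [Inst.node_path hG] at hu hw
    omega
  | cycle =>
    have h3 := G.three_le_of_cycle hG
    have := Inst.node_inj hu hw (by rw [abs_lt]; omega)
    omega

theorem Inst.exists_walk_nat {G : Inst} (k : ℕ) : ∀ {i : ℤ} {u w : G.V}, G.node i = some u →
    G.node (i + k) = some w → ∃ p : G.graph.Walk u w, p.length = k := by
  induction k with
  | zero =>
    intro i u w hu hw
    simp only [Nat.cast_zero, add_zero] at hw
    obtain rfl : u = w := by rw [hu] at hw; exact Option.some.inj hw
    exact ⟨SimpleGraph.Walk.nil, rfl⟩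
  | succ k ih =>
    intro i u w hu hw
    have h1 : (G.node (i + 1)).isSome :=
      Inst.node_isSome_mid (by rw [hu]; rfl) (by rw [hw]; rfl) (by omega)
        (show i + 1 ≤ i + ((k + 1 : ℕ) : ℤ) by push_cast; omega)
    obtain ⟨x, hx⟩ := Option.isSome_iff_exists.1 h1
    obtain ⟨p, hp⟩ := ih hx (by rw [← hw]; congr 1; push_cast; ring)
    exact ⟨SimpleGraph.Walk.cons (Inst.adj_of_node hu hx) p, by simp [hp]⟩

theorem Inst.exists_walk {G : Inst} {i j : ℤ} {u w : G.V} (hu : G.node i = some u)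
    (hw : G.node j = some w) : ∃ p : G.graph.Walk u w, p.length = (j - i).natAbs := by
  rcases le_total i j with h | h
  · exact Inst.exists_walk_nat _ hu (by rw [← hw]; congr 1; omega)
  · obtain ⟨p, hp⟩ := Inst.exists_walk_nat (j - i).natAbs hw (by rw [← hu]; congr 1; omega)
    exact ⟨p.reverse, by simp [hp]⟩

/-- Path lifting: every edge changes the coordinate by one, so a walk on a cycle lifts to the line
that covers it. -/
theorem Inst.node_of_walk {G : Inst} {u w : G.V} (p : G.graph.Walk u w) :
    ∀ i : ℤ, G.node i = some u → ∃ j : ℤ, |j - i| ≤ p.length ∧ G.node j = some w := by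
  induction p with
  | nil => intro i hi; exact ⟨i, by simp, hi⟩
  | @cons a b c hab p ih =>
    intro i hi
    rw [Inst.graph, SimpleGraph.fromRel_adj] at hab
    rw [SimpleGraph.Walk.length_cons]
    push_cast
    rcases hab.2 with h | h
    · obtain ⟨j, hj, hj'⟩ := ih (i + 1) ((Inst.succ_eq_some_iff_node hi).1 h)
      refine ⟨j, ?_, hj'⟩
      rw [abs_le] at *
      omega
    · rw [← Inst.pred_eq_some_iff, Inst.pred_eq_node hi] at h
      obtain ⟨j, hj, hj'⟩ := ih (i - 1) h
      refine ⟨j, ?_, hj'⟩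
      rw [abs_le] at *
      omega

theorem Inst.dist_le_of_node {G : Inst} {i j : ℤ} {u w : G.V} (hu : G.node i = some u)
    (hw : G.node j = some w) {k : ℕ} (h : |j - i| ≤ k) : G.dist u w ≤ k := by
  obtain ⟨p, hp⟩ := Inst.exists_walk hu hw
  have := SimpleGraph.dist_le p
  rw [Inst.dist]
  rw [abs_le] at h
  omega

theorem Inst.dist_le_iff {G : Inst} {i : ℤ} {u w : G.V} (hu : G.node i = some u) {k : ℕ} :
    G.dist u w ≤ k ↔ ∃ j : ℤ, |j - i| ≤ k ∧ G.node j = some w := by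
  constructor
  · intro h
    obtain ⟨p, -⟩ := Inst.exists_walk hu (G.node_val w)
    obtain ⟨q, hq⟩ := p.reachable.exists_walk_length_eq_dist
    obtain ⟨j, hj, hj'⟩ := Inst.node_of_walk q i hu
    refine ⟨j, hj.trans ?_, hj'⟩
    rw [hq]
    exact_mod_cast h
  · rintro ⟨j, hj, hj'⟩
    exact Inst.dist_le_of_node hu hj' hj

theorem Inst.dist_lt_n (G : Inst) (u w : G.V) : G.dist u w < G.n := by
  have h1 := u.isLt
  have h2 := w.isLt
  have : G.dist u w ≤ G.n - 1 :=
    Inst.dist_le_of_node (G.node_val u) (G.node_val w) (by rw [abs_le]; omega)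
  have := G.n_pos
  omega

theorem Inst.dist_path_le_iff {G : Inst} (hG : G.kind = Kind.path) {u w : G.V} {k : ℕ} :
    G.dist u w ≤ k ↔ |(w.val : ℤ) - u.val| ≤ k := by
  rw [Inst.dist_le_iff (G.node_val u)]
  simp only [Inst.node_path hG]
  constructor
  · rintro ⟨j, hj, rfl⟩
    exact hj
  · intro h
    exact ⟨_, h, rfl⟩

/-! ### Unrolled labelings -/

/-- The label at each integer coordinate. -/
def Inst.unroll {α : Type*} (G : Inst) (l : G.V → α) (i : ℤ) : Option α := (G.node i).map l

theorem Inst.unroll_of_node {α : Type*} {G : Inst} {l : G.V → α} {i : ℤ} {u : G.V}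
    (h : G.node i = some u) : G.unroll l i = some (l u) := by
  rw [Inst.unroll, h]; rfl

theorem Inst.unroll_val {α : Type*} (G : Inst) (l : G.V → α) (v : G.V) :
    G.unroll l (v.val : ℤ) = some (l v) := Inst.unroll_of_node (G.node_val v)

theorem Inst.unroll_isSome {α : Type*} {G : Inst} {l : G.V → α} {i : ℤ} :
    (G.unroll l i).isSome = (G.node i).isSome := by
  simp [Inst.unroll]

theorem Inst.unroll_eq_some {α : Type*} {G : Inst} {l : G.V → α} {i : ℤ} {a : α} :
    G.unroll l i = some a ↔ ∃ u, G.node i = some u ∧ l u = a := by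
  simp [Inst.unroll]

theorem Inst.unroll_eq_none {α : Type*} {G : Inst} {l : G.V → α} {i : ℤ} :
    G.unroll l i = none ↔ G.node i = none := by
  simp [Inst.unroll]

/-- The ball of radius `r` in integer coordinates. -/
noncomputable def Inst.ballEquiv (G : Inst) (v : G.V) (r : ℕ) (hr : 2 * r + 1 ≤ G.n) :
    {j : ℤ // |j| ≤ r ∧ (G.node (v.val + j)).isSome} ≃ {u : G.V // G.dist v u ≤ r} :=
  Equiv.ofBijective
    (fun j => ⟨(G.node (v.val + j.val)).get j.2.2,
      Inst.dist_le_of_node (G.node_val v) (Option.some_get j.2.2).symm (by simpa using j.2.1)⟩) (by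
    constructor
    · rintro ⟨i, hi, hi'⟩ ⟨j, hj, hj'⟩ h
      simp only [Subtype.mk.injEq] at h
      have h1 : G.node (v.val + i) = some ((G.node (v.val + i)).get hi') := by simp
      have h2 : G.node (v.val + j) = some ((G.node (v.val + i)).get hi') := by rw [h]; simp
      have := Inst.node_inj h1 h2 (by rw [abs_lt]; rw [abs_le] at hi hj; omega)
      simpa using this
    · rintro ⟨u, hu⟩
      obtain ⟨j, hj, hj'⟩ := (Inst.dist_le_iff (G.node_val v)).1 hu
      have h1 : (v.val : ℤ) + (j - v.val) = j := by ring
      refine ⟨⟨j - v.val, hj, by rw [h1, hj']; rfl⟩, ?_⟩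
      simp only [h1, hj', Option.get_some])

theorem Inst.node_ballEquiv (G : Inst) (v : G.V) (r : ℕ) (hr : 2 * r + 1 ≤ G.n)
    (j : {j : ℤ // |j| ≤ r ∧ (G.node (v.val + j)).isSome}) :
    G.node (v.val + j.val) = some (G.ballEquiv v r hr j).val := by
  exact (Option.some_get j.2.2).symm

/-- With `2 * r + 2` nodes the ball never closes up: on a cycle with `2 * r + 1` nodes its two
extreme nodes would be adjacent, and the labels alone would not reveal this edge. -/
theorem sameNeighborhood_of_unroll {Γ : Type*} {r : ℕ} {G G' : Inst} {l : G.V → Γ} {l' : G'.V → Γ}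
    {v : G.V} {v' : G'.V} (hn : 2 * r + 2 ≤ G.n) (hn' : 2 * r + 2 ≤ G'.n)
    (h : ∀ j : ℤ, |j| ≤ r → G.unroll l (v.val + j) = G'.unroll l' (v'.val + j)) :
    SameNeighborhood r G l v G' l' v' := by
  have hsome : ∀ j : ℤ, (|j| ≤ r ∧ (G.node (v.val + j)).isSome) ↔
      (|j| ≤ r ∧ (G'.node (v'.val + j)).isSome) := by
    intro j
    refine and_congr_right fun hj => ?_
    rw [← Inst.unroll_isSome (l := l), h j hj, Inst.unroll_isSome]
  let e₁ := G.ballEquiv v r (by omega)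
  let e₂ := G'.ballEquiv v' r (by omega)
  let e₀ := Equiv.subtypeEquivRight hsome
  have key : ∀ j, (e₁.symm.trans (e₀.trans e₂)) (e₁ j) = e₂ (e₀ j) := by intro j; simp
  have h1 : ∀ j, G.node (v.val + j.val) = some (e₁ j).val := Inst.node_ballEquiv G v r _
  have h2 : ∀ j, G'.node (v'.val + j.val) = some (e₂ j).val := Inst.node_ballEquiv G' v' r _
  have h0 : ∀ j, (e₀ j).val = j.val := fun j => rfl
  refine ⟨e₁.symm.trans (e₀.trans e₂), ?_, ?_, ?_⟩
  · intro a
    obtain ⟨⟨j, hj⟩, rfl⟩ := e₁.surjective a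
    rw [key]
    have g1 := h1 ⟨j, hj⟩
    have g2 := h2 (e₀ ⟨j, hj⟩)
    rw [h0] at g2
    simp only at g1 g2
    have hjr := abs_le.1 hj.1
    constructor
    · intro h
      rw [h] at g1
      have := Inst.node_inj g1 (G.node_val v) (by rw [abs_lt]; omega)
      have hj0 : j = 0 := by omega
      have : G'.node (v'.val + j) = some v' := by rw [hj0, add_zero, Inst.node_val]
      exact Option.some.inj (g2.symm.trans this)
    · intro h
      rw [h] at g2
      have := Inst.node_inj g2 (G'.node_val v') (by rw [abs_lt]; omega)
      have hj0 : j = 0 := by omega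
      have : G.node (v.val + j) = some v := by rw [hj0, add_zero, Inst.node_val]
      exact Option.some.inj (g1.symm.trans this)
  · intro a b
    obtain ⟨⟨j, hj⟩, rfl⟩ := e₁.surjective a
    obtain ⟨⟨k, hk⟩, rfl⟩ := e₁.surjective b
    rw [key, key]
    have g1 := h1 ⟨j, hj⟩
    have g2 := h2 (e₀ ⟨j, hj⟩)
    have f1 := h1 ⟨k, hk⟩
    have f2 := h2 (e₀ ⟨k, hk⟩)
    rw [h0] at g2 f2
    simp only at g1 g2 f1 f2
    have hjr := abs_le.1 hj.1
    have hkr := abs_le.1 hk.1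
    rw [Inst.succ_eq_some_iff_node g1, Inst.succ_eq_some_iff_node g2]
    constructor
    · intro h
      have := Inst.node_inj h f1 (by rw [abs_lt]; omega)
      rw [show (v'.val : ℤ) + j + 1 = v'.val + k by omega, f2]
    · intro h
      have := Inst.node_inj h f2 (by rw [abs_lt]; omega)
      rw [show (v.val : ℤ) + j + 1 = v.val + k by omega, f1]
  · intro a
    obtain ⟨⟨j, hj⟩, rfl⟩ := e₁.surjective a
    rw [key]
    have g1 := Inst.unroll_of_node (l := l) (h1 ⟨j, hj⟩)
    have g2 := Inst.unroll_of_node (l := l') (h2 (e₀ ⟨j, hj⟩))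
    rw [h0] at g2
    simp only at g1 g2
    rw [h j hj.1, g2] at g1
    exact (Option.some.inj g1).symm

theorem SameNeighborhood.refl_of_eq {Γ : Type*} {r : ℕ} {G : Inst} {l l' : G.V → Γ} {v : G.V}
    (h : ∀ u, G.dist v u ≤ r → l u = l' u) : SameNeighborhood r G l v G l' v :=
  ⟨Equiv.refl _, fun _ => Iff.rfl, fun _ _ => Iff.rfl, fun a => h a.val a.2⟩

theorem SameNeighborhood.symm {Γ : Type*} {r : ℕ} {G G' : Inst} {l : G.V → Γ} {l' : G'.V → Γ}
    {v : G.V} {v' : G'.V} (h : SameNeighborhood r G l v G' l' v') :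
    SameNeighborhood r G' l' v' G l v := by
  obtain ⟨e, h1, h2, h3⟩ := h
  refine ⟨e.symm, ?_, ?_, ?_⟩
  · intro a
    rw [h1 (e.symm a), e.apply_symm_apply]
  · intro a b
    rw [h2 (e.symm a), e.apply_symm_apply, e.apply_symm_apply]
  · intro a
    rw [h3 (e.symm a), e.apply_symm_apply]

/-- Since edges are directed and in- and out-neighbours are unique, an isomorphism that fixes the
centre has no freedom left; induct outwards from the centre. No lower bound on the number of nodes
is needed. -/
theorem node_of_ball_iso {r : ℕ} {G G' : Inst} {v : G.V} {v' : G'.V}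
    (e : {u : G.V // G.dist v u ≤ r} ≃ {u : G'.V // G'.dist v' u ≤ r})
    (h1 : ∀ a, a.val = v ↔ (e a).val = v')
    (h2 : ∀ a b, G.succ a.val = some b.val ↔ G'.succ (e a).val = some (e b).val) (k : ℕ) :
    ∀ j : ℤ, j.natAbs = k → k ≤ r → ∀ u (hu : G.dist v u ≤ r), G.node (v.val + j) = some u →
      G'.node (v'.val + j) = some (e ⟨u, hu⟩).val := by
  induction k with
  | zero =>
    intro j hj _ u hu hn
    obtain rfl : j = 0 := by omega
    simp only [add_zero, Inst.node_val, Option.some.injEq] at hn ⊢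
    exact ((h1 ⟨u, hu⟩).1 hn.symm).symm
  | succ k ih =>
    intro j hj hk u hu hn
    have hs : (G.node (v.val : ℤ)).isSome := by rw [Inst.node_val]; rfl
    have hs' : (G.node (v.val + j)).isSome := by rw [hn]; rfl
    rcases lt_or_gt_of_ne (show j ≠ 0 by omega) with hneg | hpos
    · obtain ⟨w, hw⟩ := Option.isSome_iff_exists.1
        (Inst.node_isSome_mid hs' hs (show (v.val : ℤ) + j ≤ v.val + (j + 1) by omega) (by omega))
      have hwr : G.dist v w ≤ r :=
        Inst.dist_le_of_node (G.node_val v) hw (by rw [abs_le]; omega)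
      have := ih (j + 1) (by omega) (by omega) w hwr hw
      have hsucc : G.succ u = some w := by
        rw [Inst.succ_eq_some_iff_node hn, add_assoc, hw]
      rw [h2 ⟨u, hu⟩ ⟨w, hwr⟩, ← Inst.pred_eq_some_iff, Inst.pred_eq_node this] at hsucc
      rw [← hsucc]
      congr 1
      ring
    · obtain ⟨w, hw⟩ := Option.isSome_iff_exists.1
        (Inst.node_isSome_mid hs hs' (show (v.val : ℤ) ≤ v.val + (j - 1) by omega) (by omega))
      have hwr : G.dist v w ≤ r :=
        Inst.dist_le_of_node (G.node_val v) hw (by rw [abs_le]; omega)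
      have := ih (j - 1) (by omega) (by omega) w hwr hw
      have hsucc : G.succ w = some u := by
        rw [Inst.succ_eq_some_iff_node hw, ← hn]
        congr 1
        ring
      rw [h2 ⟨w, hwr⟩ ⟨u, hu⟩, Inst.succ_eq_some_iff_node this] at hsucc
      rw [← hsucc]
      congr 1
      ring

theorem SameNeighborhood.unroll_imp {Γ : Type*} {r : ℕ} {G G' : Inst} {l : G.V → Γ}
    {l' : G'.V → Γ} {v : G.V} {v' : G'.V} (h : SameNeighborhood r G l v G' l' v') {j : ℤ}
    (hj : |j| ≤ r) {a : Γ} (ha : G.unroll l (v.val + j) = some a) :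
    G'.unroll l' (v'.val + j) = some a := by
  obtain ⟨e, h1, h2, h3⟩ := h
  obtain ⟨u, hu, rfl⟩ := Inst.unroll_eq_some.1 ha
  have hur : G.dist v u ≤ r := Inst.dist_le_of_node (G.node_val v) hu (by simpa using hj)
  have := node_of_ball_iso e h1 h2 j.natAbs j rfl
    (by rw [abs_le] at hj; omega) u hur hu
  rw [Inst.unroll_of_node this, h3 ⟨u, hur⟩]

theorem SameNeighborhood.unroll_eq {Γ : Type*} {r : ℕ} {G G' : Inst} {l : G.V → Γ}
    {l' : G'.V → Γ} {v : G.V} {v' : G'.V} (h : SameNeighborhood r G l v G' l' v') {j : ℤ}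
    (hj : |j| ≤ r) : G.unroll l (v.val + j) = G'.unroll l' (v'.val + j) :=
  Option.ext fun _ => ⟨fun ha => h.unroll_imp hj ha, fun ha => h.symm.unroll_imp hj ha⟩

theorem SameNeighborhood.mono {Γ : Type*} {r R : ℕ} (hr : r ≤ R) {G G' : Inst} {l : G.V → Γ}
    {l' : G'.V → Γ} {v : G.V} {v' : G'.V} (h : SameNeighborhood R G l v G' l' v') :
    SameNeighborhood r G l v G' l' v' := by
  have key : ∀ {G G' : Inst} {v : G.V} {v' : G'.V}
      (e : {u : G.V // G.dist v u ≤ R} ≃ {u : G'.V // G'.dist v' u ≤ R}),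
      (∀ a, a.val = v ↔ (e a).val = v') →
      (∀ a b, G.succ a.val = some b.val ↔ G'.succ (e a).val = some (e b).val) →
      ∀ a, G.dist v a.val ≤ r → G'.dist v' (e a).val ≤ r := by
    intro G G' v v' e h1 h2 a ha
    obtain ⟨j, hj, hj'⟩ := (Inst.dist_le_iff (G.node_val v)).1 ha
    have := node_of_ball_iso e h1 h2 (j - v.val).natAbs
      (j - v.val) rfl (by rw [abs_le] at hj; omega) a.val a.2 (by rw [← hj']; congr 1; ring)
    exact Inst.dist_le_of_node (G'.node_val v') this (by simpa using hj)
  have hs := h.symm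
  obtain ⟨e, h1, h2, h3⟩ := h
  have h1' : ∀ a, a.val = v' ↔ (e.symm a).val = v := fun a => by
    rw [h1 (e.symm a), e.apply_symm_apply]
  have h2' : ∀ a b, G'.succ a.val = some b.val ↔
      G.succ (e.symm a).val = some (e.symm b).val := fun a b => by
    rw [h2 (e.symm a), e.apply_symm_apply, e.apply_symm_apply]
  refine ⟨⟨fun a => ⟨(e ⟨a.val, a.2.trans hr⟩).val, key e h1 h2 _ a.2⟩,
    fun a => ⟨(e.symm ⟨a.val, a.2.trans hr⟩).val,
      key e.symm h1' h2' _ a.2⟩, ?_, ?_⟩, ?_, ?_, ?_⟩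
  · intro a; simp
  · intro a; simp
  · intro a; exact h1 ⟨a.val, a.2.trans hr⟩
  · intro a b; exact h2 ⟨a.val, a.2.trans hr⟩ ⟨b.val, b.2.trans hr⟩
  · intro a; exact h3 ⟨a.val, a.2.trans hr⟩

theorem Inst.lt_card_ball (G : Inst) (v : G.V) {R : ℕ} (hR : R < G.n) :
    R < Nat.card {u : G.V // G.dist v u ≤ R} := by
  have hv := v.isLt
  -- These are `R + 1` consecutive coordinates that contain `v` and do not run over the last node.
  have hinj : Function.Injective (fun i : Fin (R + 1) =>
      (⟨⟨min v.val (G.n - 1 - R) + i.val, by have := i.isLt; omega⟩,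
        Inst.dist_le_of_node (G.node_val v) (G.node_val _) (by
          have := i.isLt
          rw [abs_le]
          push_cast
          omega)⟩ : {u : G.V // G.dist v u ≤ R})) := by
    intro i j h
    simp only [Subtype.mk.injEq, Fin.mk.injEq] at h
    ext
    omega
  have := Nat.card_le_card_of_injective _ hinj
  simpa using this

theorem Inst.card_ball_le (G : Inst) (v : G.V) (R : ℕ) :
    Nat.card {u : G.V // G.dist v u ≤ R} ≤ G.n := by
  have := Nat.card_le_card_of_injective (Subtype.val : {u : G.V // G.dist v u ≤ R} → G.V)
    Subtype.val_injective
  simpa using this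

/-- A ball of radius `R` has more than `R` nodes or is the whole graph, so counting its nodes
decides whether there are at least `N ≤ R + 1` of them. This makes the size test in `Restricted` a
local condition. -/
theorem SameNeighborhood.lt_n {Γ : Type*} {R : ℕ} {G G' : Inst} {l : G.V → Γ}
    {l' : G'.V → Γ} {v : G.V} {v' : G'.V} (h : SameNeighborhood R G l v G' l' v')
    {N : ℕ} (hN : N ≤ R + 1) (hn : N ≤ G.n) : N ≤ G'.n := by
  by_contra hlt
  obtain ⟨e, -⟩ := h
  have h1 := Nat.card_congr e
  have h2 := G'.card_ball_le v' R
  rcases Nat.lt_or_ge R G.n with h3 | h3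
  · have := G.lt_card_ball v h3
    omega
  · have h4 : Nat.card {u : G.V // G.dist v u ≤ R} = G.n := by
      have e' : {u : G.V // G.dist v u ≤ R} ≃ G.V :=
        Equiv.subtypeUnivEquiv fun u => (G.dist_lt_n v u).le.trans h3
      rw [Nat.card_congr e', Nat.card_eq_fintype_card, Fintype.card_fin]
    omega

/-! ### Happiness in terms of the words of an unrolled labeling -/

section Verifier

variable {Γ : Type*} {K : Set Kind} {r : ℕ} {ψ : Verifier Γ}

/-- The word of length `m` at position `i` of a labeling of the integers. -/
def word (m : ℕ) (x : ℤ → Γ) (i : ℤ) : Fin m → Γ := fun j => x (i + (j.val : ℤ))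

theorem Inst.node_add {G : Inst} {i : ℤ} {u : G.V} (h : G.node i = some u) (j : ℤ) :
    G.node (i + j) = G.node (u.val + j) := by
  cases hG : G.kind with
  | path => rw [(Inst.node_path hG).1 h]
  | cycle =>
    rw [Inst.node_cycle hG] at h
    obtain ⟨w, hw⟩ := Option.isSome_iff_exists.1 (Inst.node_cycle_isSome hG (u.val + j))
    rw [hw, Inst.node_cycle hG, ← (Inst.node_cycle hG).1 hw, ← h, Int.emod_add_emod]

theorem Inst.IsWindow.node {G : Inst} {m : ℕ} {e : Fin m → G.V} (he : G.IsWindow e) {a : ℤ}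
    (h0 : 0 < m) (ha : G.node a = some (e ⟨0, h0⟩)) :
    ∀ (k : ℕ) (hk : k < m), G.node (a + k) = some (e ⟨k, hk⟩) := by
  intro k
  induction k with
  | zero => intro hk; simpa using ha
  | succ k ih =>
    intro hk
    have h1 := ih (by omega)
    have h2 := he ⟨k, by omega⟩ ⟨k + 1, hk⟩ rfl
    rw [Inst.succ_eq_some_iff_node h1] at h2
    rw [← h2]
    push_cast
    congr 1
    ring

theorem Inst.isWindow_of_node {G : Inst} {m : ℕ} {e : Fin m → G.V} {a : ℤ}
    (h : ∀ i : Fin m, G.node (a + i.val) = some (e i)) : G.IsWindow e := by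
  intro i j hij
  rw [Inst.succ_eq_some_iff_node (h i), ← h j, hij]
  push_cast
  congr 1
  ring

theorem psi_congr (hψ : IsLocal K r ψ) {G G' : Inst} (hG : G.kind ∈ K) (hG' : G'.kind ∈ K)
    (hn : 2 * r + 2 ≤ G.n) (hn' : 2 * r + 2 ≤ G'.n) {l : G.V → Γ} {l' : G'.V → Γ} {v : G.V}
    {v' : G'.V} (h : ∀ j : ℤ, |j| ≤ r → G.unroll l (v.val + j) = G'.unroll l' (v'.val + j)) :
    ψ G l v ↔ ψ G' l' v' :=
  hψ G l v G' l' v' hG hG' (sameNeighborhood_of_unroll hn hn' h)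

/-- `Feasible` asks for just one graph that realizes the word, but by locality all realizations in
graphs with `2 * r + 2` nodes agree. -/
theorem psi_iff_feasible (hψ : IsLocal K r ψ) {G : Inst} (hG : G.kind ∈ K)
    (hn : 2 * r + 2 ≤ G.n) {l : G.V → Γ} {v : G.V} {w : Fin (2 * r + 1) → Γ}
    (h : ∀ i : Fin (2 * r + 1), G.unroll l (v.val - r + i.val) = some (w i)) :
    ψ G l v ↔ Feasible K r ψ w := by
  constructor
  · intro hv
    choose e he hw using fun i => Inst.unroll_eq_some.1 (h i)
    refine ⟨G, hG, hn, e, l, Inst.isWindow_of_node he, hw, ?_⟩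
    have : e ⟨r, by omega⟩ = v := by
      have h1 := he ⟨r, by omega⟩
      simp only [sub_add_cancel, Inst.node_val] at h1
      exact (Option.some.inj h1).symm
    rwa [this]
  · rintro ⟨G', hG', hn', e, l', he, hw, hv⟩
    refine (psi_congr hψ hG hG' hn hn' fun j hj => ?_).2 hv
    rw [abs_le] at hj
    have h0 := he.node (by omega) (G'.node_val _)
    have h1 := h0 r (by omega)
    have h2 := h0 (j + r).toNat (by omega)
    have h3 := h ⟨(j + r).toNat, by omega⟩
    have h4 : ((j + r).toNat : ℤ) = j + r := by omega
    have h5 : G'.node ((e ⟨r, by omega⟩).val + j) = some (e ⟨(j + r).toNat, by omega⟩) := by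
      rw [← Inst.node_add h1, ← h2, h4]
      congr 1
      ring
    rw [Inst.unroll_of_node h5, hw, ← h3]
    congr 1
    simp only [h4]
    ring

/-! ### Walks in the diagram -/

/-- There is a walk of length `k` from `s` to `s'`. -/
def HasWalk {S : Type*} (E : S → S → Prop) (k : ℕ) (s s' : S) : Prop :=
  ∃ p : ℕ → S, p 0 = s ∧ p k = s' ∧ ∀ i < k, E (p i) (p (i + 1))

theorem HasWalk.trans {S : Type*} {E : S → S → Prop} {k m : ℕ} {a b c : S}
    (h₁ : HasWalk E k a b) (h₂ : HasWalk E m b c) : HasWalk E (k + m) a c := by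
  obtain ⟨p, p0, pk, hp⟩ := h₁
  obtain ⟨q, q0, qm, hq⟩ := h₂
  refine ⟨fun i => if i < k then p i else q (i - k), ?_, ?_, ?_⟩
  · by_cases hk : 0 < k
    · simp [hk, p0]
    · obtain rfl : k = 0 := by omega
      simp [q0, ← pk, p0]
  · simp [qm]
  · intro i hi
    by_cases h1 : i + 1 < k
    · simp only [h1, show i < k by omega, if_true]
      exact hp i (by omega)
    · by_cases h2 : i < k
      · obtain rfl : k = i + 1 := by omega
        simp only [h2, if_true, lt_irrefl, if_false, Nat.sub_self, q0]
        rw [← pk]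
        exact hp i h2
      · simp only [h1, h2, if_false, show i + 1 - k = i - k + 1 by omega]
        exact hq _ (by omega)

theorem hasWalk_zero {S : Type*} (E : S → S → Prop) (a : S) : HasWalk E 0 a a :=
  ⟨fun _ => a, rfl, rfl, fun i hi => absurd hi (Nat.not_lt_zero i)⟩

theorem hasWalk_one {S : Type*} {E : S → S → Prop} {a b : S} (h : E a b) : HasWalk E 1 a b :=
  ⟨fun i => if i = 0 then a else b, rfl, rfl, fun i hi => by
    obtain rfl : i = 0 := by omega
    simpa using h⟩

theorem exists_hasWalk {S : Type*} {E : S → S → Prop} {a b : S}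
    (h : Relation.ReflTransGen E a b) : ∃ k, HasWalk E k a b := by
  induction h with
  | refl => exact ⟨0, hasWalk_zero E a⟩
  | tail _ hbc ih =>
    obtain ⟨k, hk⟩ := ih
    exact ⟨k + 1, hk.trans (hasWalk_one hbc)⟩

theorem reflTransGen_of_walk {S : Type*} {E : S → S → Prop} {k : ℕ} {p : ℕ → S}
    (hp : ∀ i < k, E (p i) (p (i + 1))) {i : ℕ} (j : ℕ) (hij : i ≤ j) (hj : j ≤ k) :
    Relation.ReflTransGen E (p i) (p j) := by
  induction j, hij using Nat.le_induction with
  | base => exact Relation.ReflTransGen.refl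
  | succ j hij ih => exact (ih (by omega)).tail (hp j (by omega))

/-- Consecutive states overlap, so each step appends one letter. The letter is taken from the
feasible word of the edge and not from the state, because for `r = 0` the states are empty. -/
theorem exists_labels_of_walk [Nonempty Γ] {p : ℕ → Fin (2 * r) → Γ} (k : ℕ)
    (hp : ∀ i < k, DiagramEdge K r ψ (p i) (p (i + 1))) :
    ∃ x : ℤ → Γ, (∀ i : ℕ, i ≤ k → word (2 * r) x i = p i) ∧
      ∀ i : ℕ, i < k → Feasible K r ψ (word (2 * r + 1) x i) := by
  induction k with
  | zero =>
    refine ⟨fun z => if h : z.toNat < 2 * r then p 0 ⟨z.toNat, h⟩ else Classical.arbitrary Γ,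
      ?_, fun i hi => absurd hi (Nat.not_lt_zero i)⟩
    intro i hi
    obtain rfl : i = 0 := by omega
    ext j
    simp [word]
  | succ k ih =>
    obtain ⟨x, hx, hf⟩ := ih fun i hi => hp i (by omega)
    obtain ⟨w, hw, hw1, hw2⟩ := hp k (by omega)
    have key : ∀ j : Fin (2 * r + 1),
        (if ((k : ℤ) + j.val) = k + 2 * r then w (Fin.last _) else x (k + j.val)) = w j := by
      intro j
      split_ifs with h
      · congr 1
        ext
        simp only [Fin.val_last]
        omega
      · have hj : j.val < 2 * r := by have := j.isLt; omega
        have := congrFun (hx k le_rfl) ⟨j.val, hj⟩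
        rw [← hw1] at this
        exact this
    refine ⟨fun z => if z = k + 2 * r then w (Fin.last _) else x z, ?_, ?_⟩
    · intro i hi
      rcases Nat.lt_or_ge k i with h | h
      · obtain rfl : i = k + 1 := by omega
        ext j
        have e := key j.succ
        rw [← hw2]
        simp only [word, Fin.val_succ] at e ⊢
        push_cast at e ⊢
        rw [show (k : ℤ) + 1 + j.val = k + (j.val + 1) by ring]
        exact e
      · rw [← hx i h]
        ext j
        simp only [word]
        rw [if_neg]
        have := j.isLt
        omega
    · intro i hi
      rcases Nat.lt_or_ge i k with h | h
      · convert hf i h using 1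
        ext j
        simp only [word]
        rw [if_neg]
        have := j.isLt
        omega
      · obtain rfl : i = k := by omega
        convert hw using 1
        ext j
        exact key j

/-- Any two states of `C` are joined inside `C` by walks, given by their labels, of all large
lengths. -/
def IsPrimitive (K : Set Kind) (r : ℕ) (ψ : Verifier Γ) (C : Set (Fin (2 * r) → Γ)) (k₀ : ℕ) :
    Prop :=
  ∀ k ≥ k₀, ∀ s ∈ C, ∀ s' ∈ C, ∃ x : ℤ → Γ, word (2 * r) x 0 = s ∧ word (2 * r) x k = s' ∧
    (∀ i : ℕ, i < k → Feasible K r ψ (word (2 * r + 1) x i)) ∧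
    ∀ i : ℕ, i ≤ k → word (2 * r) x i ∈ C

/-- Travel from the first state to `s`, turn around `s` for as long as required, and travel on to
the second state. The travelling times are bounded because there are finitely many states, and a
walk between two states of the component never leaves it. -/
theorem isPrimitive_component [Finite Γ] [Nonempty Γ] {s : Fin (2 * r) → Γ}
    (hs : IsFlexible (DiagramEdge K r ψ) s) :
    ∃ k₀, IsPrimitive K r ψ (component (DiagramEdge K r ψ) s) k₀ := by
  obtain ⟨k₁, hk₁⟩ := hs
  set E := DiagramEdge K r ψ
  choose a ha using fun t : component E s => exists_hasWalk t.2.2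
  choose b hb using fun t : component E s => exists_hasWalk t.2.1
  obtain ⟨A, hA⟩ := (Set.finite_range a).bddAbove
  obtain ⟨B, hB⟩ := (Set.finite_range b).bddAbove
  -- This leaves more than `k₁` steps for the closed walk at `s`.
  refine ⟨A + B + k₁ + 1, ?_⟩
  intro k hk t ht t' ht'
  have h1 : a ⟨t, ht⟩ ≤ A := hA ⟨_, rfl⟩
  have h2 : b ⟨t', ht'⟩ ≤ B := hB ⟨_, rfl⟩
  have h3 : HasWalk E (k - a ⟨t, ht⟩ - b ⟨t', ht'⟩) s s := hk₁ _ (by omega)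
  have h4 := ((ha ⟨t, ht⟩).trans h3).trans (hb ⟨t', ht'⟩)
  rw [show a ⟨t, ht⟩ + (k - a ⟨t, ht⟩ - b ⟨t', ht'⟩) + b ⟨t', ht'⟩ = k by omega] at h4
  obtain ⟨p, p0, pk, hp⟩ := h4
  obtain ⟨x, hx, hf⟩ := exists_labels_of_walk k hp
  refine ⟨x, ?_, ?_, hf, ?_⟩
  · have := hx 0 (by omega)
    rw [Nat.cast_zero] at this
    rw [this, p0]
  · rw [hx k le_rfl, pk]
  · intro i hi
    rw [hx i hi]
    constructor
    · refine ht.1.trans ?_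
      have := reflTransGen_of_walk hp i (Nat.zero_le i) hi
      rwa [p0] at this
    · refine Relation.ReflTransGen.trans ?_ ht'.2
      have := reflTransGen_of_walk hp k hi le_rfl
      rwa [pk] at this

theorem loop_of_const {a : Γ} (h : Feasible K r ψ (fun _ => a)) :
    DiagramEdge K r ψ (fun _ => a) (fun _ => a) := ⟨_, h, fun _ => rfl, fun _ => rfl⟩

theorem isFlexible_of_loop {S : Type*} {E : S → S → Prop} {s : S} (h : E s s) :
    IsFlexible E s := ⟨0, fun _ _ => ⟨fun _ => s, rfl, rfl, fun _ _ => h⟩⟩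

theorem isPrimitive_const {a : Γ} (h : Feasible K r ψ (fun _ => a)) :
    IsPrimitive K r ψ {fun _ => a} 0 := by
  rintro k - s hs s' hs'
  rw [Set.mem_singleton_iff] at hs hs'
  subst hs hs'
  exact ⟨fun _ => a, rfl, rfl, fun _ _ => h, fun _ _ => rfl⟩

/-! ### Restricting a verifier to a set of words -/

/-- The verifier that also requires, on graphs with at least `N` nodes and at distance more than
`N` from the ends, that the word around the node is in `C`. -/
def Restricted (r : ℕ) (ψ : Verifier Γ) (N : ℕ) (C : Set (Fin (2 * r) → Γ)) : Verifier Γ :=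
  fun G l v => ψ G l v ∧ (N ≤ G.n →
    (∀ j : ℤ, -((r : ℤ) + N) ≤ j → j ≤ r - 1 + N → (G.node (v.val + j)).isSome) →
    ∀ w : Fin (2 * r) → Γ, (∀ i, G.unroll l (v.val - r + i.val) = some (w i)) → w ∈ C)

/-- The problem verified by `Restricted`. -/
def RestrictedProblem (r : ℕ) (ψ : Verifier Γ) (N : ℕ) (C : Set (Fin (2 * r) → Γ)) : Problem Γ :=
  fun G l => ∀ v, Restricted r ψ N C G l v

variable {N : ℕ} {C : Set (Fin (2 * r) → Γ)}

/-- The additional clause inspects labels within distance `r`, the existence of nodes within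
distance `r + N`, and a lower bound on the size that is visible at this radius by
`SameNeighborhood.lt_n`. -/
theorem restricted_isLocal (hψ : IsLocal K r ψ) : IsLocal K (r + N) (Restricted r ψ N C) := by
  have key : ∀ (G : Inst) (l : G.V → Γ) (v : G.V) (G' : Inst) (l' : G'.V → Γ) (v' : G'.V),
      G.kind ∈ K → G'.kind ∈ K → SameNeighborhood (r + N) G l v G' l' v' →
      Restricted r ψ N C G l v → Restricted r ψ N C G' l' v' := by
    rintro G l v G' l' v' hG hG' h ⟨h1, h2⟩
    refine ⟨(hψ G l v G' l' v' hG hG' (h.mono (by omega))).1 h1, ?_⟩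
    intro hN hex w hw
    refine h2 (h.symm.lt_n (by omega) hN) ?_ w ?_
    · intro j hj1 hj2
      rw [← Inst.unroll_isSome (l := l), h.unroll_eq (by rw [abs_le]; push_cast; omega),
        Inst.unroll_isSome]
      exact hex j hj1 hj2
    · intro i
      have := i.isLt
      rw [← hw i, sub_add_eq_add_sub, add_sub_assoc, h.unroll_eq (by rw [abs_le]; push_cast; omega),
        sub_add_eq_add_sub, add_sub_assoc]
  intro G l v G' l' v' hG hG' h
  exact ⟨key G l v G' l' v' hG hG' h, key G' l' v' G l v hG' hG h.symm⟩

theorem restricted_isVerifierFor (hψ : IsLocal K r ψ) :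
    IsVerifierFor K (r + N) (Restricted r ψ N C) (RestrictedProblem r ψ N C) :=
  ⟨restricted_isLocal hψ, fun _ _ _ => Iff.rfl⟩

theorem Inst.not_isEnd_of_cycle {G : Inst} (hG : G.kind = Kind.cycle) (u : G.V) : ¬ G.IsEnd u := by
  rintro (h | h)
  · rw [Inst.pred_eq_node (G.node_val u)] at h
    have := Inst.node_cycle_isSome hG (u.val - 1)
    rw [h] at this
    cases this
  · rw [Inst.succ_eq_node (G.node_val u)] at h
    have := Inst.node_cycle_isSome hG (u.val + 1)
    rw [h] at this
    cases this

theorem Inst.isEnd_path {G : Inst} (hG : G.kind = Kind.path) (u : G.V) :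
    G.IsEnd u ↔ u.val = 0 ∨ u.val + 1 = G.n := by
  have := u.isLt
  rw [Inst.IsEnd, Inst.pred_eq_node (G.node_val u), Inst.succ_eq_node (G.node_val u),
    ← Option.not_isSome_iff_eq_none, ← Option.not_isSome_iff_eq_none, Inst.node_path_isSome hG,
    Inst.node_path_isSome hG]
  omega

/-- The window belonging to `v` has the coordinates `v - r, …, v + r - 1`. All of it has distance at
least `N` from the ends if and only if the path extends by `N` more nodes on both sides, which is
the test made in `Restricted`. -/
theorem restricted_isInducedBy {P : Problem Γ} (hψ : IsVerifierFor K r ψ P) (hC : C.Nonempty) :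
    IsInducedBy K P (RestrictedProblem r ψ N C) C := by
  refine ⟨N, fun G hG hn l => ?_⟩
  rw [hψ.2 G hG]
  constructor
  · intro h
    refine ⟨fun v => (h v).1, fun e he hend => ?_⟩
    -- For `r = 0` the only word is the empty one, and the nonempty set `C` contains it.
    rcases Nat.eq_zero_or_pos r with rfl | hr
    · obtain ⟨s, hs⟩ := hC
      convert hs using 1
      ext i
      exact i.elim0
    have h0 := he.node (by omega) (G.node_val _)
    set a : ℤ := ((e ⟨0, by omega⟩).val : ℤ) with ha
    have hv := h0 r (by omega)
    refine (h (e ⟨r, by omega⟩)).2 hn ?_ _ ?_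
    · intro j hj1 hj2
      rw [← Inst.node_add hv]
      cases hk : G.kind with
      | cycle => exact Inst.node_cycle_isSome hk _
      | path =>
        rw [Inst.node_path_isSome hk]
        have hpos := G.n_pos
        have e1 := hend ⟨0, hpos⟩ ((Inst.isEnd_path hk _).2 (Or.inl rfl)) ⟨0, by omega⟩
        have e2 := hend ⟨G.n - 1, by omega⟩ ((Inst.isEnd_path hk _).2 (Or.inr (by simp only; omega)))
          ⟨2 * r - 1, by omega⟩
        have h2 := (Inst.node_path hk).1 (h0 (2 * r - 1) (by omega))
        have e1' : G.dist ⟨0, hpos⟩ (e ⟨0, by omega⟩) ≤ a.natAbs := by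
          rw [Inst.dist_path_le_iff hk]
          simp [← ha]
        have e2' : G.dist ⟨G.n - 1, by omega⟩ (e ⟨2 * r - 1, by omega⟩) ≤
            (a + (2 * r - 1 : ℕ) - (G.n - 1 : ℕ)).natAbs := by
          rw [Inst.dist_path_le_iff hk, ← h2]
          simp
        have h3 := (e ⟨2 * r - 1, by omega⟩).isLt
        omega
    · intro i
      have h4 := h0 i.val i.isLt
      have h5 : G.node ((e ⟨r, by omega⟩).val - r + i.val) = some (e i) := by
        rw [← h4, sub_add_eq_add_sub, add_sub_assoc, ← Inst.node_add hv]
        congr 1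
        ring
      rw [Inst.unroll_of_node h5]
  · rintro ⟨h1, h2⟩ v
    refine ⟨h1 v, fun _ hex w hw => ?_⟩
    choose e he hwe using fun i => Inst.unroll_eq_some.1 (hw i)
    rw [show w = fun i => l (e i) from funext fun i => (hwe i).symm]
    refine h2 e (Inst.isWindow_of_node he) ?_
    intro u hu i
    cases hk : G.kind with
    | cycle => exact absurd hu (Inst.not_isEnd_of_cycle hk u)
    | path =>
      by_contra hlt
      have h3 : G.dist u (e i) ≤ N - 1 := by omega
      rw [Inst.dist_path_le_iff hk, ← (Inst.node_path hk).1 (he i), abs_le] at h3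
      have hi := i.isLt
      have h4 := hex (-((r : ℤ) + N)) le_rfl (by omega)
      have h5 := hex (r - 1 + N) (by omega) le_rfl
      rw [Inst.node_path_isSome hk] at h4 h5
      rw [Inst.isEnd_path hk] at hu
      omega

/-! ### Solutions near the ends of a path -/

/-- A path with a happy labeling `l₀` that contains the word `s` at position `p₀`. -/
structure EndData (r : ℕ) (ψ : Verifier Γ) (s : Fin (2 * r) → Γ) where
  n₀ : ℕ
  p₀ : ℕ
  l₀ : ℤ → Γ
  hn : 2 * r + 2 ≤ n₀
  hp : p₀ + 2 * r ≤ n₀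
  happy : ∀ v : Fin n₀, ψ ⟨Kind.path, n₀, (show 1 ≤ n₀ by omega)⟩ (fun v => l₀ v.val) v
  hword : word (2 * r) l₀ p₀ = s

theorem Inst.unroll_path {G : Inst} (hG : G.kind = Kind.path) (y : ℤ → Γ) (i : ℤ) :
    G.unroll (fun v => y v.val) i = if 0 ≤ i ∧ i < G.n then some (y i) else none := by
  split_ifs with h
  · rw [Inst.unroll_of_node (Inst.node_of_range h.1 h.2)]
    congr 2
    simp only
    omega
  · rwa [Inst.unroll_eq_none, ← Option.not_isSome_iff_eq_none, Inst.node_path_isSome hG]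

/-- The whole neighbourhood of `v` is copied from `D`, so `v` is happy; and `v` is closer to the
start than `r + N`, so the clause about `C` is void. -/
theorem restricted_of_prefix (hψ : IsLocal K r ψ) {s : Fin (2 * r) → Γ} (D : EndData r ψ s)
    (hN : D.p₀ ≤ N) {G : Inst} (hK : G.kind ∈ K) (hG : G.kind = Kind.path)
    (hn : D.n₀ ≤ G.n) {l : G.V → Γ}
    (h : ∀ i : ℤ, 0 ≤ i → i < D.p₀ + 2 * r → G.unroll l i = some (D.l₀ i)) {v : G.V}
    (hv : v.val < D.p₀ + r) : Restricted r ψ N C G l v := by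
  have hn0 := D.hn
  have hp0 := D.hp
  have hvlt := v.isLt
  have hKp : Kind.path ∈ K := hG ▸ hK
  constructor
  · have hv0 := D.happy ⟨v.val, by omega⟩
    refine (psi_congr hψ hK hKp (by omega) D.hn fun j hj => ?_).2 hv0
    rw [abs_le] at hj
    rw [Inst.unroll_path rfl]
    simp only
    split_ifs with hc
    · rw [h _ hc.1 (by omega)]
    · rw [Inst.unroll_eq_none, ← Option.not_isSome_iff_eq_none, Inst.node_path_isSome hG]
      omega
  · intro _ hex
    have := hex (-((r : ℤ) + N)) le_rfl (by omega)
    rw [Inst.node_path_isSome hG] at this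
    omega

theorem restricted_of_suffix (hψ : IsLocal K r ψ) {s : Fin (2 * r) → Γ} (D : EndData r ψ s)
    (hN : D.n₀ < N) {G : Inst} (hK : G.kind ∈ K) (hG : G.kind = Kind.path)
    (hn : D.n₀ ≤ G.n) {l : G.V → Γ}
    (h : ∀ i : ℤ, D.p₀ ≤ i → i < D.n₀ → G.unroll l (G.n - D.n₀ + i) = some (D.l₀ i)) {v : G.V}
    (hv : G.n - D.n₀ + D.p₀ + r ≤ v.val) : Restricted r ψ N C G l v := by
  have hn0 := D.hn
  have hp0 := D.hp
  have hvlt := v.isLt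
  have hKp : Kind.path ∈ K := hG ▸ hK
  constructor
  · have hv0 := D.happy ⟨v.val - (G.n - D.n₀), by omega⟩
    refine (psi_congr hψ hK hKp (by omega) D.hn fun j hj => ?_).2 hv0
    rw [abs_le] at hj
    rw [Inst.unroll_path rfl]
    simp only
    split_ifs with hc
    · rw [← h _ (by omega) (by omega)]
      congr 1
      omega
    · rw [Inst.unroll_eq_none, ← Option.not_isSome_iff_eq_none, Inst.node_path_isSome hG]
      omega
  · intro _ hex
    have := hex (r - 1 + N) (by omega) le_rfl
    rw [Inst.node_path_isSome hG] at this
    omega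

theorem restricted_of_mid (hψ : IsLocal K r ψ) {G : Inst} (hK : G.kind ∈ K)
    (hn : 2 * r + 2 ≤ G.n) {l : G.V → Γ} {v : G.V} {w : Fin (2 * r + 1) → Γ}
    (hw : ∀ i : Fin (2 * r + 1), G.unroll l (v.val - r + i.val) = some (w i))
    (hf : Feasible K r ψ w) (hC : (fun i : Fin (2 * r) => w i.castSucc) ∈ C) :
    Restricted r ψ N C G l v := by
  refine ⟨(psi_iff_feasible hψ hK hn hw).2 hf, fun _ _ w' hw' => ?_⟩
  convert hC using 1
  ext i
  have := hw i.castSucc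
  rw [Fin.val_castSucc, hw' i] at this
  exact Option.some.inj this

/-- Prefix and middle overlap in `2 * r` positions, and so do middle and suffix; hence every
neighbourhood lies completely within one of the three parts. -/
theorem restrictedProblem_path (hψ : IsLocal K r ψ) {s : Fin (2 * r) → Γ} (D : EndData r ψ s)
    (hN : D.n₀ < N) {G : Inst} (hK : G.kind ∈ K) (hG : G.kind = Kind.path) (hn : D.n₀ ≤ G.n)
    {y : ℤ → Γ} (hpre : ∀ i : ℤ, 0 ≤ i → i < D.p₀ + 2 * r → y i = D.l₀ i)
    (hsuf : ∀ i : ℤ, D.p₀ ≤ i → i < D.n₀ → y (G.n - D.n₀ + i) = D.l₀ i)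
    (hmid : ∀ i : ℤ, D.p₀ ≤ i → i < G.n - D.n₀ + D.p₀ →
      Feasible K r ψ (word (2 * r + 1) y i) ∧ word (2 * r) y i ∈ C) :
    RestrictedProblem r ψ N C G (fun v => y v.val) := by
  have hn0 := D.hn
  have hp0 := D.hp
  intro v
  have hvlt := v.isLt
  by_cases h1 : v.val < D.p₀ + r
  · refine restricted_of_prefix hψ D (by omega) hK hG hn (fun i hi hi' => ?_) h1
    rw [Inst.unroll_path hG, if_pos (by omega), hpre i hi hi']
  by_cases h2 : G.n - D.n₀ + D.p₀ + r ≤ v.val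
  · refine restricted_of_suffix hψ D hN hK hG hn (fun i hi hi' => ?_) h2
    rw [Inst.unroll_path hG, if_pos (by omega), hsuf i hi hi']
  obtain ⟨hf, hC⟩ := hmid (v.val - r) (by omega) (by omega)
  refine restricted_of_mid hψ hK (by omega) (fun i => ?_) hf hC
  have := i.isLt
  rw [Inst.unroll_path hG, if_pos (by omega)]
  rfl

theorem Inst.unroll_cycle {G : Inst} (hG : G.kind = Kind.cycle) {y : ℤ → Γ}
    (hy : Function.Periodic y (G.n : ℤ)) (i : ℤ) :
    G.unroll (fun v => y v.val) i = some (y i) := by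
  obtain ⟨u, hu⟩ := Option.isSome_iff_exists.1 (Inst.node_cycle_isSome hG i)
  rw [Inst.unroll_of_node hu, ← (Inst.node_cycle hG).1 hu]
  congr 1
  have h1 : i % G.n = i - (i / G.n) * G.n := by
    have := Int.emod_add_mul_ediv i G.n
    linarith
  rw [h1]
  exact hy.sub_int_mul_eq (i / G.n)

theorem restrictedProblem_cycle (hψ : IsLocal K r ψ) {G : Inst} (hK : G.kind ∈ K)
    (hG : G.kind = Kind.cycle) (hn : 2 * r + 2 ≤ G.n) {y : ℤ → Γ}
    (hy : Function.Periodic y (G.n : ℤ))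
    (hmid : ∀ i : ℤ, 0 ≤ i → i < G.n →
      Feasible K r ψ (word (2 * r + 1) y i) ∧ word (2 * r) y i ∈ C) :
    RestrictedProblem r ψ N C G (fun v => y v.val) := by
  intro v
  have h0 : (0 : ℤ) < G.n := by exact_mod_cast G.n_pos
  have hper : ∀ (m : ℕ) (i : ℤ), word m y (i % G.n) = word m y i := by
    intro m i
    ext j
    have h1 : i % G.n + j.val = i + j.val - (i / G.n) * G.n := by
      have := Int.emod_add_mul_ediv i G.n
      linarith
    simp only [word]
    rw [h1]
    exact hy.sub_int_mul_eq (i / G.n)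
  obtain ⟨hf, hC⟩ := hmid ((v.val - r) % G.n) (Int.emod_nonneg _ h0.ne') (Int.emod_lt_of_pos _ h0)
  rw [hper] at hf hC
  refine restricted_of_mid hψ hK hn (fun i => ?_) hf hC
  rw [Inst.unroll_cycle hG hy]
  rfl

/-! ### Usable states -/

theorem exists_endData {P : Problem Γ} (hψ : IsVerifierFor K r ψ P) (hK : Kind.path ∈ K) {n : ℕ}
    (hn : 2 * r + 2 ≤ n) {l : Fin n → Γ} (hP : P ⟨Kind.path, n, (show 1 ≤ n by omega)⟩ l)
    {s : Fin (2 * r) → Γ} {p : ℕ} (hp : p + 2 * r ≤ n)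
    (hs : ∀ i : Fin (2 * r), l ⟨p + i.val, by have := i.isLt; omega⟩ = s i) :
    Nonempty (EndData r ψ s) := by
  have hl : (fun v : Fin n => (fun z : ℤ => if h : z.toNat < n then l ⟨z.toNat, h⟩ else
      l ⟨0, by omega⟩) (v.val : ℤ)) = l := by
    ext v
    simp
  refine ⟨⟨n, p, fun z => if h : z.toNat < n then l ⟨z.toNat, h⟩ else l ⟨0, by omega⟩, hn, hp,
    ?_, ?_⟩⟩
  · have := (hψ.2 ⟨Kind.path, n, (show 1 ≤ n by omega)⟩ hK l).1 hP
    rw [hl]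
    exact this
  · ext i
    have hi := i.isLt
    rw [← hs i]
    simp only [word]
    rw [dif_pos (by omega)]
    congr 1

theorem IsUsable.endData {P : Problem Γ} (hψ : IsVerifierFor K r ψ P) (hK : Kind.path ∈ K)
    {s : Fin (2 * r) → Γ} (hs : IsUsable K P s) : Nonempty (EndData r ψ s) := by
  obtain ⟨N, hN⟩ := hs
  have hn : 1 ≤ N + 2 * r + 2 := by omega
  obtain ⟨l, e, hP, he, hw⟩ := hN ⟨Kind.path, N + 2 * r + 2, hn⟩ hK (by simp only; omega)
  rcases Nat.eq_zero_or_pos r with rfl | hr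
  · exact exists_endData hψ hK (by omega) hP (p := 0) (by omega) fun i => i.elim0
  · have h0 := he.node (by omega) (Inst.node_val _ _)
    have h1 := h0 (2 * r - 1) (by omega)
    rw [Inst.node_path rfl] at h1
    have h2 := (e ⟨2 * r - 1, by omega⟩).isLt
    simp only at h2
    refine exists_endData hψ hK (by omega) hP (p := (e ⟨0, by omega⟩).val) (by omega) fun i => ?_
    rw [← hw i]
    congr 1
    have h3 : Inst.node _ _ = some (e i) := h0 i.val i.isLt
    rw [Inst.node_path rfl] at h3
    ext
    simp only
    omega

/-- One solution on one path yields solutions on all longer ones: cut it at its occurrence of `s`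
and insert a closed walk at `s` of the missing length. On a cycle with `n` nodes, a closed walk of
length `n` is itself a solution. -/
theorem isUsable_of_endData [Finite Γ] [Nonempty Γ] {P : Problem Γ} (hψ : IsVerifierFor K r ψ P)
    {s : Fin (2 * r) → Γ} (hs : IsFlexible (DiagramEdge K r ψ) s)
    (hD : Kind.path ∈ K → Nonempty (EndData r ψ s)) : IsUsable K P s := by
  obtain ⟨k₀, hk₀⟩ := isPrimitive_component hs
  have hsC : s ∈ component (DiagramEdge K r ψ) s :=
    ⟨Relation.ReflTransGen.refl, Relation.ReflTransGen.refl⟩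
  have hpath : ∃ N₁, ∀ G : Inst, G.kind = Kind.path → G.kind ∈ K → N₁ ≤ G.n →
      ∃ (l : G.V → Γ) (e : Fin (2 * r) → G.V), P G l ∧ G.IsWindow e ∧ ∀ i, l (e i) = s i := by
    by_cases hK : Kind.path ∈ K
    · obtain ⟨D⟩ := hD hK
      have hp0 := D.hp
      refine ⟨D.n₀ + k₀, fun G hG hGK hn => ?_⟩
      obtain ⟨x, hx0, hxk, hxf, -⟩ := hk₀ (G.n - D.n₀) (by omega) s hsC s hsC
      let y : ℤ → Γ := fun i => if i < D.p₀ then D.l₀ i else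
        if i < G.n - D.n₀ + D.p₀ then x (i - D.p₀) else D.l₀ (i - (G.n - D.n₀))
      have hx : ∀ i : ℤ, D.p₀ ≤ i → i < G.n - D.n₀ + D.p₀ + 2 * r → y i = x (i - D.p₀) := by
        intro i h1 h2
        simp only [y]
        rw [if_neg (by omega)]
        split_ifs with h3
        · rfl
        · have e1 := congrFun (hxk.trans D.hword.symm) ⟨(i - (G.n - D.n₀ + D.p₀)).toNat, by omega⟩
          simp only [word] at e1
          rw [show i - (G.n - D.n₀) = D.p₀ + ((i - (G.n - D.n₀ + D.p₀)).toNat : ℤ) by omega,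
            ← e1]
          congr 1
          omega
      have hpre : ∀ i : ℤ, 0 ≤ i → i < D.p₀ + 2 * r → y i = D.l₀ i := by
        intro i h1 h2
        rcases lt_or_ge i D.p₀ with h3 | h3
        · simp only [y, if_pos h3]
        · rw [hx i h3 (by omega)]
          have e1 := congrFun (hx0.trans D.hword.symm) ⟨(i - D.p₀).toNat, by omega⟩
          simp only [word] at e1
          rw [show i - D.p₀ = 0 + ((i - D.p₀).toNat : ℤ) by omega, e1]
          congr 1
          omega
      -- With `C` the set of all words the restriction is void, and only the happiness of `ψ` is
      -- extracted.
      have hsol := restrictedProblem_path (N := D.n₀ + 1) (C := Set.univ) hψ.1 D (Nat.lt_succ_self _) hGK hG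
        (by omega) (y := y) hpre
        (fun i h1 h2 => by
          simp only [y]
          rw [if_neg (by omega), if_neg (by omega)]
          congr 1
          ring)
        (fun i h1 h2 => ⟨by
          convert hxf (i - D.p₀).toNat (by omega) using 1
          ext j
          have := j.isLt
          simp only [word]
          rw [hx _ (by omega) (by omega)]
          congr 1
          omega, Set.mem_univ _⟩)
      refine ⟨fun v => y v.val, fun i => ⟨D.p₀ + i.val, by have := i.isLt; omega⟩,
        (hψ.2 G hGK _).2 fun v => (hsol v).1, ?_, ?_⟩
      · refine Inst.isWindow_of_node (a := D.p₀) fun i => ?_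
        rw [Inst.node_path hG]
        push_cast
        rfl
      · intro i
        have := i.isLt
        simp only
        rw [hpre _ (by omega) (by push_cast; omega), ← congrFun D.hword i]
        simp only [word]
        push_cast
        rfl
    · exact ⟨0, fun G h1 h2 => absurd (h1 ▸ h2) hK⟩
  obtain ⟨N₁, hN₁⟩ := hpath
  refine ⟨N₁ + k₀ + 2 * r + 2, fun G hGK hn => ?_⟩
  cases hG : G.kind with
  | path => exact hN₁ G hG hGK (by omega)
  | cycle =>
    obtain ⟨x, hx0, hxk, hxf, -⟩ := hk₀ G.n (by omega) s hsC s hsC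
    have h0 : (0 : ℤ) < G.n := by exact_mod_cast G.n_pos
    let y : ℤ → Γ := fun i => x (i % G.n)
    have hx : ∀ i : ℤ, 0 ≤ i → i < G.n + 2 * r → y i = x i := by
      intro i h1 h2
      simp only [y]
      rcases lt_or_ge i G.n with h3 | h3
      · rw [Int.emod_eq_of_lt h1 h3]
      · have e1 := congrFun (hx0.trans hxk.symm) ⟨(i - G.n).toNat, by omega⟩
        simp only [word] at e1
        rw [← Int.sub_emod_right, Int.emod_eq_of_lt (by omega) (by omega)]
        rw [show i - G.n = 0 + ((i - G.n).toNat : ℤ) by omega, e1]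
        congr 1
        omega
    have hsol := restrictedProblem_cycle (N := 0) (C := Set.univ) hψ.1 hGK hG
      (by omega) (y := y) (fun i => by simp only [y, Int.add_emod_right])
      (fun i h1 h2 => ⟨by
        convert hxf i.toNat (by omega) using 1
        ext j
        have := j.isLt
        simp only [word]
        rw [hx _ (by omega) (by omega)]
        congr 1
        omega, Set.mem_univ _⟩)
    refine ⟨fun v => y v.val, fun i => ⟨i.val, by have := i.isLt; omega⟩,
      (hψ.2 G hGK _).2 fun v => (hsol v).1, ?_, ?_⟩
    · refine Inst.isWindow_of_node (a := 0) fun i => ?_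
      rw [Inst.node_of_range (by omega) (by have := i.isLt; omega)]
      congr 1
      ext
      simp
    · intro i
      have := i.isLt
      simp only
      rw [hx _ (by omega) (by omega), ← hx0]
      simp [word]

end Verifier

section Local

variable {Γ : Type*} {K : Set Kind} {c : ℕ} {P : Problem Γ}

/-! ### Executions on a view -/

/-- The state after `t` rounds of a node that sees the identifiers `x`, itself at coordinate `0`. -/
def LocalAlgorithm.run (A : LocalAlgorithm Γ) (n : ℕ) : ℕ → (ℤ → Option ℕ) → A.State
  | 0, x => A.init n ((x 0).getD 0) (x (-1)).isSome (x 1).isSome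
  | t + 1, x => A.update (A.run n t x)
      (if (x (-1)).isSome then some (A.toSucc (A.run n t fun j => x (-1 + j))) else none)
      (if (x 1).isSome then some (A.toPred (A.run n t fun j => x (1 + j))) else none)

/-- `run` accepts arbitrary sequences of identifiers, so that an algorithm can later be executed on
sequences that are not the view of any node, such as those formed by every `j`-th node. -/
theorem LocalAlgorithm.stateAt_eq_run (A : LocalAlgorithm Γ) (G : Inst) (ident : G.V → ℕ) (t : ℕ) :
    ∀ v : G.V, A.stateAt G ident t v = A.run G.n t fun j => G.unroll ident (v.val + j) := by
  induction t with
  | zero =>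
    intro v
    simp only [LocalAlgorithm.stateAt, LocalAlgorithm.run, add_zero, Inst.unroll_val,
      Option.getD_some, Inst.unroll_isSome]
    rw [Inst.pred_eq_node (G.node_val v), Inst.succ_eq_node (G.node_val v), sub_eq_add_neg]
  | succ t ih =>
    intro v
    simp only [LocalAlgorithm.stateAt, LocalAlgorithm.run, Inst.unroll_isSome]
    rw [Inst.pred_eq_node (G.node_val v), Inst.succ_eq_node (G.node_val v), sub_eq_add_neg, ih v]
    congr 1
    · cases h : G.node (v.val + -1) with
      | none => simp
      | some u =>
        simp only [Option.map_some, Option.isSome_some, if_true, Option.some.injEq]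
        rw [ih u]
        congr 2
        ext1 j
        rw [Inst.unroll, Inst.unroll, ← add_assoc, Inst.node_add h]
    · cases h : G.node (v.val + 1) with
      | none => simp
      | some u =>
        simp only [Option.map_some, Option.isSome_some, if_true, Option.some.injEq]
        rw [ih u]
        congr 2
        ext1 j
        rw [Inst.unroll, Inst.unroll, ← add_assoc, Inst.node_add h]

/-- The radius is `t + 1` and not `t` because nodes know from the start whether they have
neighbours. -/
theorem LocalAlgorithm.run_congr (A : LocalAlgorithm Γ) (n : ℕ) (t : ℕ) :
    ∀ x y : ℤ → Option ℕ, (∀ j : ℤ, |j| ≤ t + 1 → x j = y j) → A.run n t x = A.run n t y := by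
  induction t with
  | zero =>
    intro x y h
    simp only [LocalAlgorithm.run]
    rw [h 0 (by simp), h (-1) (by simp), h 1 (by simp)]
  | succ t ih =>
    intro x y h
    simp only [LocalAlgorithm.run]
    rw [h (-1) (by simp; omega), h 1 (by simp; omega), ih x y fun j hj => h j (by push_cast; omega),
      ih (fun j => x (-1 + j)) (fun j => y (-1 + j)) fun j hj =>
        h _ (by rw [abs_le] at *; push_cast; omega),
      ih (fun j => x (1 + j)) (fun j => y (1 + j)) fun j hj =>
        h _ (by rw [abs_le] at *; push_cast; omega)]

/-! ### Gathering the neighbourhood -/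

/-- The algorithm that collects all identifiers in sight and then applies `F`. -/
def gather (F : ℕ → (ℤ → Option ℕ) → Γ) : LocalAlgorithm Γ where
  State := ℕ × (ℤ → Option ℕ)
  Msg := ℤ → Option ℕ
  init n i _ _ := (n, fun j => if j = 0 then some i else none)
  toPred s := s.2
  toSucc s := s.2
  update s p q := (s.1, fun j => if j = 0 then s.2 0 else
    if j < 0 then p.bind (fun x => x (j + 1)) else q.bind (fun x => x (j - 1)))
  output s := F s.1 s.2

theorem stateAt_gather (F : ℕ → (ℤ → Option ℕ) → Γ) (G : Inst) (ident : G.V → ℕ) (t : ℕ) :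
    ∀ v : G.V, (gather F).stateAt G ident t v =
      (G.n, fun j => if |j| ≤ (t : ℤ) then G.unroll ident (v.val + j) else none) := by
  induction t with
  | zero =>
    intro v
    simp only [LocalAlgorithm.stateAt, gather]
    congr 1
    ext1 j
    simp only [Nat.cast_zero, abs_nonpos_iff]
    split_ifs with h
    · rw [h, add_zero, Inst.unroll_val]
    · rfl
  | succ t ih =>
    intro v
    have hsome : (G.node (v.val : ℤ)).isSome := by rw [Inst.node_val]; rfl
    rw [LocalAlgorithm.stateAt, ih v, Inst.pred_eq_node (G.node_val v),
      Inst.succ_eq_node (G.node_val v)]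
    simp only [gather]
    congr 1
    ext1 j
    rcases lt_trichotomy j 0 with hj | rfl | hj
    · rw [if_neg hj.ne, if_pos hj]
      cases h : G.node (v.val - 1) with
      | none =>
        have : G.node (v.val + j) = none := by
          rw [← Option.not_isSome_iff_eq_none]
          intro h'
          have := Inst.node_isSome_mid h' hsome (show v.val + j ≤ (v.val : ℤ) - 1 by omega)
            (by omega)
          rw [h] at this
          cases this
        simp [Inst.unroll, this]
      | some u =>
        have e : G.unroll ident (u.val + (j + 1)) = G.unroll ident (v.val + j) := by
          rw [Inst.unroll, Inst.unroll, ← Inst.node_add h]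
          congr 2
          ring
        have hs := ih u
        simp only [gather] at hs
        simp only [Option.map_some, Option.bind_some, hs, e]
        congr 1
        rw [abs_le, abs_le]
        push_cast
        apply propext
        omega
    · simp
      omega
    · rw [if_neg hj.ne', if_neg hj.not_gt]
      cases h : G.node (v.val + 1) with
      | none =>
        have : G.node (v.val + j) = none := by
          rw [← Option.not_isSome_iff_eq_none]
          intro h'
          have := Inst.node_isSome_mid hsome h' (show (v.val : ℤ) ≤ (v.val : ℤ) + 1 by omega)
            (by omega)
          rw [h] at this
          cases this
        simp [Inst.unroll, this]
      | some u =>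
        have e : G.unroll ident (u.val + (j - 1)) = G.unroll ident (v.val + j) := by
          rw [Inst.unroll, Inst.unroll, ← Inst.node_add h]
          congr 2
          ring
        have hs := ih u
        simp only [gather] at hs
        simp only [Option.map_some, Option.bind_some, hs, e]
        congr 1
        rw [abs_le, abs_le]
        push_cast
        apply propext
        omega

theorem solvable_of_view {R : ℕ → ℕ} (F : ℕ → (ℤ → Option ℕ) → Γ)
    (hF : ∀ n x y, (∀ j : ℤ, |j| ≤ R n → x j = y j) → F n x = F n y)
    (h : ∀ G : Inst, G.kind ∈ K → ∀ ident : G.V → ℕ, Function.Injective ident →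
      (∀ v, 1 ≤ ident v ∧ ident v ≤ G.n ^ c) →
      P G fun v => F G.n fun j => G.unroll ident (v.val + j)) : Solvable K c P R := by
  refine ⟨gather F, fun G hG ident hi hb => ?_⟩
  convert h G hG ident hi hb using 1
  ext v
  rw [stateAt_gather]
  refine hF _ _ _ fun j hj => ?_
  exact if_pos hj

/-! ### Choosing identifiers -/

theorem exists_ident {n c : ℕ} (hc : 1 ≤ c) (S : Finset (Fin n)) {f : Fin n → ℕ}
    (hf : Set.InjOn f S) (hb : ∀ v ∈ S, 1 ≤ f v ∧ f v ≤ n ^ c) :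
    ∃ ident : Fin n → ℕ, Function.Injective ident ∧ (∀ v, 1 ≤ ident v ∧ ident v ≤ n ^ c) ∧
      ∀ v ∈ S, ident v = f v := by
  have h1 : S.image f ⊆ Finset.Icc 1 (n ^ c) := by
    intro x hx
    obtain ⟨v, hv, rfl⟩ := Finset.mem_image.1 hx
    exact Finset.mem_Icc.2 (hb v hv)
  have h2 : (S.image f).card ≤ n := by
    refine Finset.card_image_le.trans ?_
    simpa using Finset.card_le_univ S
  have h3 : n ≤ (Finset.Icc 1 (n ^ c)).card := by
    rw [Nat.card_Icc, Nat.add_sub_cancel]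
    exact Nat.le_self_pow (by omega) n
  obtain ⟨t, ht1, ht2, ht3⟩ := Finset.exists_subsuperset_card_eq h1 h2 h3
  obtain ⟨g, hg⟩ := Finset.exists_equiv_extend_of_card_eq (by simpa using ht3.symm) ht1 hf
  refine ⟨fun v => (g v : ℕ), fun u v h => g.injective (Subtype.ext h), fun v => ?_, hg⟩
  exact Finset.mem_Icc.1 (ht2 (g v).2)

/-- `A` solves `P` in `t` rounds on the graphs with `n` nodes. -/
def SolvesAt (K : Set Kind) (c : ℕ) (P : Problem Γ) (A : LocalAlgorithm Γ) (n t : ℕ) : Prop :=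
  ∀ G : Inst, G.kind ∈ K → G.n = n → ∀ ident : G.V → ℕ, Function.Injective ident →
    (∀ v, 1 ≤ ident v ∧ ident v ≤ n ^ c) → P G fun v => A.output (A.stateAt G ident t v)

/-- The device for all arguments that feed chosen identifiers to an algorithm: identifiers
prescribed on `D` are completed arbitrarily, and wherever the view stays in `D`, or leaves it only
beyond the ends of a path, the output is known in advance. -/
theorem SolvesAt.exists_solution {A : LocalAlgorithm Γ} {n t : ℕ} (hA : SolvesAt K c P A n t)
    (hc : 1 ≤ c) {G : Inst} (hG : G.kind ∈ K) (hn : G.n = n) (D : Set ℤ) {f : ℤ → ℕ}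
    (hf : Set.InjOn f D) (hb : ∀ q ∈ D, 1 ≤ f q ∧ f q ≤ n ^ c) :
    ∃ l : G.V → Γ, P G l ∧ ∀ (q : ℤ) (x : ℤ → Option ℕ), 0 ≤ q → q < n →
      (∀ j : ℤ, |j| ≤ t + 1 →
        (0 ≤ q + j ∧ q + j < n ∧ q + j ∈ D ∧ x j = some (f (q + j))) ∨
        (G.kind = Kind.path ∧ ¬ (0 ≤ q + j ∧ q + j < n) ∧ x j = none)) →
      G.unroll l q = some (A.output (A.run n t x)) := by
  classical
  subst hn
  obtain ⟨ident, hi, hib, hif⟩ := exists_ident hc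
    (Finset.univ.filter fun v : Fin G.n => (v.val : ℤ) ∈ D) (f := fun v => f v.val)
    (fun u hu v hv h => by
      simp only [Finset.coe_filter, Finset.mem_univ, true_and, Set.mem_ofPred_eq] at hu hv
      have := hf hu hv h
      ext
      exact_mod_cast this)
    (fun v hv => hb _ (by simpa using hv))
  refine ⟨_, hA G hG rfl ident hi hib, fun q x hq0 hqn hx => ?_⟩
  rw [Inst.unroll_of_node (Inst.node_of_range hq0 hqn), LocalAlgorithm.stateAt_eq_run]
  congr 2
  refine A.run_congr _ _ _ _ fun j hj => ?_
  rw [show ((⟨q.toNat, by omega⟩ : G.V).val : ℤ) = q by simp only; omega]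
  rcases hx j hj with ⟨h1, h2, h3, h4⟩ | ⟨h1, h2, h3⟩
  · rw [h4, Inst.unroll_of_node (Inst.node_of_range h1 h2), hif]
    · congr 2
      simp only
      omega
    · simp only [Finset.mem_filter, Finset.mem_univ, true_and]
      rwa [show (((q + j).toNat : ℕ) : ℤ) = q + j by omega]
  · rw [h3, Inst.unroll_eq_none, ← Option.not_isSome_iff_eq_none, Inst.node_path_isSome h1]
    exact h2

end Local

/-! ### Usable flexible states obtained from algorithms -/

section Flexible

variable {Γ : Type*} {K : Set Kind} {c r : ℕ} {ψ : Verifier Γ} {P : Problem Γ}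

theorem feasible_of_solution (hψ : IsLocal K r ψ) {G : Inst} (hG : G.kind ∈ K) {l : G.V → Γ}
    (hl : ∀ v, ψ G l v) (hn : 2 * r + 2 ≤ G.n) {p : ℤ} (hp : 0 ≤ p) (hp' : p + 2 * r < G.n)
    {w : Fin (2 * r + 1) → Γ} (hw : ∀ i, G.unroll l (p + i.val) = some (w i)) :
    Feasible K r ψ w := by
  refine (psi_iff_feasible hψ hG hn (v := ⟨(p + r).toNat, by omega⟩) fun i => ?_).1 (hl _)
  rw [← hw i]
  congr 1
  simp only
  omega

theorem hasWalk_of_solution (hψ : IsLocal K r ψ) {G : Inst} (hG : G.kind ∈ K) {l : G.V → Γ}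
    (hl : ∀ v, ψ G l v) (hn : 2 * r + 2 ≤ G.n) {p : ℤ} {k : ℕ} (hp : 0 ≤ p)
    (hp' : p + k + 2 * r ≤ G.n) {s s' : Fin (2 * r) → Γ}
    (hs : ∀ i, G.unroll l (p + i.val) = some (s i))
    (hs' : ∀ i, G.unroll l (p + k + i.val) = some (s' i)) :
    HasWalk (DiagramEdge K r ψ) k s s' := by
  have a : Γ := l ⟨0, by omega⟩
  have hy : ∀ i : ℤ, 0 ≤ i → i < G.n → G.unroll l i = some ((G.unroll l i).getD a) := by
    intro i h1 h2
    rw [Inst.unroll_of_node (Inst.node_of_range h1 h2), Option.getD_some]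
  refine ⟨fun m i => (G.unroll l (p + m + i.val)).getD a, ?_, ?_, ?_⟩
  · ext i
    simp [hs]
  · ext i
    simp [hs']
  · intro m hm
    refine ⟨fun i => (G.unroll l (p + m + i.val)).getD a, ?_, fun i => rfl, fun i => ?_⟩
    · refine feasible_of_solution hψ hG hl hn (p := p + m) (by omega) (by omega) fun i => ?_
      have := i.isLt
      exact hy _ (by omega) (by omega)
    · simp only [Fin.val_succ]
      push_cast
      congr 2
      ring

/-- A single solution suffices by `isUsable_of_endData`. If the family contains paths the solution
has to live on a path, since a cycle says nothing about the ends. -/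
theorem usable_of_solution [Finite Γ] [Nonempty Γ] (hψ : IsVerifierFor K r ψ P) {G : Inst}
    (hG : G.kind ∈ K) (hGp : Kind.path ∈ K → G.kind = Kind.path) {l : G.V → Γ} (hl : P G l)
    (hn : 2 * r + 2 ≤ G.n) {p : ℤ} (hp : 0 ≤ p) (hp' : p + 2 * r ≤ G.n) {s : Fin (2 * r) → Γ}
    (hs : ∀ i, G.unroll l (p + i.val) = some (s i))
    (hflex : IsFlexible (DiagramEdge K r ψ) s) : IsUsable K P s := by
  refine isUsable_of_endData hψ hflex fun hK => ?_
  have hk := hGp hK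
  obtain ⟨κ, n, hv⟩ := G
  simp only at hk
  subst hk
  refine exists_endData hψ hK hn hl (p := p.toNat)
    (by have h2 : p + 2 * r ≤ (n : ℤ) := hp'; omega) fun i => ?_
  have h1 := hs i
  rw [Inst.unroll_of_node (Inst.node_of_range (by omega)
    (by have := i.isLt; simp only at hp' ⊢; omega))] at h1
  rw [← Option.some.inj h1]
  congr 1
  ext
  simp only
  omega

theorem exists_inst (hK : K.Nonempty) {n : ℕ} (hn : 3 ≤ n) :
    ∃ G : Inst, G.kind ∈ K ∧ G.n = n ∧ (Kind.path ∈ K → G.kind = Kind.path) := by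
  by_cases h : Kind.path ∈ K
  · exact ⟨⟨Kind.path, n, (show 1 ≤ n by omega)⟩, h, rfl, fun _ => rfl⟩
  · obtain ⟨κ, hκ⟩ := hK
    cases κ with
    | path => exact absurd hκ h
    | cycle => exact ⟨⟨Kind.cycle, n, hn⟩, hκ, rfl, fun h' => absurd h' h⟩

/-- If `k = q * m + ρ` with `ρ < m ≤ q`, then `k = (q - ρ) * m + ρ * (m + 1)`. -/
theorem isFlexible_of_consecutive {S : Type*} {E : S → S → Prop} {s : S} {m : ℕ}
    (h₁ : HasWalk E m s s) (h₂ : HasWalk E (m + 1) s s) : IsFlexible E s := by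
  have hmul : ∀ (k q : ℕ), HasWalk E k s s → HasWalk E (q * k) s s := by
    intro k q hk
    induction q with
    | zero => simpa using hasWalk_zero E s
    | succ q ih => rw [Nat.succ_mul]; exact ih.trans hk
  refine ⟨m * m, fun k hk => ?_⟩
  rcases Nat.eq_zero_or_pos m with rfl | hm
  · have := hmul _ k h₂
    rw [Nat.zero_add, Nat.mul_one] at this
    exact this
  have h3 : k % m < m := Nat.mod_lt _ hm
  have h4 : m ≤ k / m := (Nat.le_div_iff_mul_le hm).2 hk.le
  have h5 := (hmul m (k / m - k % m) h₁).trans (hmul (m + 1) (k % m) h₂)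
  have h6 : (k / m - k % m) * m + k % m * (m + 1) = k := by
    obtain ⟨d, hd⟩ : ∃ d, k / m = k % m + d := ⟨k / m - k % m, by omega⟩
    have h7 := Nat.div_add_mod k m
    rw [hd, Nat.add_sub_cancel_left]
    rw [hd] at h7
    nlinarith
  rw [h6] at h5
  exact h5

/-- Two blocks of identifiers produce the words `σ 0` and `σ ℓ` wherever they are placed. Placing
the second block right after the first, one position later, or before it gives walks from `σ 0` to
`σ ℓ` of lengths `ℓ` and `ℓ + 1`, and a walk of length `ℓ` back. So there are closed walks of
lengths `2 * ℓ` and `2 * ℓ + 1`. -/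
theorem exists_flexible_usable [Finite Γ] [Nonempty Γ] (hψ : IsVerifierFor K r ψ P)
    (hK : K.Nonempty) (hc : 1 ≤ c) {A : LocalAlgorithm Γ} {n t : ℕ} (hA : SolvesAt K c P A n t)
    (hn : 2 * (2 * t + 2 * r + 3) + 1 ≤ n) :
    ∃ s : Fin (2 * r) → Γ, IsFlexible (DiagramEdge K r ψ) s ∧ IsUsable K P s := by
  obtain ⟨G, hG, hGn, hGp⟩ := exists_inst hK (show 3 ≤ n by omega)
  -- A block must contain the views, of radius `t + 1`, of `2 * r` consecutive nodes.
  set ℓ := 2 * t + 2 * r + 3 with hℓ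
  let σ : ℕ → Fin (2 * r) → Γ := fun off i =>
    A.output (A.run n t fun j : ℤ => some ((off + 1 + (t + 1 + i.val + j) : ℤ).toNat))
  have place : ∀ a b : ℤ, 0 ≤ a → a + ℓ ≤ n → 0 ≤ b → b + ℓ ≤ n → (a + ℓ ≤ b ∨ b + ℓ ≤ a) →
      ∃ l : G.V → Γ, P G l ∧ (∀ i : Fin (2 * r), G.unroll l (a + (t + 1) + i.val) = some (σ 0 i)) ∧
        ∀ i : Fin (2 * r), G.unroll l (b + (t + 1) + i.val) = some (σ ℓ i) := by
    intro a b ha ha' hb hb' hab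
    have hpow : n ≤ n ^ c := Nat.le_self_pow (by omega) n
    obtain ⟨l, hl, hl'⟩ := hA.exists_solution hc hG hGn
      {q : ℤ | (a ≤ q ∧ q < a + ℓ) ∨ (b ≤ q ∧ q < b + ℓ)}
      (f := fun q => if a ≤ q ∧ q < a + ℓ then (q - a + 1).toNat else (ℓ + 1 + (q - b)).toNat)
      (by
        intro x hx y hy hxy
        simp only [Set.mem_ofPred_eq] at hx hy hxy
        split_ifs at hxy <;> omega)
      (by
        intro x hx
        simp only [Set.mem_ofPred_eq] at hx ⊢
        split_ifs <;> omega)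
    refine ⟨l, hl, fun i => ?_, fun i => ?_⟩
    · have := i.isLt
      refine hl' _ _ (by omega) (by omega) fun j hj => ?_
      rw [abs_le] at hj
      left
      refine ⟨by omega, by omega, ?_, ?_⟩
      · simp only [Set.mem_ofPred_eq]
        omega
      · rw [if_pos (by omega)]
        congr 1
        push_cast
        omega
    · have := i.isLt
      refine hl' _ _ (by omega) (by omega) fun j hj => ?_
      rw [abs_le] at hj
      left
      refine ⟨by omega, by omega, ?_, ?_⟩
      · simp only [Set.mem_ofPred_eq]
        omega
      · rw [if_neg (by omega)]
        congr 1
        omega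
  have happy : ∀ l : G.V → Γ, P G l → ∀ v, ψ G l v := fun l hl => (hψ.2 G hG l).1 hl
  obtain ⟨l₁, hl₁, hX₁, hY₁⟩ := place 0 ℓ (by omega) (by omega) (by omega) (by omega) (by omega)
  obtain ⟨l₂, hl₂, hX₂, hY₂⟩ := place 0 (ℓ + 1) (by omega) (by omega) (by omega) (by omega)
    (by omega)
  obtain ⟨l₃, hl₃, hX₃, hY₃⟩ := place ℓ 0 (by omega) (by omega) (by omega) (by omega) (by omega)
  have w₁ : HasWalk (DiagramEdge K r ψ) ℓ (σ 0) (σ ℓ) :=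
    hasWalk_of_solution hψ.1 hG (happy _ hl₁) (by omega) (by omega) (by omega) hX₁ fun i => by
      rw [← hY₁ i]; congr 1; omega
  have w₂ : HasWalk (DiagramEdge K r ψ) (ℓ + 1) (σ 0) (σ ℓ) :=
    hasWalk_of_solution hψ.1 hG (happy _ hl₂) (by omega) (by omega) (by push_cast; omega) hX₂
      fun i => by rw [← hY₂ i]; congr 1; push_cast; omega
  have w₃ : HasWalk (DiagramEdge K r ψ) ℓ (σ ℓ) (σ 0) :=
    hasWalk_of_solution hψ.1 hG (happy _ hl₃) (by omega) (by omega) (by omega) hY₃ fun i => by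
      rw [← hX₃ i]; congr 1; omega
  have hflex : IsFlexible (DiagramEdge K r ψ) (σ 0) := by
    refine isFlexible_of_consecutive (w₁.trans w₃) ?_
    rw [show ℓ + ℓ + 1 = ℓ + 1 + ℓ by omega]
    exact w₂.trans w₃
  exact ⟨σ 0, hflex, usable_of_solution hψ hG hGp hl₁ (by omega) (by omega) (by omega) hX₁ hflex⟩

/-! ### Fast algorithms produce constant runs -/

/-- Shift graphs have unbounded chromatic number. One variable is removed at a time by passing from
`f` to the set of values that `f` takes when the last entry varies above the others; the price is
that `Q` becomes `Set Q`. The case of one variable is the pigeonhole principle. -/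
theorem exists_shift_eq (k : ℕ) : ∀ (Q : Type*) [Finite Q], ∃ N : ℕ, ∀ f : (ℕ → ℕ) → Q,
    (∀ x y, (∀ i < k + 1, x i = y i) → f x = f y) →
    ∃ z : ℕ → ℕ, (∀ i < k + 1, z i < z (i + 1)) ∧ (∀ i ≤ k + 1, z i < N) ∧
      f z = f fun i => z (i + 1) := by
  induction k with
  | zero =>
    intro Q _
    refine ⟨Nat.card Q + 1, fun f hf => ?_⟩
    have hni : ¬ Function.Injective fun a : Fin (Nat.card Q + 1) => f fun _ => a.val := by
      intro h
      have := Nat.card_le_card_of_injective _ h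
      simp at this
    have key : ∀ a b : Fin (Nat.card Q + 1), a.val < b.val →
        (f fun _ => a.val) = (f fun _ => b.val) →
        ∃ z : ℕ → ℕ, (∀ i < 0 + 1, z i < z (i + 1)) ∧ (∀ i ≤ 0 + 1, z i < Nat.card Q + 1) ∧
          f z = f fun i => z (i + 1) := by
      intro a b hab h
      refine ⟨fun i => if i = 0 then a.val else b.val, ?_, ?_, ?_⟩
      · intro i hi
        obtain rfl : i = 0 := by omega
        simpa using hab
      · intro i _
        have := a.isLt
        have := b.isLt
        simp only
        split_ifs <;> omega
      · rw [hf _ (fun _ => a.val) (fun i hi => by simp; omega), h]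
        exact hf _ _ fun i hi => by simp
    simp only [Function.Injective, not_forall] at hni
    obtain ⟨a, b, h, hne⟩ := hni
    rcases lt_or_gt_of_ne (fun h' => hne (Fin.ext h') : a.val ≠ b.val) with h' | h'
    · exact key a b h' h
    · exact key b a h' h.symm
  | succ k ih =>
    intro Q _
    obtain ⟨N, hN⟩ := ih (Set Q)
    refine ⟨N, fun f hf => ?_⟩
    -- The value `f z` lies in the set belonging to `z`, hence in the set belonging to the shifted
    -- sequence; the entry that realizes it there becomes the new last entry.
    obtain ⟨z, hz1, hz2, hz3⟩ := hN
      (fun x => {q | ∃ y, x k < y ∧ y < N ∧ f (fun i => if i = k + 1 then y else x i) = q})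
      (by
        intro x y hxy
        ext q
        simp only [Set.mem_ofPred_eq]
        refine exists_congr fun a => ?_
        rw [hxy k (by omega), hf (fun i => if i = k + 1 then a else x i)
          (fun i => if i = k + 1 then a else y i)]
        intro i hi
        split_ifs with h
        · rfl
        · exact hxy i (by omega))
    have hmem : f z ∈ {q | ∃ y, z k < y ∧ y < N ∧ f (fun i => if i = k + 1 then y else z i) = q} := by
      refine ⟨z (k + 1), hz1 k (by omega), hz2 _ le_rfl, ?_⟩
      congr 1
      ext i
      split_ifs with h
      · rw [h]
      · rfl
    rw [hz3] at hmem
    obtain ⟨y, hy1, hy2, hy3⟩ := hmem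
    refine ⟨fun i => if i = k + 2 then y else z i, ?_, ?_, ?_⟩
    · intro i hi
      rcases Nat.lt_or_ge i (k + 1) with h | h
      · simp only
        rw [if_neg (by omega), if_neg (by omega)]
        exact hz1 i h
      · obtain rfl : i = k + 1 := by omega
        simpa using hy1
    · intro i hi
      simp only
      split_ifs with h
      · exact hy2
      · exact hz2 i (by omega)
    · rw [hf _ z (fun i hi => if_neg (by omega)), ← hy3]
      congr 1
      ext i
      simp

/-- Apply `exists_shift_eq` to the `2 * r + 1` labels in the middle of a block with increasing
identifiers. Invariance of this list under the shift means that consecutive labels are equal. The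
identifiers needed are bounded in terms of `t₀` alone, so they are available for all large `n`. -/
theorem exists_const_of_fast [Finite Γ] [Nonempty Γ] (hψ : IsVerifierFor K r ψ P)
    (hK : K.Nonempty) (hc : 1 ≤ c) (t₀ : ℕ) : ∃ n₀, ∀ n ≥ n₀, ∀ t ≤ t₀, ∀ A : LocalAlgorithm Γ,
      SolvesAt K c P A n t → ∃ a : Γ, Feasible K r ψ (fun _ => a) ∧
        IsUsable K P (fun _ : Fin (2 * r) => a) := by
  obtain ⟨N, hN⟩ := exists_shift_eq (2 * t₀ + 2 * r + 3) (Fin (2 * r + 1) → Γ)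
  refine ⟨N + 2 * t₀ + 2 * r + 6, fun n hn t ht A hA => ?_⟩
  obtain ⟨G, hG, hGn, hGp⟩ := exists_inst hK (show 3 ≤ n by omega)
  let L : (ℕ → ℕ) → ℤ → Γ := fun z q => A.output (A.run n t fun j => some (z (q + j).toNat + 1))
  obtain ⟨z, hz1, hz2, hz3⟩ := hN (fun z i => L z (t + 1 + i.val)) (by
    intro x y hxy
    ext i
    have := i.isLt
    simp only [L]
    congr 1
    refine A.run_congr _ _ _ _ fun j hj => ?_
    rw [abs_le] at hj
    rw [hxy _ (by omega)])
  have hmono : ∀ j ≤ 2 * t₀ + 2 * r + 4, ∀ i < j, z i < z j := by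
    intro j hj
    induction j with
    | zero => intro i hi; omega
    | succ j ih =>
      intro i hi
      have h1 := hz1 j (by omega)
      rcases Nat.lt_or_ge i j with h | h
      · exact (ih (by omega) i h).trans h1
      · obtain rfl : i = j := by omega
        exact h1
  have hstep : ∀ i : ℕ, i < 2 * r + 1 → L z (t + 1 + i) = L z (t + 1 + i + 1) := by
    intro i hi
    have h1 := congrFun hz3 ⟨i, hi⟩
    simp only at h1
    rw [h1]
    simp only [L]
    congr 1
    refine A.run_congr _ _ _ _ fun j hj => ?_
    rw [abs_le] at hj
    congr 3
    omega
  have hconst : ∀ i : ℕ, i ≤ 2 * r + 1 → L z (t + 1 + i) = L z (t + 1) := by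
    intro i
    induction i with
    | zero => intro _; simp
    | succ i ih =>
      intro hi
      rw [← ih (by omega), hstep i (by omega)]
      push_cast
      congr 1
  have hpow : n ≤ n ^ c := Nat.le_self_pow (by omega) n
  obtain ⟨l, hl, hl'⟩ := hA.exists_solution hc hG hGn
    {q : ℤ | 0 ≤ q ∧ q ≤ 2 * t₀ + 2 * r + 4} (f := fun q => z q.toNat + 1)
    (by
      intro x hx y hy hxy
      simp only [Set.mem_ofPred_eq, add_left_inj] at hx hy hxy
      by_contra hne
      rcases lt_or_gt_of_ne hne with h | h
      · have := hmono y.toNat (by omega) x.toNat (by omega)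
        omega
      · have := hmono x.toNat (by omega) y.toNat (by omega)
        omega)
    (by
      intro x hx
      simp only [Set.mem_ofPred_eq] at hx ⊢
      have := hz2 x.toNat (by omega)
      omega)
  have hlab : ∀ i : ℕ, i ≤ 2 * r → G.unroll l (t + 1 + i) = some (L z (t + 1)) := by
    intro i hi
    rw [← hconst i (by omega)]
    refine hl' _ _ (by omega) (by omega) fun j hj => ?_
    rw [abs_le] at hj
    left
    refine ⟨by omega, by omega, ?_, rfl⟩
    simp only [Set.mem_ofPred_eq]
    omega
  have hf : Feasible K r ψ (fun _ => L z (t + 1)) :=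
    feasible_of_solution hψ.1 hG ((hψ.2 G hG l).1 hl) (by omega) (p := t + 1) (by omega) (by omega)
      fun i => hlab i.val (by have := i.isLt; omega)
  exact ⟨_, hf, usable_of_solution hψ hG hGp hl (by omega) (p := t + 1) (by omega) (by omega)
    (fun i => hlab i.val (by have := i.isLt; omega)) (isFlexible_of_loop (loop_of_const hf))⟩

end Flexible

section Sequences

/-- `F` depends only on the values within distance `R`. -/
def LocalAt {α β : Type*} (R : ℕ) (F : (ℤ → α) → β) : Prop :=
  ∀ x y : ℤ → α, (∀ j : ℤ, |j| ≤ R → x j = y j) → F x = F y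

theorem LocalAt.mono {α β : Type*} {R R' : ℕ} {F : (ℤ → α) → β} (h : LocalAt R F) (hR : R ≤ R') :
    LocalAt R' F := fun x y hxy => h x y fun j hj => hxy j (by omega)

theorem LocalAt.shift {α β : Type*} {R : ℕ} {F : (ℤ → α) → β} (h : LocalAt R F) (d : ℤ) :
    LocalAt (R + d.natAbs) fun x => F fun j => x (d + j) :=
  fun x y hxy => h _ _ fun j hj => hxy _ (by rw [abs_le] at *; omega)

/-! ### Greedy independent sets -/

/-- The greedy `a`-independent set for the colors `0, …, m - 1` of `κ`. -/
def greedySet (a : ℕ) (κ : ℤ → ℕ) : ℕ → ℤ → Prop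
  | 0, _ => False
  | m + 1, i => greedySet a κ m i ∨ (κ i = m ∧ ∀ j : ℤ, |j - i| ≤ a → ¬ greedySet a κ m j)

theorem greedySet_sep {a Q : ℕ} {κ : ℤ → ℕ}
    (hκ : ∀ i j : ℤ, i ≠ j → |i - j| ≤ a → κ i < Q → κ i ≠ κ j) {m : ℕ} (hm : m ≤ Q) :
    ∀ {i j : ℤ}, greedySet a κ m i → greedySet a κ m j → i ≠ j → (a : ℤ) < |i - j| := by
  induction m with
  | zero => intro i j h; exact h.elim
  | succ m ih =>
    rintro i j (h1 | ⟨h1, h1'⟩) (h2 | ⟨h2, h2'⟩) hne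
    · exact ih (by omega) h1 h2 hne
    · by_contra hlt
      exact h2' i (by omega) h1
    · by_contra hlt
      exact h1' j (by rw [abs_sub_comm]; omega) h2
    · by_contra hlt
      exact hκ i j hne (by omega) (by omega) (by omega)

theorem greedySet_dense {a : ℕ} {κ : ℤ → ℕ} {m : ℕ} :
    ∀ {i : ℤ}, κ i < m → ∃ j : ℤ, |j - i| ≤ a ∧ greedySet a κ m j := by
  induction m with
  | zero => intro i h; omega
  | succ m ih =>
    intro i h
    by_cases h1 : ∃ j : ℤ, |j - i| ≤ a ∧ greedySet a κ m j
    · obtain ⟨j, hj, hj'⟩ := h1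
      exact ⟨j, hj, Or.inl hj'⟩
    · rcases Nat.lt_or_ge (κ i) m with h2 | h2
      · exact absurd (ih h2) h1
      · exact ⟨i, by simp, Or.inr ⟨by omega, fun j hj hj' => h1 ⟨j, hj, hj'⟩⟩⟩

/-- Each colour is decided by the smaller colours within distance `a`, so `m` colours look `a * m`
far. -/
theorem greedySet_congr {a : ℕ} {κ κ' : ℤ → ℕ} {m : ℕ} : ∀ {i i' : ℤ},
    (∀ j : ℤ, |j| ≤ ((a * m : ℕ) : ℤ) → κ (i + j) = κ' (i' + j)) →
    (greedySet a κ m i ↔ greedySet a κ' m i') := by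
  induction m with
  | zero => intro i i' _; exact Iff.rfl
  | succ m ih =>
    intro i i' h
    rw [Nat.mul_succ] at h
    have h0 : κ i = κ' i' := by simpa using h 0 (by rw [abs_zero]; positivity)
    have hd : ∀ d : ℤ, |d| ≤ a → (greedySet a κ m (i + d) ↔ greedySet a κ' m (i' + d)) := by
      intro d hd
      refine ih fun j hj => ?_
      rw [add_assoc, add_assoc]
      exact h _ (by rw [abs_le] at *; push_cast at *; omega)
    have h1 := hd 0 (by simp)
    rw [add_zero, add_zero] at h1
    simp only [greedySet]
    rw [h1, h0]
    refine or_congr Iff.rfl (and_congr Iff.rfl ?_)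
    constructor
    · intro h2 j hj hj'
      refine h2 (i + (j - i')) (by rw [add_sub_cancel_left]; exact hj) ((hd _ hj).2 ?_)
      rwa [add_sub_cancel]
    · intro h2 j hj hj'
      refine h2 (i' + (j - i)) (by rw [add_sub_cancel_left]; exact hj) ((hd _ hj).1 ?_)
      rwa [add_sub_cancel]

/-! ### Filling the gaps between anchors -/

theorem exists_consecutive {S : Set ℤ} {i : ℤ} {b : ℕ}
    (h₁ : ∃ p ∈ S, p ≤ i ∧ i ≤ p + b) (h₂ : ∃ p ∈ S, i < p ∧ p ≤ i + b) :
    ∃ p ∈ S, ∃ p' ∈ S, p ≤ i ∧ i < p' ∧ p' - p ≤ 2 * b ∧ i ≤ p + b ∧ p' ≤ i + b ∧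
      ∀ q ∈ S, q ≤ p ∨ p' ≤ q := by
  classical
  have e₁ : ∃ d : ℕ, i - d ∈ S := by
    obtain ⟨p, hp, h, -⟩ := h₁
    exact ⟨(i - p).toNat, by rwa [show i - ((i - p).toNat : ℤ) = p by omega]⟩
  have e₂ : ∃ d : ℕ, i + 1 + d ∈ S := by
    obtain ⟨p, hp, h, -⟩ := h₂
    exact ⟨(p - i - 1).toNat, by rwa [show i + 1 + ((p - i - 1).toNat : ℤ) = p by omega]⟩
  have l₁ : Nat.find e₁ ≤ b := by
    obtain ⟨p, hp, h, h'⟩ := h₁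
    have := Nat.find_min' e₁ (m := (i - p).toNat)
      (by rwa [show i - ((i - p).toNat : ℤ) = p by omega])
    omega
  have l₂ : Nat.find e₂ + 1 ≤ b := by
    obtain ⟨p, hp, h, h'⟩ := h₂
    have := Nat.find_min' e₂ (m := (p - i - 1).toNat)
      (by rwa [show i + 1 + ((p - i - 1).toNat : ℤ) = p by omega])
    omega
  refine ⟨_, Nat.find_spec e₁, _, Nat.find_spec e₂, by omega, by omega, by omega, by omega,
    by omega, fun q hq => ?_⟩
  by_contra hc
  push Not at hc
  rcases le_or_gt q i with h | h
  · have := Nat.find_min' e₁ (m := (i - q).toNat)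
      (by rwa [show i - ((i - q).toNat : ℤ) = q by omega])
    omega
  · have := Nat.find_min' e₂ (m := (q - i - 1).toNat)
      (by rwa [show i + 1 + ((q - i - 1).toNat : ℤ) = q by omega])
    omega

/-- The label given to a node by the walks `W` between consecutive anchors, when the anchors within
distance `B` of the node are those in `S`. -/
noncomputable def fillLabel {Γ : Type*} (W : ℕ → ℤ → Γ) (B : ℕ) (S : ℤ → Prop) : Γ :=
  W (sInf {d : ℕ | B ≤ d ∨ S (-d)} + sInf {d : ℕ | B ≤ d ∨ S (d + 1)} + 1)
    (sInf {d : ℕ | B ≤ d ∨ S (-d)} : ℕ)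

/-- The cut-off at `B` in both searches makes the label depend only on the anchors in sight. -/
theorem fillLabel_congr {Γ : Type*} {W : ℕ → ℤ → Γ} {B : ℕ} {S S' : ℤ → Prop}
    (h : ∀ j : ℤ, |j| ≤ B → (S j ↔ S' j)) : fillLabel W B S = fillLabel W B S' := by
  have h1 : {d : ℕ | B ≤ d ∨ S (-d)} = {d : ℕ | B ≤ d ∨ S' (-d)} := by
    ext d
    simp only [Set.mem_ofPred_eq]
    by_cases hd : B ≤ d
    · simp [hd]
    · rw [h _ (by rw [abs_le]; omega)]
  have h2 : {d : ℕ | B ≤ d ∨ S (d + 1)} = {d : ℕ | B ≤ d ∨ S' (d + 1)} := by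
    ext d
    simp only [Set.mem_ofPred_eq]
    by_cases hd : B ≤ d
    · simp [hd]
    · rw [h _ (by rw [abs_le]; omega)]
  rw [fillLabel, fillLabel, h1, h2]

theorem sInf_eq_of_min {T : Set ℕ} {m : ℕ} (hm : m ∈ T) (h : ∀ d ∈ T, m ≤ d) : sInf T = m :=
  le_antisymm (Nat.sInf_le hm) (h _ (Nat.sInf_mem ⟨m, hm⟩))

theorem fillLabel_eq {Γ : Type*} {W : ℕ → ℤ → Γ} {B : ℕ} {S : Set ℤ} {i p p' : ℤ} (hp : p ∈ S)
    (hp' : p' ∈ S) (h1 : p ≤ i) (h2 : i < p') (hB : p' - p ≤ B)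
    (hS : ∀ q ∈ S, q ≤ p ∨ p' ≤ q) :
    fillLabel W B (fun j => i + j ∈ S) = W (p' - p).toNat (i - p) := by
  have e1 : sInf {d : ℕ | B ≤ d ∨ i + -(d : ℤ) ∈ S} = (i - p).toNat := by
    refine sInf_eq_of_min ?_ ?_
    · right
      rwa [show i + -(((i - p).toNat : ℕ) : ℤ) = p by omega]
    · rintro d (hd | hd)
      · omega
      · rcases hS _ hd with h | h <;> omega
  have e2 : sInf {d : ℕ | B ≤ d ∨ i + ((d : ℤ) + 1) ∈ S} = (p' - i - 1).toNat := by
    refine sInf_eq_of_min ?_ ?_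
    · right
      rwa [show i + ((((p' - i - 1).toNat : ℕ) : ℤ) + 1) = p' by omega]
    · rintro d (hd | hd)
      · omega
      · rcases hS _ hd with h | h <;> omega
  rw [fillLabel, e1, e2]
  congr 1 <;> omega

/-- The walks `W k` of length `k` from `s` to itself inside `C`, for `k ≥ a`. -/
structure IsLoopFamily {Γ : Type*} (K : Set Kind) (r : ℕ) (ψ : Verifier Γ)
    (C : Set (Fin (2 * r) → Γ)) (s : Fin (2 * r) → Γ) (a : ℕ) (W : ℕ → ℤ → Γ) : Prop where
  start : ∀ k ≥ a, word (2 * r) (W k) 0 = s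
  finish : ∀ k ≥ a, word (2 * r) (W k) k = s
  feasible : ∀ k ≥ a, ∀ i : ℕ, i < k → Feasible K r ψ (word (2 * r + 1) (W k) i)
  mem : ∀ k ≥ a, ∀ i : ℕ, i ≤ k → word (2 * r) (W k) i ∈ C

theorem IsPrimitive.exists_loopFamily {Γ : Type*} [Nonempty Γ] {K : Set Kind} {r : ℕ}
    {ψ : Verifier Γ}
    {C : Set (Fin (2 * r) → Γ)} {k₀ : ℕ} (h : IsPrimitive K r ψ C k₀) {s : Fin (2 * r) → Γ}
    (hs : s ∈ C) : ∃ W, IsLoopFamily K r ψ C s k₀ W := by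
  choose! W h1 h2 h3 h4 using fun k (hk : k ≥ k₀) => h k hk s hs s hs
  exact ⟨W, h1, h2, h3, h4⟩

theorem IsLoopFamily.apply_start {Γ : Type*} {K : Set Kind} {r : ℕ} {ψ : Verifier Γ}
    {C : Set (Fin (2 * r) → Γ)} {s : Fin (2 * r) → Γ} {a : ℕ} {W : ℕ → ℤ → Γ}
    (hW : IsLoopFamily K r ψ C s a W) {k : ℕ} (hk : a ≤ k) {j : ℤ} (h0 : 0 ≤ j)
    (h1 : j < 2 * r) : W k j = s ⟨j.toNat, by omega⟩ := by
  rw [← hW.start k hk]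
  simp only [word]
  congr 1
  omega

theorem IsLoopFamily.apply_finish {Γ : Type*} {K : Set Kind} {r : ℕ} {ψ : Verifier Γ}
    {C : Set (Fin (2 * r) → Γ)} {s : Fin (2 * r) → Γ} {a : ℕ} {W : ℕ → ℤ → Γ}
    (hW : IsLoopFamily K r ψ C s a W) {k : ℕ} (hk : a ≤ k) {j : ℤ} (h0 : 0 ≤ j)
    (h1 : j < 2 * r) : W k (k + j) = s ⟨j.toNat, by omega⟩ := by
  rw [← hW.finish k hk]
  simp only [word]
  congr 1
  omega

/-- A window that starts before `p'` may reach beyond it by fewer than `2 * r + 1` positions, and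
there both `y` and the continuation of the walk read `s`. -/
theorem IsLoopFamily.window {Γ : Type*} {K : Set Kind} {r : ℕ} {ψ : Verifier Γ}
    {C : Set (Fin (2 * r) → Γ)} {s : Fin (2 * r) → Γ} {a : ℕ} {W : ℕ → ℤ → Γ}
    (hW : IsLoopFamily K r ψ C s a W) {y : ℤ → Γ} {p p' : ℤ} (hp : a ≤ p' - p)
    (hy : ∀ i, p ≤ i → i < p' → y i = W (p' - p).toNat (i - p))
    (hy' : ∀ j : Fin (2 * r), y (p' + j.val) = s j) {i : ℤ} (h1 : p ≤ i) (h2 : i < p') :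
    Feasible K r ψ (word (2 * r + 1) y i) ∧ word (2 * r) y i ∈ C := by
  have key : ∀ j : ℤ, 0 ≤ j → j ≤ 2 * r → y (i + j) = W (p' - p).toNat ((i - p).toNat + j) := by
    intro j h3 h4
    rcases lt_or_ge (i + j) p' with h5 | h5
    · rw [hy _ (by omega) h5]
      congr 1
      omega
    · have e1 := hW.apply_finish (k := (p' - p).toNat) (by omega) (j := i + j - p') (by omega)
        (by omega)
      rw [show i + j = p' + (((i + j - p').toNat : ℕ) : ℤ) by omega]
      rw [show ((i - p).toNat : ℤ) + j = (p' - p).toNat + (i + j - p') by omega, e1]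
      exact hy' ⟨(i + j - p').toNat, by omega⟩
  constructor
  · convert hW.feasible (p' - p).toNat (by omega) (i - p).toNat (by omega) using 1
    ext j
    have := j.isLt
    exact key _ (by omega) (by omega)
  · convert hW.mem (p' - p).toNat (by omega) (i - p).toNat (by omega) using 1
    ext j
    have := j.isLt
    exact key _ (by omega) (by omega)

/-! ### Labels near the ends -/

open Classical in
/-- Label the first `p₀` nodes as in `l₀`, the last `q₀` nodes as at the end of `l₀`, on a path
with `p₀ + q₀` nodes, and the other nodes by `mid`. -/
noncomputable def withEnds {Γ : Type*} (p₀ q₀ : ℕ) (l₀ : ℤ → Γ) (mid : (ℤ → Option ℕ) → Γ)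
    (x : ℤ → Option ℕ) : Γ :=
  if x (-p₀) = none then l₀ (sInf {d : ℕ | p₀ ≤ d ∨ x (-(d + 1)) = none} : ℕ) else
    if x q₀ = none then
      l₀ ((p₀ : ℤ) + q₀ - 1 - (sInf {d : ℕ | q₀ ≤ d ∨ x (d + 1) = none} : ℕ)) else mid x

theorem LocalAt.withEnds {Γ : Type*} {p₀ q₀ R : ℕ} {l₀ : ℤ → Γ} {mid : (ℤ → Option ℕ) → Γ}
    (h : LocalAt R mid) : LocalAt (R + p₀ + q₀) (withEnds p₀ q₀ l₀ mid) := by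
  intro x y hxy
  have h1 : {d : ℕ | p₀ ≤ d ∨ x (-(d + 1)) = none} = {d : ℕ | p₀ ≤ d ∨ y (-(d + 1)) = none} := by
    ext d
    simp only [Set.mem_ofPred_eq]
    by_cases hd : p₀ ≤ d
    · simp [hd]
    · rw [hxy _ (by rw [abs_le]; push_cast; omega)]
  have h2 : {d : ℕ | q₀ ≤ d ∨ x (d + 1) = none} = {d : ℕ | q₀ ≤ d ∨ y (d + 1) = none} := by
    ext d
    simp only [Set.mem_ofPred_eq]
    by_cases hd : q₀ ≤ d
    · simp [hd]
    · rw [hxy _ (by rw [abs_le]; push_cast; omega)]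
  rw [LocalMending.withEnds, LocalMending.withEnds, h1, h2,
    h x y fun j hj => hxy j (by push_cast; omega),
    hxy (-p₀) (by rw [abs_le]; push_cast; omega), hxy q₀ (by rw [abs_le]; push_cast; omega)]

theorem withEnds_prefix {Γ : Type*} {p₀ q₀ n : ℕ} {l₀ : ℤ → Γ} {mid : (ℤ → Option ℕ) → Γ}
    {X : ℤ → Option ℕ} (hX : ∀ i, (X i).isSome ↔ 0 ≤ i ∧ i < n) {i : ℤ}
    (h0 : 0 ≤ i) (h1 : i < p₀) (hn : p₀ ≤ n) :
    withEnds p₀ q₀ l₀ mid (fun j => X (i + j)) = l₀ i := by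
  have hnone : ∀ i, X i = none ↔ ¬ (0 ≤ i ∧ i < n) := fun i => by
    rw [← hX, Option.not_isSome_iff_eq_none]
  rw [withEnds, if_pos (by rw [hnone]; omega)]
  congr 1
  rw [sInf_eq_of_min (m := i.toNat)]
  · omega
  · right
    rw [hnone]
    omega
  · rintro d (hd | hd)
    · omega
    · rw [hnone] at hd
      omega

theorem withEnds_suffix {Γ : Type*} {p₀ q₀ n : ℕ} {l₀ : ℤ → Γ} {mid : (ℤ → Option ℕ) → Γ}
    {X : ℤ → Option ℕ} (hX : ∀ i, (X i).isSome ↔ 0 ≤ i ∧ i < n) {i : ℤ}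
    (h0 : n - q₀ ≤ i) (h1 : i < n) (hn : p₀ + q₀ ≤ n) :
    withEnds p₀ q₀ l₀ mid (fun j => X (i + j)) = l₀ (i - (n - (p₀ + q₀))) := by
  have hnone : ∀ i, X i = none ↔ ¬ (0 ≤ i ∧ i < n) := fun i => by
    rw [← hX, Option.not_isSome_iff_eq_none]
  rw [withEnds, if_neg (by rw [hnone]; omega), if_pos (by rw [hnone]; omega)]
  congr 1
  rw [sInf_eq_of_min (m := (n - 1 - i).toNat)]
  · omega
  · right
    rw [hnone]
    omega
  · rintro d (hd | hd)
    · omega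
    · rw [hnone] at hd
      omega

theorem withEnds_mid {Γ : Type*} {p₀ q₀ : ℕ} {l₀ : ℤ → Γ} {mid : (ℤ → Option ℕ) → Γ}
    {x : ℤ → Option ℕ} (h1 : (x (-p₀)).isSome) (h2 : (x q₀).isSome) :
    withEnds p₀ q₀ l₀ mid x = mid x := by
  rw [withEnds, if_neg (by intro h; rw [h] at h1; cases h1),
    if_neg (by intro h; rw [h] at h2; cases h2)]

end Sequences

/-! ### Colouring by executions on every `j`-th node -/

section Coloring

variable {Γ : Type*} {K : Set Kind} {c r : ℕ} {ψ : Verifier Γ} {P : Problem Γ}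

/-- A position on the path with `n` nodes from which the ends look as they do from `c₀` when only
every `j`-th node is visible. -/
theorem exists_center {n M j : ℕ} (hj : 1 ≤ j) (hn : 2 * (M * j) + 2 ≤ n) {c₀ : ℤ} (h0 : 0 ≤ c₀)
    (h1 : c₀ < n) : ∃ p : ℤ, ∀ i : ℤ, |i| ≤ M →
      ((0 ≤ p + i ∧ p + i < n) ↔ (0 ≤ c₀ + i * j ∧ c₀ + i * j < n)) := by
  have hj' : (0 : ℤ) < j := by omega
  have hM : M ≤ M * j := Nat.le_mul_of_pos_right M hj
  have hL : ∀ i : ℤ, 0 ≤ c₀ + i * j ↔ -(c₀ / j) ≤ i := by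
    intro i
    rw [neg_le, Int.le_ediv_iff_mul_le hj', neg_mul]
    omega
  have hR : ∀ i : ℤ, c₀ + i * j < n ↔ i ≤ (n - 1 - c₀) / j := by
    intro i
    rw [Int.le_ediv_iff_mul_le hj']
    omega
  have h2 : 0 ≤ c₀ / j := Int.ediv_nonneg h0 hj'.le
  have h3 : 0 ≤ (n - 1 - c₀) / j := Int.ediv_nonneg (by omega) hj'.le
  have h4 : ((M * j : ℕ) : ℤ) = (M : ℤ) * j := by push_cast; rfl
  -- The assumption on `n` prevents both ends from being in view. An end that is in view fixes the
  -- position; otherwise any position far from both ends will do.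
  by_cases hl : c₀ / j < M
  · have hr : M ≤ (n - 1 - c₀) / j := by
      rw [Int.le_ediv_iff_mul_le hj']
      have : c₀ < M * j := (Int.ediv_lt_iff_lt_mul hj').1 hl
      omega
    refine ⟨c₀ / j, fun i hi => ?_⟩
    rw [abs_le] at hi
    rw [hL, hR]
    omega
  by_cases hr : (n - 1 - c₀) / j < M
  · refine ⟨n - 1 - (n - 1 - c₀) / j, fun i hi => ?_⟩
    rw [abs_le] at hi
    rw [hL, hR]
    omega
  · refine ⟨M, fun i hi => ?_⟩
    rw [abs_le] at hi
    rw [hL, hR]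
    omega

theorem Inst.unroll_inj {G : Inst} {ident : G.V → ℕ} (hi : Function.Injective ident) {i j : ℤ}
    (h : G.unroll ident i = G.unroll ident j) (hs : (G.unroll ident i).isSome)
    (hij : |i - j| < G.n) : i = j := by
  obtain ⟨a, ha⟩ := Option.isSome_iff_exists.1 hs
  rw [ha] at h
  obtain ⟨u, hu, hu'⟩ := Inst.unroll_eq_some.1 ha
  obtain ⟨w, hw, hw'⟩ := Inst.unroll_eq_some.1 h.symm
  obtain rfl : u = w := hi (hu'.trans hw'.symm)
  exact Inst.node_inj hu hw hij

/-- If an algorithm, executed on every `j`-th node only, gives the same label to `2 * r + 1`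
consecutive nodes, then the constant labeling is happy and usable. -/
theorem usable_const_of_run [Finite Γ] [Nonempty Γ] (hψ : IsVerifierFor K r ψ P) (hc : 1 ≤ c)
    {A : LocalAlgorithm Γ} {n t : ℕ} (hA : SolvesAt K c P A n t) {G : Inst} (hG : G.kind ∈ K)
    (hGn : G.n = n) {ident : G.V → ℕ} (hi : Function.Injective ident)
    (hb : ∀ v, 1 ≤ ident v ∧ ident v ≤ n ^ c) {j : ℕ} (hj : 1 ≤ j)
    (hn : 2 * ((t + 1 + r) * j) + 3 ≤ n) {c₀ : ℤ} {a : Γ}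
    (hrun : ∀ i : ℤ, |i| ≤ r → (G.unroll ident (c₀ + i * j)).isSome ∧
      A.output (A.run n t fun k => G.unroll ident (c₀ + (i + k) * j)) = a) :
    Feasible K r ψ (fun _ => a) ∧ IsUsable K P (fun _ : Fin (2 * r) => a) := by
  set X := G.unroll ident with hX
  set M := t + 1 + r with hM
  have hMj : M ≤ M * j := Nat.le_mul_of_pos_right M hj
  -- Sampled nodes at most `2 * M` steps apart do not wrap around a cycle, so they are distinct and
  -- carry distinct identifiers.
  have hbound : ∀ i : ℤ, |i| ≤ 2 * M → |i * j| < n := by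
    intro i hi'
    rw [abs_mul, Nat.abs_cast]
    have h1 : |i| * (j : ℤ) ≤ 2 * M * j := mul_le_mul_of_nonneg_right hi' (by omega)
    have h2 : (2 * M * j : ℤ) = ((2 * (M * j) : ℕ) : ℤ) := by push_cast; ring
    omega
  -- In `G'` consecutive nodes around `p` are to receive the identifiers of every `j`-th node of `G`
  -- around `c₀`. For this exactly the same positions must exist.
  obtain ⟨G', hG', hGn', hGp', p, hp⟩ : ∃ G' : Inst, G'.kind ∈ K ∧ G'.n = n ∧
      (Kind.path ∈ K → G'.kind = Kind.path) ∧
      ∃ p : ℤ, ∀ i : ℤ, |i| ≤ M → ((0 ≤ p + i ∧ p + i < n) ↔ (X (c₀ + i * j)).isSome) := by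
    obtain ⟨G', hG', hGn', hGp'⟩ := exists_inst ⟨_, hG⟩ (show 3 ≤ n by omega)
    refine ⟨G', hG', hGn', hGp', ?_⟩
    cases hk : G.kind with
    | cycle =>
      -- On a cycle no end is ever seen, so the position only has to keep distance `M` from both
      -- ends of `G'`, which may be a path.
      refine ⟨M, fun i hi' => ?_⟩
      rw [hX, Inst.unroll_isSome]
      simp only [Inst.node_cycle_isSome hk, iff_true]
      rw [abs_le] at hi'
      omega
    | path =>
      have h0 := (hrun 0 (by simp)).1
      rw [hX, Inst.unroll_isSome, zero_mul, add_zero, Inst.node_path_isSome hk, hGn] at h0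
      obtain ⟨p, hp⟩ := exists_center hj (by omega : 2 * (M * j) + 2 ≤ n) h0.1 h0.2
      refine ⟨p, fun i hi' => ?_⟩
      rw [hX, Inst.unroll_isSome, Inst.node_path_isSome hk, hGn]
      exact hp i hi'
  have hXb : ∀ i m, X i = some m → 1 ≤ m ∧ m ≤ n ^ c := by
    intro i m h
    obtain ⟨u, -, rfl⟩ := Inst.unroll_eq_some.1 h
    exact hb u
  obtain ⟨l, hl, hl'⟩ := hA.exists_solution hc hG' hGn' {q : ℤ | |q - p| ≤ M ∧ 0 ≤ q ∧ q < n}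
    (f := fun q => (X (c₀ + (q - p) * j)).getD 0)
    (by
      rintro x ⟨hx1, hx2⟩ y ⟨hy1, hy2⟩ hxy
      have sx := (hp (x - p) hx1).1 (by rwa [add_sub_cancel])
      have sy := (hp (y - p) hy1).1 (by rwa [add_sub_cancel])
      have hxy' : X (c₀ + (x - p) * j) = X (c₀ + (y - p) * j) := by
        obtain ⟨u, hu⟩ := Option.isSome_iff_exists.1 sx
        obtain ⟨w, hw⟩ := Option.isSome_iff_exists.1 sy
        simp only [hu, hw, Option.getD_some] at hxy
        rw [hu, hw, hxy]
      have h1 := Inst.unroll_inj hi hxy' sx (by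
        rw [hGn, show c₀ + (x - p) * j - (c₀ + (y - p) * j) = (x - y) * j by ring]
        refine hbound _ ?_
        rw [abs_le] at *
        omega)
      have h2 : (x - y) * (j : ℤ) = 0 := by linarith
      rcases mul_eq_zero.1 h2 with h3 | h3 <;> omega)
    (by
      rintro x ⟨hx1, hx2⟩
      have sx := (hp (x - p) hx1).1 (by rwa [add_sub_cancel])
      obtain ⟨u, hu⟩ := Option.isSome_iff_exists.1 sx
      simp only [hu, Option.getD_some]
      exact hXb _ _ hu)
  have hlab : ∀ i : ℤ, |i| ≤ r → G'.unroll l (p + i) = some a := by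
    intro i hir
    obtain ⟨hs, ha⟩ := hrun i hir
    rw [← ha]
    have hpi := (hp i (by omega)).2 hs
    refine hl' _ _ hpi.1 hpi.2 fun k hk => ?_
    have hik : |i + k| ≤ M := by
      rw [abs_le] at *
      omega
    have hpk := hp (i + k) hik
    rw [← add_assoc] at hpk
    by_cases hin : 0 ≤ p + i + k ∧ p + i + k < n
    · left
      refine ⟨hin.1, hin.2, ⟨?_, hin⟩, ?_⟩
      · rwa [show p + i + k - p = i + k by ring]
      · obtain ⟨u, hu⟩ := Option.isSome_iff_exists.1 (hpk.1 hin)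
        rw [show p + i + k - p = i + k by ring, hu, Option.getD_some]
    · right
      have hnone : X (c₀ + (i + k) * j) = none := by
        rw [← Option.not_isSome_iff_eq_none]
        exact fun h => hin (hpk.2 h)
      refine ⟨?_, hin, hnone⟩
      cases hk : G.kind with
      | cycle =>
        have := Inst.node_cycle_isSome hk (c₀ + (i + k) * j)
        rw [← Inst.unroll_isSome (l := ident), ← hX, hnone] at this
        cases this
      | path => exact hGp' (hk ▸ hG)
  have hp1 := (hp (-r) (by rw [abs_le]; omega)).2 (hrun (-r) (by simp)).1
  have hp2 := (hp r (by rw [abs_le]; omega)).2 (hrun r (by simp)).1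
  have hlab' : ∀ i : ℕ, i ≤ 2 * r → G'.unroll l (p + -r + i) = some a := by
    intro i hi'
    rw [add_assoc]
    exact hlab _ (by rw [abs_le]; omega)
  have hf : Feasible K r ψ (fun _ => a) :=
    feasible_of_solution hψ.1 hG' ((hψ.2 G' hG' l).1 hl) (by omega) hp1.1 (by omega)
      fun i => hlab' i.val (by have := i.isLt; omega)
  exact ⟨hf, usable_of_solution hψ hG' hGp' hl (by omega) hp1.1 (by omega)
    (fun i => hlab' i.val (by have := i.isLt; omega)) (isFlexible_of_loop (loop_of_const hf))⟩

/-- The labels that `A` gives to the node and to `2 * r` later nodes when it is executed on every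
`j`-th node only, for `j = 1, …, a`. -/
noncomputable def stepCode (A : LocalAlgorithm Γ) (n t r a : ℕ) (x : ℤ → Option ℕ) :
    Fin a → Fin (2 * r + 1) → Option Γ := fun j i =>
  if (x (i.val * (j.val + 1 : ℕ))).isSome then
    some (A.output (A.run n t fun k => x ((i.val + k) * (j.val + 1 : ℕ)))) else none

/-- A numbering of the values of `stepCode`; the last number is for coordinates without node. -/
noncomputable def stepColor [Finite Γ] (A : LocalAlgorithm Γ) (n t r a : ℕ) (x : ℤ → Option ℕ) :
    ℕ :=
  if (x 0).isSome then
    (Finite.equivFin (Fin a → Fin (2 * r + 1) → Option Γ) (stepCode A n t r a x)).val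
  else Nat.card (Fin a → Fin (2 * r + 1) → Option Γ)

theorem stepColor_lt_iff [Finite Γ] {A : LocalAlgorithm Γ} {n t r a : ℕ} {x : ℤ → Option ℕ} :
    stepColor A n t r a x < Nat.card (Fin a → Fin (2 * r + 1) → Option Γ) ↔ (x 0).isSome := by
  rw [stepColor]
  split_ifs with h
  · simp [h]
  · simp [h]

theorem localAt_stepColor [Finite Γ] (A : LocalAlgorithm Γ) (n t r a : ℕ) :
    LocalAt ((2 * r + t + 1) * a) (stepColor A n t r a) := by
  intro x y hxy
  have hmul : ∀ (i : ℤ) (j : Fin a), |i| ≤ 2 * r + t + 1 →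
      |i * (j.val + 1 : ℕ)| ≤ ((2 * r + t + 1) * a : ℕ) := by
    intro i j hi
    rw [abs_mul, Nat.abs_cast]
    push_cast
    have := j.isLt
    exact mul_le_mul hi (by omega) (by omega) (by omega)
  have hcode : stepCode A n t r a x = stepCode A n t r a y := by
    ext1 j
    ext1 i
    have := i.isLt
    rw [stepCode, stepCode, hxy _ (hmul _ _ (by rw [abs_le]; omega)),
      A.run_congr n t _ (fun k => y ((i.val + k) * (j.val + 1 : ℕ))) fun k hk =>
        hxy _ (hmul _ _ (by rw [abs_le] at *; omega))]
  rw [stepColor, stepColor, hcode, hxy 0 (by rw [abs_zero]; omega)]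

/-- For step width `d` the record of `u + d` is that of `u` shifted by one sampled node. If the two
records agree, then all the labels in them agree, and `usable_const_of_run` produces a usable
constant word, contrary to `hno`. -/
theorem stepColor_ne [Finite Γ] [Nonempty Γ] (hψ : IsVerifierFor K r ψ P) (hc : 1 ≤ c)
    (hno : ∀ b : Γ, Feasible K r ψ (fun _ => b) → ¬ IsUsable K P (fun _ : Fin (2 * r) => b))
    {A : LocalAlgorithm Γ} {n t : ℕ} (hA : SolvesAt K c P A n t) {G : Inst} (hG : G.kind ∈ K)
    (hGn : G.n = n) {ident : G.V → ℕ} (hi : Function.Injective ident)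
    (hb : ∀ v, 1 ≤ ident v ∧ ident v ≤ n ^ c) {a : ℕ}
    (hn : 2 * ((t + 1 + r) * a) + 3 ≤ n) {u : ℤ} {d : ℕ} (hd : 1 ≤ d) (hda : d ≤ a)
    (h1 : (G.unroll ident u).isSome) (h2 : (G.unroll ident (u + d)).isSome) :
    stepColor A n t r a (fun j => G.unroll ident (u + j)) ≠
      stepColor A n t r a (fun j => G.unroll ident (u + d + j)) := by
  intro heq
  rw [stepColor, stepColor, if_pos (by simpa using h1), if_pos (by simpa using h2)] at heq
  have hcode := (Finite.equivFin _).injective (Fin.ext heq)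
  set X := G.unroll ident with hX
  -- Missing nodes count as `none`; as `u` exists, constancy of `g` also shows that all the sampled
  -- nodes exist.
  let g : ℕ → Option Γ := fun m => if (X (u + m * d)).isSome then
    some (A.output (A.run n t fun k => X (u + (m + k) * d))) else none
  have hg : ∀ i : ℕ, i ≤ 2 * r → g i = g (i + 1) := by
    intro i hi'
    have h3 := congrFun (congrFun hcode ⟨d - 1, by omega⟩) ⟨i, by omega⟩
    simp only [stepCode] at h3
    rw [show d - 1 + 1 = d by omega] at h3
    simp only [g]
    rw [h3]
    push_cast
    rw [show u + d + (i : ℤ) * d = u + ((i : ℤ) + 1) * d by ring]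
    congr 4
    ext1 k
    congr 1
    ring
  have hg' : ∀ i : ℕ, i ≤ 2 * r + 1 → g i = g 0 := by
    intro i
    induction i with
    | zero => intro _; rfl
    | succ i ih => intro hi'; rw [← hg i (by omega), ih (by omega)]
  obtain ⟨b, hgb⟩ : ∃ b, g 0 = some b := ⟨_, if_pos (by simpa using h1)⟩
  have hn' : 2 * ((t + 1 + r) * d) + 3 ≤ n := by
    have := Nat.mul_le_mul_left (t + 1 + r) hda
    omega
  obtain ⟨hf, hu⟩ := usable_const_of_run hψ hc hA hG hGn hi hb hd hn' (c₀ := u + r * d) (a := b)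
    (by
      intro i hir
      rw [abs_le] at hir
      have h3 := (hg' (r + i).toNat (by omega)).trans hgb
      simp only [g] at h3
      rw [show (((r + i).toNat : ℕ) : ℤ) = r + i by omega] at h3
      split_ifs at h3 with h4
      rw [show u + (r + i) * d = u + r * d + i * d by ring] at h4
      refine ⟨h4, ?_⟩
      rw [← Option.some.inj h3]
      congr 2
      ext1 k
      congr 1
      ring)
  exact hno b hf hu

end Coloring

/-! ### Algorithms for the restricted problem -/

section Solvers

variable {Γ : Type*} {K : Set Kind} {c r : ℕ} {ψ : Verifier Γ} {P : Problem Γ}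
  {C : Set (Fin (2 * r) → Γ)} {s : Fin (2 * r) → Γ} {N : ℕ}

/-- `I` is the region labeled by `fillLabel`. An anchor outside `I`, such as the one where the final
segment of a path begins, has to bring its word `s` along; this is `hS`. -/
theorem fill_windows {a b B : ℕ} {W : ℕ → ℤ → Γ} (hW : IsLoopFamily K r ψ C s a W)
    (har : 2 * r ≤ a) {S I : Set ℤ} {y : ℤ → Γ}
    (hsep : ∀ p ∈ S, ∀ q ∈ S, p < q → (a : ℤ) < q - p)
    (hdense : ∀ i ∈ I, (∃ p ∈ S, p ≤ i ∧ i ≤ p + b) ∧ ∃ p ∈ S, i < p ∧ p ≤ i + b)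
    (hI : ∀ i ∈ I, ∀ p ∈ S, ∀ p' ∈ S, p ≤ i → i < p' → ∀ k, p ≤ k → k < p' → k ∈ I)
    (hB : 2 * b ≤ B) (hy : ∀ i ∈ I, y i = fillLabel W B fun j => i + j ∈ S)
    (hS : ∀ p ∈ S, p ∉ I → ∀ j : Fin (2 * r), y (p + j.val) = s j) :
    (∀ p ∈ S, ∀ j : Fin (2 * r), y (p + j.val) = s j) ∧
      ∀ i ∈ I, Feasible K r ψ (word (2 * r + 1) y i) ∧ word (2 * r) y i ∈ C := by
  have hint : ∀ i ∈ I, ∃ p ∈ S, ∃ p' ∈ S, p ≤ i ∧ i < p' ∧ (∀ q ∈ S, q ≤ p ∨ p' ≤ q) ∧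
      ∀ k, p ≤ k → k < p' → y k = W (p' - p).toNat (k - p) := by
    intro i hi
    obtain ⟨p, hp, p', hp', h1, h2, h3, -, -, h4⟩ :=
      exists_consecutive (hdense i hi).1 (hdense i hi).2
    refine ⟨p, hp, p', hp', h1, h2, h4, fun k hk1 hk2 => ?_⟩
    rw [hy k (hI i hi p hp p' hp' h1 h2 k hk1 hk2)]
    exact fillLabel_eq hp hp' hk1 hk2 (by omega) h4
  have hanchor : ∀ p ∈ S, ∀ j : Fin (2 * r), y (p + j.val) = s j := by
    intro p hp j
    by_cases hpI : p ∈ I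
    · obtain ⟨q, hq, p', hp', h1, h2, h3, h4⟩ := hint p hpI
      have hqp : q = p := by
        rcases h3 p hp with h | h <;> omega
      subst hqp
      have hgap := hsep q hq p' hp' h2
      have hj := j.isLt
      rw [h4 _ (by omega) (by omega), add_sub_cancel_left,
        hW.apply_start (by omega) (by omega) (by omega)]
      congr 1
    · exact hS p hp hpI j
  refine ⟨hanchor, fun i hi => ?_⟩
  obtain ⟨p, hp, p', hp', h1, h2, -, h4⟩ := hint i hi
  have hgap := hsep p hp p' hp' (by omega)
  exact hW.window (by omega) h4 (hanchor p' hp') h1 h2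

/-- Labels for the two ends of a path, if paths are in the family. -/
structure EndWords (K : Set Kind) (r : ℕ) (ψ : Verifier Γ) (s : Fin (2 * r) → Γ) where
  p₀ : ℕ
  q₀ : ℕ
  l₀ : ℤ → Γ
  spec : Kind.path ∈ K → ∃ D : EndData r ψ s, D.p₀ = p₀ ∧ D.n₀ = p₀ + q₀ ∧ D.l₀ = l₀

theorem exists_endWords [Nonempty Γ] (hψ : IsVerifierFor K r ψ P) (hs : IsUsable K P s) :
    Nonempty (EndWords K r ψ s) := by
  by_cases hK : Kind.path ∈ K
  · obtain ⟨D⟩ := hs.endData hψ hK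
    have := D.hp
    exact ⟨⟨D.p₀, D.n₀ - D.p₀, D.l₀, fun _ => ⟨D, rfl, by omega, rfl⟩⟩⟩
  · exact ⟨⟨0, 0, fun _ => Classical.arbitrary Γ, fun h => absurd h hK⟩⟩

theorem Inst.unroll_add_n {α : Type*} {G : Inst} (hG : G.kind = Kind.cycle) (l : G.V → α) (i : ℤ) :
    G.unroll l (i + G.n) = G.unroll l i := by
  rw [Inst.unroll, Inst.unroll, Inst.node_add_n hG]

/-- Both end segments border on an occurrence of `s`, so they interact with the middle only through
this word. Quantifying over all `y` that continue `mid` by `s` keeps the end labels out of the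
analysis of the middle. -/
theorem restrictedProblem_withEnds_path (hψ : IsLocal K r ψ) (E : EndWords K r ψ s)
    (hN : E.p₀ + E.q₀ < N) {G : Inst} (hK : G.kind ∈ K) (hG : G.kind = Kind.path)
    (hn : E.p₀ + E.q₀ + 2 * r ≤ G.n) {ident : G.V → ℕ} {mid : (ℤ → Option ℕ) → Γ}
    (hm : ∀ j : Fin (2 * r),
      mid (fun k => G.unroll ident (E.p₀ + (j.val : ℤ) + k)) = s j)
    (hw : ∀ y : ℤ → Γ,
      (∀ i : ℤ, E.p₀ ≤ i → i < G.n - E.q₀ → y i = mid fun k => G.unroll ident (i + k)) →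
      (∀ j : Fin (2 * r), y (G.n - E.q₀ + j.val) = s j) →
      ∀ i : ℤ, E.p₀ ≤ i → i < G.n - E.q₀ →
      Feasible K r ψ (word (2 * r + 1) y i) ∧ word (2 * r) y i ∈ C) :
    RestrictedProblem r ψ N C G fun v =>
      withEnds E.p₀ E.q₀ E.l₀ mid fun j => G.unroll ident (v.val + j) := by
  obtain ⟨D, hp, hq, hl⟩ := E.spec (hG ▸ hK)
  have hDp := D.hp
  have hX : ∀ i, (G.unroll ident i).isSome ↔ 0 ≤ i ∧ i < G.n := fun i => by
    rw [Inst.unroll_isSome, Inst.node_path_isSome hG]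
  let y : ℤ → Γ := fun i => withEnds E.p₀ E.q₀ E.l₀ mid fun j => G.unroll ident (i + j)
  have y1 : ∀ i : ℤ, 0 ≤ i → i < E.p₀ → y i = E.l₀ i := fun i h0 h1 =>
    withEnds_prefix hX h0 h1 (by omega)
  have y2 : ∀ i : ℤ, G.n - E.q₀ ≤ i → i < G.n → y i = E.l₀ (i - (G.n - (E.p₀ + E.q₀))) :=
    fun i h0 h1 => withEnds_suffix hX h0 h1 (by omega)
  have y3 : ∀ i : ℤ, E.p₀ ≤ i → i < G.n - E.q₀ → y i = mid fun k => G.unroll ident (i + k) :=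
    fun i h0 h1 => withEnds_mid (by rw [hX]; omega) (by rw [hX]; omega)
  have hs : ∀ j : Fin (2 * r), E.l₀ (E.p₀ + j.val) = s j := by
    intro j
    rw [← hl, ← hp]
    exact congrFun D.hword j
  have hmid := hw y y3 (fun j => by
    have := j.isLt
    rw [y2 _ (by omega) (by omega), ← hs]
    congr 1
    ring)
  refine restrictedProblem_path hψ D (by omega) hK hG (by omega) (y := y) ?_ ?_ ?_
  · intro i h0 h1
    rw [hl]
    rcases lt_or_ge i E.p₀ with h2 | h2
    · exact y1 i h0 h2
    · have h3 := hm ⟨(i - E.p₀).toNat, by omega⟩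
      have h4 := hs ⟨(i - E.p₀).toNat, by omega⟩
      rw [show (E.p₀ : ℤ) + (i - E.p₀).toNat = i by omega] at h3 h4
      rw [y3 i h2 (by omega), h3, h4]
  · intro i h0 h1
    rw [hl, y2 _ (by omega) (by omega)]
    congr 1
    omega
  · intro i h0 h1
    exact hmid i (by omega) (by omega)

theorem withEnds_cycle {G : Inst} (hG : G.kind = Kind.cycle) {ident : G.V → ℕ} {p₀ q₀ : ℕ}
    {l₀ : ℤ → Γ} {mid : (ℤ → Option ℕ) → Γ} (i : ℤ) :
    withEnds p₀ q₀ l₀ mid (fun k => G.unroll ident (i + k)) =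
      mid fun k => G.unroll ident (i + k) :=
  withEnds_mid (by rw [Inst.unroll_isSome]; exact Inst.node_cycle_isSome hG _)
    (by rw [Inst.unroll_isSome]; exact Inst.node_cycle_isSome hG _)

theorem restrictedProblem_withEnds_cycle (hψ : IsLocal K r ψ) {G : Inst} (hK : G.kind ∈ K)
    (hG : G.kind = Kind.cycle) (hn : 2 * r + 2 ≤ G.n) {ident : G.V → ℕ} {p₀ q₀ : ℕ} {l₀ : ℤ → Γ}
    {mid : (ℤ → Option ℕ) → Γ}
    (hw : ∀ i : ℤ,
      Feasible K r ψ (word (2 * r + 1) (fun i => mid fun k => G.unroll ident (i + k)) i) ∧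
        word (2 * r) (fun i => mid fun k => G.unroll ident (i + k)) i ∈ C) :
    RestrictedProblem r ψ N C G fun v =>
      withEnds p₀ q₀ l₀ mid fun j => G.unroll ident (v.val + j) := by
  simp only [withEnds_cycle hG]
  refine restrictedProblem_cycle hψ hK hG hn (y := fun i => mid fun k => G.unroll ident (i + k))
    (fun i => ?_) fun i _ _ => hw i
  simp only
  congr 1
  ext1 k
  rw [add_right_comm, Inst.unroll_add_n hG]

/-- For large `n` combine an algorithm with any solver that is given by a function of the view. -/
theorem solvable_restricted {A : LocalAlgorithm Γ} {T R : ℕ → ℕ} (hψ : IsVerifierFor K r ψ P)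
    (hA : ∀ n, SolvesAt K c P A n (T n))
    (h : ∀ n ≥ N, ∃ F : (ℤ → Option ℕ) → Γ, LocalAt (R n) F ∧ ∀ G : Inst, G.kind ∈ K → G.n = n →
      ∀ ident : G.V → ℕ, Function.Injective ident → (∀ v, 1 ≤ ident v ∧ ident v ≤ n ^ c) →
      RestrictedProblem r ψ N C G fun v => F fun j => G.unroll ident (v.val + j)) :
    Solvable K c (RestrictedProblem r ψ N C) (fun n => if n < N then T n + 1 else R n) := by
  choose F hF1 hF2 using h
  -- Below `N` the clause about `C` is void and `A` itself is used; as a function of the view its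
  -- output needs radius `T n + 1`, by `run_congr`.
  refine solvable_of_view
    (fun n x => if hn : n ≥ N then F n hn x else A.output (A.run n (T n) x)) ?_ ?_
  · intro n x y hxy
    by_cases hn : n ≥ N
    · simp only [dif_pos hn]
      rw [if_neg (by omega)] at hxy
      exact hF1 n hn x y hxy
    · simp only [dif_neg hn]
      rw [if_pos (by omega)] at hxy
      rw [A.run_congr n (T n) x y (by exact_mod_cast hxy)]
  · intro G hG ident hi hb
    by_cases hn : G.n ≥ N
    · simp only [dif_pos hn]
      exact hF2 _ hn G hG rfl ident hi hb
    · simp only [dif_neg hn]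
      have h1 := hA G.n G hG rfl ident hi hb
      simp only [LocalAlgorithm.stateAt_eq_run] at h1
      exact fun v => ⟨(hψ.2 G hG _).1 h1 v, fun h => absurd h hn⟩

theorem exists_solver_of_loop (hψ : IsVerifierFor K r ψ P) {a : Γ}
    (ha : Feasible K r ψ fun _ => a) (E : EndWords K r ψ fun _ => a)
    (hN : E.p₀ + E.q₀ + 2 * r + 2 ≤ N) {n : ℕ} (hn : N ≤ n) :
    ∃ F : (ℤ → Option ℕ) → Γ, LocalAt (E.p₀ + E.q₀) F ∧ ∀ G : Inst, G.kind ∈ K → G.n = n →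
      ∀ ident : G.V → ℕ,
      RestrictedProblem r ψ N {fun _ => a} G fun v => F fun j => G.unroll ident (v.val + j) := by
  refine ⟨withEnds E.p₀ E.q₀ E.l₀ fun _ => a, ?_, ?_⟩
  · have : LocalAt 0 (fun _ : ℤ → Option ℕ => a) := fun _ _ _ => rfl
    simpa using this.withEnds (p₀ := E.p₀) (q₀ := E.q₀) (l₀ := E.l₀)
  · intro G hK hGn ident
    cases hG : G.kind with
    | path =>
      refine restrictedProblem_withEnds_path hψ.1 E (by omega) hK hG (by omega) (fun j => rfl) ?_
      intro y hy1 hy2 i h0 h1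
      have hy : ∀ j : ℤ, 0 ≤ j → j ≤ 2 * r → y (i + j) = a := by
        intro j h2 h3
        rcases lt_or_ge (i + j) (G.n - E.q₀) with h4 | h4
        · exact hy1 _ (by omega) h4
        · have := hy2 ⟨(i + j - (G.n - E.q₀)).toNat, by omega⟩
          rwa [show (G.n : ℤ) - E.q₀ + ((i + j - (G.n - E.q₀)).toNat : ℕ) = i + j by omega] at this
      constructor
      · convert ha using 1
        ext j
        have := j.isLt
        exact hy _ (by omega) (by omega)
      · rw [Set.mem_singleton_iff]
        ext j
        have := j.isLt
        exact hy _ (by omega) (by omega)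
    | cycle =>
      exact restrictedProblem_withEnds_cycle hψ.1 hK hG (by omega) fun i => ⟨ha, rfl⟩

/-! ### Anchors -/

/-- The node is the `p₀`-th of a path or the `q₀`-th from its end, or else it is far from such nodes
and belongs to the greedy `a`-independent set. -/
def IsAnchor (p₀ q₀ a Q : ℕ) (col : (ℤ → Option ℕ) → ℕ) (x : ℤ → Option ℕ) : Prop :=
  ((x (-p₀)).isSome ∧ x (-p₀ - 1) = none) ∨ ((x (q₀ - 1)).isSome ∧ x q₀ = none) ∨
    ((x (-(p₀ + a + 1))).isSome ∧ (x (q₀ + a)).isSome ∧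
      greedySet a (fun j => col fun k => x (j + k)) Q 0)

theorem localAt_isAnchor {p₀ q₀ a Q R : ℕ} {col : (ℤ → Option ℕ) → ℕ} (h : LocalAt R col) :
    LocalAt (R + a * Q + p₀ + q₀ + a + 1) (IsAnchor p₀ q₀ a Q col) := by
  intro x y hxy
  have hpos : (0 : ℤ) ≤ R + a * Q := by positivity
  have hx : ∀ j : ℤ, |j| ≤ p₀ + q₀ + a + 1 → x j = y j := fun j hj => hxy j (by push_cast; omega)
  have hg : greedySet a (fun j => col fun k => x (j + k)) Q 0 ↔
      greedySet a (fun j => col fun k => y (j + k)) Q 0 := by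
    refine greedySet_congr fun j hj => ?_
    simp only [zero_add]
    refine h.shift j x y fun k hk => hxy k ?_
    rw [abs_le] at *
    omega
  rw [IsAnchor, IsAnchor, hg, hx _ (by rw [abs_le]; omega), hx (-p₀ - 1) (by rw [abs_le]; omega),
    hx (q₀ - 1) (by rw [abs_le]; omega), hx q₀ (by rw [abs_le]; omega),
    hx (-(p₀ + a + 1)) (by rw [abs_le]; omega), hx (q₀ + a) (by rw [abs_le]; omega)]

theorem isAnchor_shift {p₀ q₀ a Q : ℕ} {col : (ℤ → Option ℕ) → ℕ} {X : ℤ → Option ℕ} {i : ℤ} :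
    IsAnchor p₀ q₀ a Q col (fun k => X (i + k)) ↔
      ((X (i - p₀)).isSome ∧ X (i - p₀ - 1) = none) ∨
      ((X (i + q₀ - 1)).isSome ∧ X (i + q₀) = none) ∨
      ((X (i - (p₀ + a + 1))).isSome ∧ (X (i + (q₀ + a))).isSome ∧
        greedySet a (fun j => col fun k => X (j + k)) Q i) := by
  have hg : greedySet a (fun j => col fun k => X (i + (j + k))) Q 0 ↔
      greedySet a (fun j => col fun k => X (j + k)) Q i := by
    refine greedySet_congr fun j _ => ?_
    congr 1
    ext1 k
    congr 1
    ring
  rw [IsAnchor, hg]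
  simp only [sub_eq_add_neg, add_assoc]

/-- The proper colouring `stepColor` yields a greedy set whose members are more than `a` apart, yet
close to every node. Consecutive anchors are joined by walks from `s` to `s`, which exist because
the gaps exceed `a`. Only the colouring costs more than constant time, namely `t * a` plus a
constant. -/
theorem exists_solver [Finite Γ] [Nonempty Γ] (hψ : IsVerifierFor K r ψ P) (hc : 1 ≤ c)
    (hno : ∀ b : Γ, Feasible K r ψ (fun _ => b) → ¬ IsUsable K P (fun _ : Fin (2 * r) => b))
    {a : ℕ} {W : ℕ → ℤ → Γ} (hW : IsLoopFamily K r ψ C s a W) (har : 2 * r ≤ a) (ha : 1 ≤ a)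
    (E : EndWords K r ψ s) : ∃ c₂ : ℕ, ∀ N n : ℕ, c₂ ≤ N → N ≤ n →
      ∀ (A : LocalAlgorithm Γ) (t : ℕ), SolvesAt K c P A n t → 2 * ((t + 1 + r) * a) + c₂ ≤ n →
      ∃ F : (ℤ → Option ℕ) → Γ, LocalAt (t * a + c₂) F ∧ ∀ G : Inst, G.kind ∈ K → G.n = n →
        ∀ ident : G.V → ℕ, Function.Injective ident → (∀ v, 1 ≤ ident v ∧ ident v ≤ n ^ c) →
        RestrictedProblem r ψ N C G fun v => F fun j => G.unroll ident (v.val + j) := by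
  set Q := Nat.card (Fin a → Fin (2 * r + 1) → Option Γ) with hQ
  set p₀ := E.p₀ with hp₀
  set q₀ := E.q₀ with hq₀
  refine ⟨(2 * r + 1) * a + a * Q + 2 * p₀ + 2 * q₀ + 9 * a + 2 * r + 20, ?_⟩
  intro N n hN hn A t hA hsize
  -- On each side there is an anchor within `4 * a + 3`, so gaps are at most `2 * (4 * a + 3)`.
  set B := 8 * a + 6 with hB
  let col := stepColor A n t r a
  let anch := IsAnchor p₀ q₀ a Q col
  let mid : (ℤ → Option ℕ) → Γ := fun x => fillLabel W B fun j => anch fun k => x (j + k)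
  have hpos1 : 0 ≤ (2 * r + 1) * a := by positivity
  have hpos2 : 0 ≤ a * Q := by positivity
  have hcol : LocalAt ((2 * r + t + 1) * a) col := localAt_stepColor A n t r a
  have hanch := localAt_isAnchor (p₀ := p₀) (q₀ := q₀) (a := a) (Q := Q) hcol
  have hmid : LocalAt ((2 * r + t + 1) * a + a * Q + p₀ + q₀ + a + 1 + B) mid := by
    intro x y hxy
    refine fillLabel_congr fun j hj => ?_
    exact Eq.to_iff (hanch.shift j x y fun k hk => hxy k (by rw [abs_le] at *; omega))
  refine ⟨withEnds p₀ q₀ E.l₀ mid, hmid.withEnds.mono ?_, ?_⟩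
  · have : (2 * r + t + 1) * a = (2 * r + 1) * a + t * a := by ring
    omega
  intro G hK hGn ident hi hb
  set X := G.unroll ident with hX
  let κ : ℤ → ℕ := fun j => col fun k => X (j + k)
  let S : Set ℤ := {i | anch fun k => X (i + k)}
  have hS : ∀ i, i ∈ S ↔ _ := fun i => isAnchor_shift (X := X)
  have hκ : ∀ i, κ i < Q ↔ (X i).isSome := by
    intro i
    have := stepColor_lt_iff (A := A) (n := n) (t := t) (r := r) (a := a) (x := fun k => X (i + k))
    rwa [add_zero] at this
  have hproper : ∀ i j : ℤ, i ≠ j → |i - j| ≤ a → κ i < Q → κ i ≠ κ j := by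
    have key : ∀ i j : ℤ, i < j → j - i ≤ a → κ i < Q → κ i ≠ κ j := by
      intro i j hij hd h1 heq
      have h2 : κ j < Q := heq ▸ h1
      rw [hκ] at h1 h2
      refine stepColor_ne hψ hc hno hA hK hGn hi hb (a := a) (by omega) (u := i) (d := (j - i).toNat)
        (by omega) (by omega) h1 ?_ ?_
      · rwa [show i + ((j - i).toNat : ℤ) = j by omega]
      · rw [show i + ((j - i).toNat : ℤ) = j by omega]
        exact heq
    intro i j hne hd h1
    rw [abs_le] at hd
    rcases lt_or_gt_of_ne hne with h | h
    · exact key i j h (by omega) h1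
    · intro heq
      exact key j i h (by omega) (heq ▸ h1) heq.symm
  have hgsep : ∀ i j : ℤ, greedySet a κ Q i → greedySet a κ Q j → i < j → (a : ℤ) < j - i := by
    intro i j h1 h2 hij
    have := greedySet_sep hproper le_rfl h2 h1 hij.ne'
    rwa [abs_of_pos (by omega)] at this
  have hgdense : ∀ i : ℤ, (X i).isSome → ∃ j, i - a ≤ j ∧ j ≤ i + a ∧ greedySet a κ Q j := by
    intro i h
    obtain ⟨j, hj, hj'⟩ := greedySet_dense (a := a) ((hκ i).2 h)
    rw [abs_le] at hj
    exact ⟨j, by omega, by omega, hj'⟩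
  have hmidS : ∀ i, mid (fun k => X (i + k)) = fillLabel W B fun j => i + j ∈ S := by
    intro i
    simp only [mid, S, Set.mem_ofPred_eq, add_assoc]
  cases hG : G.kind with
  | path =>
    have hXs : ∀ i, (X i).isSome ↔ 0 ≤ i ∧ i < n := fun i => by
      rw [hX, Inst.unroll_isSome, Inst.node_path_isSome hG, hGn]
    have hXn : ∀ i, X i = none ↔ ¬ (0 ≤ i ∧ i < n) := fun i => by
      rw [← hXs, Option.not_isSome_iff_eq_none]
    have hS' : ∀ i, i ∈ S ↔ i = p₀ ∨ i = n - q₀ ∨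
        (p₀ + a + 1 ≤ i ∧ i ≤ n - q₀ - a - 1 ∧ greedySet a κ Q i) := by
      intro i
      rw [hS, hXs, hXs, hXs, hXs, hXn, hXn]
      constructor
      · rintro (h | h | ⟨h1, h2, h3⟩)
        · left; omega
        · right; left; omega
        · right; right
          exact ⟨by omega, by omega, h3⟩
      · rintro (h | h | ⟨h1, h2, h3⟩)
        · left; omega
        · right; left; omega
        · right; right
          exact ⟨by omega, by omega, h3⟩
    have hsep : ∀ p ∈ S, ∀ q ∈ S, p < q → (a : ℤ) < q - p := by
      intro p hp q hq hpq
      rw [hS'] at hp hq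
      rcases hp with hp | hp | ⟨hp1, hp2, hp3⟩ <;> rcases hq with hq | hq | ⟨hq1, hq2, hq3⟩
      any_goals omega
      exact hgsep p q hp3 hq3 hpq
    -- Far from the anchor at the relevant end, the greedy node is sought around `i - 2 * a - 1` or
    -- `i + 2 * a + 1`. It then lies at least `a + 1` from `i`, hence also from the end anchor
    -- beyond `i`, as membership in `S` requires.
    have hdense : ∀ i ∈ Set.Ico (p₀ : ℤ) (n - q₀),
        (∃ p ∈ S, p ≤ i ∧ i ≤ p + (4 * a + 3 : ℕ)) ∧ ∃ p ∈ S, i < p ∧ p ≤ i + (4 * a + 3 : ℕ) := by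
      rintro i ⟨hi1, hi2⟩
      constructor
      · by_cases h : i < p₀ + 4 * a + 2
        · exact ⟨p₀, (hS' _).2 (Or.inl rfl), hi1, by push_cast; omega⟩
        · obtain ⟨j, h1, h2, h3⟩ := hgdense (i - 2 * a - 1) (by rw [hXs]; omega)
          exact ⟨j, (hS' j).2 (Or.inr (Or.inr ⟨by omega, by omega, h3⟩)), by omega,
            by push_cast; omega⟩
      · by_cases h : n - q₀ - 4 * a - 2 < i
        · exact ⟨n - q₀, (hS' _).2 (Or.inr (Or.inl rfl)), hi2, by push_cast; omega⟩
        · obtain ⟨j, h1, h2, h3⟩ := hgdense (i + 2 * a + 1) (by rw [hXs]; omega)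
          exact ⟨j, (hS' j).2 (Or.inr (Or.inr ⟨by omega, by omega, h3⟩)), by omega,
            by push_cast; omega⟩
    have hrange : ∀ p ∈ S, (p₀ : ℤ) ≤ p ∧ p ≤ n - q₀ := by
      intro p hp
      rw [hS'] at hp
      omega
    have main : ∀ y : ℤ → Γ,
        (∀ i : ℤ, p₀ ≤ i → i < n - q₀ → y i = mid fun k => X (i + k)) →
        (∀ j : Fin (2 * r), y (n - q₀ + j.val) = s j) →
        (∀ p ∈ S, ∀ j : Fin (2 * r), y (p + j.val) = s j) ∧
          ∀ i ∈ Set.Ico (p₀ : ℤ) (n - q₀),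
            Feasible K r ψ (word (2 * r + 1) y i) ∧ word (2 * r) y i ∈ C := by
      intro y hy1 hy2
      refine fill_windows hW har hsep hdense ?_ (show 2 * (4 * a + 3) ≤ B by omega) ?_ ?_
      · intro i _ p hp p' hp' _ _ k hk1 hk2
        have h1 := hrange p hp
        have h2 := hrange p' hp'
        exact ⟨by omega, by omega⟩
      · intro i hi'
        rw [← hmidS, hy1 i hi'.1 hi'.2]
      · intro p hp hpI j
        have h1 := hrange p hp
        have h2 : p = n - q₀ := by
          by_contra hne
          exact hpI ⟨h1.1, by omega⟩
        rw [h2]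
        exact hy2 j
    refine restrictedProblem_withEnds_path hψ.1 E (by omega) hK hG (by omega) ?_ ?_
    · intro j
      have hj := j.isLt
      -- What `mid` writes at the first anchor is read off from an artificial continuation to the
      -- right; the remainder modulo `2 * r` merely makes it a total function.
      obtain ⟨h1, -⟩ := main
        (fun i => if i < n - q₀ then mid fun k => X (i + k) else
          s ⟨(i - (n - q₀)).toNat % (2 * r), Nat.mod_lt _ (by omega)⟩)
        (fun i _ h => if_pos h) (fun j => by
          have hj := j.isLt
          rw [if_neg (by omega)]
          congr 1
          ext
          simp only
          rw [show ((n : ℤ) - q₀ + j.val - (n - q₀)).toNat = j.val by omega, Nat.mod_eq_of_lt hj])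
      have h2 := h1 p₀ ((hS' _).2 (Or.inl rfl)) j
      rwa [if_pos (by omega)] at h2
    · intro y hy1 hy2 i h0 h1
      rw [hGn] at hy1 hy2 h1
      exact (main y hy1 hy2).2 i ⟨h0, h1⟩
  | cycle =>
    have hXs : ∀ i, (X i).isSome := fun i => by
      rw [hX, Inst.unroll_isSome]
      exact Inst.node_cycle_isSome hG i
    have hXn : ∀ i, ¬ X i = none := fun i h => by
      have := hXs i
      rw [h] at this
      cases this
    have hS' : ∀ i, i ∈ S ↔ greedySet a κ Q i := by
      intro i
      rw [hS]
      simp only [hXs, hXn, and_false, false_or, true_and]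
      exact Iff.rfl
    refine restrictedProblem_withEnds_cycle hψ.1 hK hG (by omega) fun i => ?_
    refine (fill_windows (I := Set.univ) (b := 4 * a + 3) hW har
      (fun p hp q hq hpq => hgsep p q ((hS' p).1 hp) ((hS' q).1 hq) hpq) (fun i _ => ?_)
      (fun _ _ _ _ _ _ _ _ _ _ _ => Set.mem_univ _) (show 2 * (4 * a + 3) ≤ B by omega)
      (fun i _ => hmidS i) (fun p _ h => absurd (Set.mem_univ p) h)).2 i (Set.mem_univ i)
    constructor
    · obtain ⟨j, h1, h2, h3⟩ := hgdense (i - a) (hXs _)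
      exact ⟨j, (hS' j).2 h3, by omega, by push_cast; omega⟩
    · obtain ⟨j, h1, h2, h3⟩ := hgdense (i + a + 1) (hXs _)
      exact ⟨j, (hS' j).2 h3, by omega, by push_cast; omega⟩

end Solvers

/-! ### Mending the restricted verifier -/

section Mending

variable {Γ : Type*} {K : Set Kind} {r : ℕ} {ψ : Verifier Γ}
  {C : Set (Fin (2 * r) → Γ)} {s : Fin (2 * r) → Γ} {N R : ℕ}

theorem restricted_congr (hψ : IsLocal K r ψ) {G : Inst} (hK : G.kind ∈ K) {l l' : G.V → Γ}
    {u : G.V} (h : ∀ w, G.dist u w ≤ r → l w = l' w) (hl : Restricted r ψ N C G l u) :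
    Restricted r ψ N C G l' u := by
  refine ⟨(hψ G l u G l' u hK hK (SameNeighborhood.refl_of_eq h)).1 hl.1, ?_⟩
  intro hn hex w hw
  refine hl.2 hn hex w fun i => ?_
  have hi := i.isLt
  obtain ⟨x, hx, hx'⟩ := Inst.unroll_eq_some.1 (hw i)
  rw [Inst.unroll_of_node hx, ← hx', h x]
  exact Inst.dist_le_of_node (G.node_val u) hx (by rw [abs_le]; omega)

theorem Inst.unroll_add {α : Type*} {G : Inst} {i : ℤ} {u : G.V} (h : G.node i = some u)
    (l : G.V → α) (j : ℤ) : G.unroll l (u.val + j) = G.unroll l (i + j) := by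
  rw [Inst.unroll, Inst.unroll, Inst.node_add h]

theorem unroll_getD {G : Inst} {m : G.V → Option Γ} {d a : Γ} {i : ℤ}
    (h : G.unroll m i = some (some a)) : G.unroll (fun w => (m w).getD d) i = some a := by
  obtain ⟨w, hw, hw'⟩ := Inst.unroll_eq_some.1 h
  rw [Inst.unroll_of_node hw, hw', Option.getD_some]

/-- If no hole is within distance `R`, then `d` fills only holes outside the ball, about which
`Relaxed` demands nothing. -/
theorem relaxed_of_getD {ψ' : Verifier Γ} {G : Inst} {m : G.V → Option Γ} {i : ℤ} {u : G.V}
    (hu : G.node i = some u) (d : Γ)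
    (h : (∀ j : ℤ, |j - i| ≤ R → G.unroll m j ≠ some none) → ψ' G (fun w => (m w).getD d) u) :
    Relaxed R ψ' G m u := by
  by_cases hex : ∃ w, G.dist u w ≤ R ∧ m w = none
  · exact Or.inl hex
  · refine Or.inr ⟨fun w => (m w).getD d, fun w hw => ?_, h fun j hj hnone => ?_⟩
    · cases hm : m w with
      | none => exact absurd ⟨w, hw, hm⟩ hex
      | some a => simp only [hm, Option.getD_some]
    · obtain ⟨w, hw, hw'⟩ := Inst.unroll_eq_some.1 hnone
      exact hex ⟨w, Inst.dist_le_of_node hu hw hj, hw'⟩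

theorem exists_of_relaxed {ψ' : Verifier Γ} {G : Inst} {l : G.V → Option Γ} {i : ℤ} {u : G.V}
    (hu : G.node i = some u) (hl : Relaxed R ψ' G l u)
    (hno : ∀ j : ℤ, |j - i| ≤ R → G.unroll l j ≠ some none) :
    ∃ l' : G.V → Γ, (∀ w, G.dist u w ≤ R → l w = some (l' w)) ∧ ψ' G l' u := by
  rcases hl with ⟨w, hw, hw'⟩ | h
  · obtain ⟨j, hj, hj'⟩ := (Inst.dist_le_iff hu).1 hw
    exact absurd (by rw [Inst.unroll_of_node hj', hw']) (hno j hj)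
  · exact h

/-- Agreement up to distance `r` is enough although the verifier has radius `R`: farther away
`Restricted` inspects which nodes exist, and not their labels. -/
theorem restricted_of_unchanged (hψ : IsLocal K r ψ) (hr : r ≤ R) {G : Inst} (hK : G.kind ∈ K)
    {l m : G.V → Option Γ} {i : ℤ} {u : G.V} (hu : G.node i = some u) (d : Γ)
    (hl : Relaxed R (Restricted r ψ N C) G l u)
    (hno : ∀ j : ℤ, |j - i| ≤ R → G.unroll l j ≠ some none)
    (heq : ∀ j : ℤ, |j - i| ≤ r → G.unroll m j = G.unroll l j) :
    Restricted r ψ N C G (fun w => (m w).getD d) u := by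
  obtain ⟨l', h1, h2⟩ := exists_of_relaxed hu hl hno
  refine restricted_congr hψ hK (fun w hw => ?_) h2
  obtain ⟨j, hj, hj'⟩ := (Inst.dist_le_iff hu).1 hw
  have h3 := heq j hj
  rw [Inst.unroll_of_node hj', Inst.unroll_of_node hj', h1 w (hw.trans hr)] at h3
  rw [Option.some.inj h3, Option.getD_some]

/-- How a mend is continued on the right: the word of `y` at `a` belongs to `C`, and the labels up
to `B` are either the end of a path, or kept from `l`, or followed by a hole of `l`. -/
structure RightSide (E : EndWords K r ψ s) (C : Set (Fin (2 * r) → Γ)) (R : ℕ) (G : Inst)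
    (l : G.V → Option Γ) (a B : ℤ) (y : ℤ → Γ) : Prop where
  mem : word (2 * r) y a ∈ C
  le : a + 2 * r - 1 ≤ B
  node : (G.node B).isSome
  cases : (G.kind = Kind.path ∧ a = G.n - E.q₀ ∧ B = G.n - 1 ∧
      ∀ i : ℤ, E.p₀ ≤ i → i < E.p₀ + E.q₀ → y (G.n - (E.p₀ + E.q₀) + i) = E.l₀ i) ∨
    (B = a + 2 * r - 1 ∧ (∀ i, a ≤ i → i ≤ B → G.unroll l i = some (some (y i))) ∧
      ∀ i, |i - (a + r)| ≤ R → G.unroll l i ≠ some none) ∨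
    (B = a + 2 * r - 1 ∧ G.unroll l (B + 1) = some none)

/-- How a mend is continued on the left. -/
structure LeftSide (E : EndWords K r ψ s) (C : Set (Fin (2 * r) → Γ)) (R : ℕ) (G : Inst)
    (l : G.V → Option Γ) (a A : ℤ) (y : ℤ → Γ) : Prop where
  mem : word (2 * r) y a ∈ C
  le : A ≤ a
  node : (G.node A).isSome
  cases : (G.kind = Kind.path ∧ a = E.p₀ ∧ A = 0 ∧
      ∀ i : ℤ, 0 ≤ i → i < E.p₀ + 2 * r → y i = E.l₀ i) ∨
    (A = a ∧ (∀ i, a ≤ i → i < a + 2 * r → G.unroll l i = some (some (y i))) ∧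
      ∀ i, |i - (a + r)| ≤ R → G.unroll l i ≠ some none) ∨
    (A = a ∧ G.unroll l (a - 1) = some none)

/-- At an end the labels are copied from a happy path. Next to kept labels the neighbourhood of
radius `r` is unchanged, and `l` had no hole in sight. Beyond a hole, a node either still sees it or
is so far away that its whole ball lies in the unchanged part. -/
theorem RightSide.relaxed (hψ : IsLocal K r ψ) (hr : r < R) {E : EndWords K r ψ s}
    (hN : E.p₀ + E.q₀ < N) {G : Inst} (hK : G.kind ∈ K) (hn : E.p₀ + E.q₀ ≤ G.n)
    {l m : G.V → Option Γ} {a A B : ℤ} {y : ℤ → Γ} (h : RightSide E C R G l a B y) {i : ℤ}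
    {u : G.V} (hu : G.node i = some u) (hl : Relaxed R (Restricted r ψ N C) G l u)
    (hi : a + r ≤ i) (hA : A ≤ a)
    (hm : ∀ j, a ≤ j → j ≤ B → G.unroll m j = some (some (y j)))
    (hm' : ∀ j, B < j → j ≤ i + R → G.unroll m j = G.unroll l j) :
    Relaxed R (Restricted r ψ N C) G m u := by
  have hle := h.le
  refine relaxed_of_getD hu (y 0) fun hno => ?_
  rcases h.cases with ⟨hG, rfl, rfl, hy⟩ | ⟨rfl, hy, hfree⟩ | ⟨rfl, hhole⟩
  · obtain ⟨D, hp, hq, hl₀⟩ := E.spec (hG ▸ hK)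
    have hui := (Inst.node_path hG).1 hu
    refine restricted_of_suffix hψ D (by omega) hK hG (by omega) (fun j h1 h2 => ?_) (by omega)
    refine unroll_getD ?_
    rw [hm _ (by omega) (by omega), hl₀, ← hy j (by omega) (by omega)]
    congr 3
    omega
  · refine restricted_of_unchanged hψ hr.le hK hu (y 0) hl (fun j hj => ?_) fun j hj => ?_
    · rw [abs_le] at hj
      rcases le_or_gt j (a + 2 * r - 1) with h1 | h1
      · exact hfree j (by rw [abs_le]; omega)
      · rw [← hm' j h1 (by omega)]
        exact hno j (by rw [abs_le]; omega)
    · rw [abs_le] at hj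
      rcases le_or_gt j (a + 2 * r - 1) with h1 | h1
      · rw [hm j (by omega) h1, hy j (by omega) h1]
      · exact hm' j h1 (by omega)
  · rcases le_or_gt i (a + 2 * r + R) with h1 | h1
    · refine absurd ?_ (hno (a + 2 * r - 1 + 1) (by rw [abs_le]; omega))
      rw [hm' _ (by omega) (by omega), hhole]
    · have heq : ∀ j : ℤ, |j - i| ≤ R → G.unroll m j = G.unroll l j := by
        intro j hj
        rw [abs_le] at hj
        exact hm' j (by omega) (by omega)
      refine restricted_of_unchanged hψ hr.le hK hu (y 0) hl (fun j hj => ?_) fun j hj => ?_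
      · rw [← heq j hj]
        exact hno j hj
      · exact heq j (hj.trans (by omega))

theorem LeftSide.relaxed (hψ : IsLocal K r ψ) (hr : r < R) {E : EndWords K r ψ s}
    (hN : E.p₀ + E.q₀ < N) {G : Inst} (hK : G.kind ∈ K) (hn : E.p₀ + E.q₀ ≤ G.n)
    {l m : G.V → Option Γ} {a A : ℤ} {y : ℤ → Γ} (h : LeftSide E C R G l a A y) {i : ℤ}
    {u : G.V} (hu : G.node i = some u) (hl : Relaxed R (Restricted r ψ N C) G l u)
    (hi : i < a + r)
    (hm : ∀ j, A ≤ j → j < a + 2 * r → G.unroll m j = some (some (y j)))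
    (hm' : ∀ j, j < A → i - R ≤ j → G.unroll m j = G.unroll l j) :
    Relaxed R (Restricted r ψ N C) G m u := by
  refine relaxed_of_getD hu (y 0) fun hno => ?_
  rcases h.cases with ⟨hG, rfl, rfl, hy⟩ | ⟨rfl, hy, hfree⟩ | ⟨rfl, hhole⟩
  · obtain ⟨D, hp, hq, hl₀⟩ := E.spec (hG ▸ hK)
    have hui := (Inst.node_path hG).1 hu
    refine restricted_of_prefix hψ D (by omega) hK hG (by omega) (fun j h1 h2 => ?_) (by omega)
    refine unroll_getD ?_
    rw [hm _ (by omega) (by omega), hl₀, ← hy j (by omega) (by omega)]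
  · refine restricted_of_unchanged hψ hr.le hK hu (y 0) hl (fun j hj => ?_) fun j hj => ?_
    · rw [abs_le] at hj
      rcases le_or_gt A j with h1 | h1
      · exact hfree j (by rw [abs_le]; omega)
      · rw [← hm' j h1 (by omega)]
        exact hno j (by rw [abs_le]; omega)
    · rw [abs_le] at hj
      rcases le_or_gt A j with h1 | h1
      · rw [hm j h1 (by omega), hy j h1 (by omega)]
      · exact hm' j h1 (by omega)
  · rcases le_or_gt (A - 1 - R) i with h1 | h1
    · refine absurd ?_ (hno (A - 1) (by rw [abs_le]; omega))
      rw [hm' _ (by omega) (by omega), hhole]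
    · have heq : ∀ j : ℤ, |j - i| ≤ R → G.unroll m j = G.unroll l j := by
        intro j hj
        rw [abs_le] at hj
        exact hm' j (by omega) (by omega)
      refine restricted_of_unchanged hψ hr.le hK hu (y 0) hl (fun j hj => ?_) fun j hj => ?_
      · rw [← heq j hj]
        exact hno j hj
      · exact heq j (hj.trans (by omega))

theorem exists_word_eq [Nonempty Γ] {m : ℕ} (s : Fin m → Γ) (a : ℤ) :
    ∃ y : ℤ → Γ, word m y a = s := by
  refine ⟨fun i => if h : (i - a).toNat < m then s ⟨(i - a).toNat, h⟩ else Classical.arbitrary Γ,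
    ?_⟩
  ext j
  have := j.isLt
  simp only [word]
  rw [dif_pos (by omega)]
  congr 1
  ext
  simp

/-- The word around a node without holes in sight belongs to `C`. -/
theorem exists_kept_word [Nonempty Γ] (hR : r + N ≤ R) {G : Inst} (hn : N ≤ G.n)
    {l : G.V → Option Γ} (hl : ∀ u, Relaxed R (Restricted r ψ N C) G l u) {i : ℤ}
    (hex : ∀ j : ℤ, |j - i| ≤ R → (G.node j).isSome)
    (hno : ∀ j : ℤ, |j - i| ≤ R → G.unroll l j ≠ some none) :
    ∃ y : ℤ → Γ, word (2 * r) y (i - r) ∈ C ∧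
      ∀ j, i - r ≤ j → j < i - r + 2 * r → G.unroll l j = some (some (y j)) := by
  obtain ⟨u, hu⟩ := Option.isSome_iff_exists.1 (hex i (by simp))
  obtain ⟨l', h1, h2⟩ := exists_of_relaxed hu (hl u) hno
  have hval : ∀ j : ℤ, |j - i| ≤ R → ∃ a, G.unroll l j = some (some a) ∧ G.unroll l' j = some a := by
    intro j hj
    obtain ⟨w, hw⟩ := Option.isSome_iff_exists.1 (hex j hj)
    refine ⟨l' w, ?_, Inst.unroll_of_node hw⟩
    rw [Inst.unroll_of_node hw, h1 w (Inst.dist_le_of_node hu hw hj)]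
  choose! y hy1 hy2 using hval
  refine ⟨y, ?_, fun j hj1 hj2 => hy1 j (by rw [abs_le]; omega)⟩
  refine h2.2 hn (fun j hj1 hj2 => ?_) _ fun j => ?_
  · rw [← Inst.node_add hu]
    exact hex _ (by rw [abs_le]; omega)
  · have := j.isLt
    rw [sub_add_eq_add_sub, add_sub_assoc, Inst.unroll_add hu, hy2 _ (by rw [abs_le]; omega)]
    simp only [word]
    congr 2
    ring

/-- Inspect the ball of radius `R` around the node `L` steps to the right of `v`. If the path ends
before the ball does, take the fixed end segment; if the ball has a hole, write `s` directly in
front of it; otherwise `l` already has a word of `C` around the centre. Since `L > R`, the stopping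
point is not before `v`. -/
theorem exists_rightSide [Nonempty Γ] (hR : r + N ≤ R) (hs : s ∈ C) (E : EndWords K r ψ s)
    {G : Inst} (hK : G.kind ∈ K) (hn : N ≤ G.n) {l : G.V → Option Γ}
    (hl : ∀ u, Relaxed R (Restricted r ψ N C) G l u) (v : G.V) {L : ℕ} (hL : R + 1 ≤ L) :
    ∃ (a B : ℤ) (y : ℤ → Γ), RightSide E C R G l a B y ∧ (v.val : ℤ) ≤ B ∧ B ≤ v.val + L + R ∧
      ((G.kind = Kind.path ∧ G.n ≤ v.val + L + R ∧ a = G.n - E.q₀) ∨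
        (v.val : ℤ) + L - R - 2 * r ≤ a) := by
  have hv := v.isLt
  by_cases hend : (G.node (v.val + L + R)).isSome
  · have hex : ∀ j : ℤ, |j - (v.val + L)| ≤ R → (G.node j).isSome := by
      intro j hj
      rw [abs_le] at hj
      exact Inst.node_isSome_mid (by rw [Inst.node_val]; rfl) hend
        (show (v.val : ℤ) ≤ j by omega) (by omega)
    by_cases hhole : ∃ h : ℤ, |h - (v.val + L)| ≤ R ∧ G.unroll l h = some none
    · obtain ⟨h, h1, h2⟩ := hhole
      obtain ⟨y, hy⟩ := exists_word_eq s (h - 2 * r)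
      have h1' := abs_le.1 h1
      refine ⟨h - 2 * r, h - 1, y, ⟨by rwa [hy], by omega, ?_, Or.inr (Or.inr ⟨by ring, ?_⟩)⟩,
        by omega, by omega, Or.inr (by omega)⟩
      · exact Inst.node_isSome_mid (by rw [Inst.node_val]; rfl) hend
          (show (v.val : ℤ) ≤ h - 1 by omega) (by omega)
      · rwa [sub_add_cancel]
    · push Not at hhole
      obtain ⟨y, hy1, hy2⟩ := exists_kept_word hR hn hl hex hhole
      refine ⟨v.val + L - r, v.val + L + r - 1, y, ⟨hy1, by omega, ?_, Or.inr (Or.inl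
        ⟨by ring, fun j hj1 hj2 => hy2 j hj1 (by omega), ?_⟩)⟩, by omega, by omega,
        Or.inr (by omega)⟩
      · exact Inst.node_isSome_mid (by rw [Inst.node_val]; rfl) hend
          (show (v.val : ℤ) ≤ v.val + L + r - 1 by omega) (by omega)
      · simpa using hhole
  · cases hG : G.kind with
    | cycle => exact absurd (Inst.node_cycle_isSome hG _) hend
    | path =>
      rw [Inst.node_path_isSome hG] at hend
      obtain ⟨D, hp, hq, hl₀⟩ := E.spec (hG ▸ hK)
      have hD := D.hp
      refine ⟨G.n - E.q₀, G.n - 1, fun i => E.l₀ (i - (G.n - (E.p₀ + E.q₀))),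
        ⟨?_, by omega, ?_, Or.inl ⟨hG, rfl, rfl, fun i _ _ => congrArg E.l₀ (by ring)⟩⟩,
        by omega, by omega, Or.inl ⟨rfl, by omega, rfl⟩⟩
      · have hw := D.hword
        rw [hl₀, hp] at hw
        convert hs using 1
        refine Eq.trans ?_ hw
        ext j
        simp only [word]
        congr 1
        ring
      · rw [Inst.node_path_isSome hG]
        omega

theorem exists_leftSide [Nonempty Γ] (hR : r + N ≤ R) (hs : s ∈ C) (E : EndWords K r ψ s)
    {G : Inst} (hK : G.kind ∈ K) (hn : N ≤ G.n) {l : G.V → Option Γ}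
    (hl : ∀ u, Relaxed R (Restricted r ψ N C) G l u) (v : G.V) {L : ℕ} (hL : R + 1 ≤ L) :
    ∃ (a A : ℤ) (y : ℤ → Γ), LeftSide E C R G l a A y ∧ A ≤ v.val ∧ (v.val : ℤ) - L - R ≤ A ∧
      ((G.kind = Kind.path ∧ v.val < L + R ∧ a = E.p₀) ∨ a ≤ v.val - L + R + 1) := by
  have hv := v.isLt
  by_cases hend : (G.node (v.val - L - R)).isSome
  · have hex : ∀ j : ℤ, |j - (v.val - L)| ≤ R → (G.node j).isSome := by
      intro j hj
      rw [abs_le] at hj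
      exact Inst.node_isSome_mid hend (by rw [Inst.node_val]; rfl)
        (show _ ≤ j by omega) (show j ≤ (v.val : ℤ) by omega)
    by_cases hhole : ∃ h : ℤ, |h - (v.val - L)| ≤ R ∧ G.unroll l h = some none
    · obtain ⟨h, h1, h2⟩ := hhole
      obtain ⟨y, hy⟩ := exists_word_eq s (h + 1)
      have h1' := abs_le.1 h1
      refine ⟨h + 1, h + 1, y, ⟨by rwa [hy], by omega, ?_, Or.inr (Or.inr ⟨rfl, ?_⟩)⟩,
        by omega, by omega, Or.inr (by omega)⟩
      · exact Inst.node_isSome_mid hend (by rw [Inst.node_val]; rfl)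
          (show _ ≤ h + 1 by omega) (show h + 1 ≤ (v.val : ℤ) by omega)
      · rwa [add_sub_cancel_right]
    · push Not at hhole
      obtain ⟨y, hy1, hy2⟩ := exists_kept_word hR hn hl hex hhole
      refine ⟨v.val - L - r, v.val - L - r, y, ⟨hy1, le_rfl, ?_, Or.inr (Or.inl
        ⟨rfl, fun j hj1 hj2 => hy2 j hj1 (by omega), ?_⟩)⟩, by omega, by omega,
        Or.inr (by omega)⟩
      · exact Inst.node_isSome_mid hend (by rw [Inst.node_val]; rfl)
          (show _ ≤ (v.val : ℤ) - L - r by omega) (show _ ≤ (v.val : ℤ) by omega)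
      · simpa using hhole
  · cases hG : G.kind with
    | cycle => exact absurd (Inst.node_cycle_isSome hG _) hend
    | path =>
      rw [Inst.node_path_isSome hG] at hend
      obtain ⟨D, hp, hq, hl₀⟩ := E.spec (hG ▸ hK)
      refine ⟨E.p₀, 0, E.l₀,
        ⟨?_, by omega, ?_, Or.inl ⟨hG, rfl, rfl, fun i _ _ => rfl⟩⟩,
        by omega, by omega, Or.inl ⟨rfl, by omega, rfl⟩⟩
      · have hw := D.hword
        rw [hl₀, hp] at hw
        rwa [hw]
      · rw [Inst.node_path_isSome hG]
        omega

/-- Overwriting the labels at the coordinates between `A` and `B`. -/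
theorem exists_overwrite {G : Inst} (l : G.V → Option Γ) {A B : ℤ} (y : ℤ → Γ)
    (hA : (G.node A).isSome) (hB : (G.node B).isSome) (hAB : B - A < G.n) :
    ∃ m : G.V → Option Γ, (∀ i, A ≤ i → i ≤ B → G.unroll m i = some (some (y i))) ∧
      (∀ i, (i < A ∧ B - G.n < i) ∨ (B < i ∧ i < A + G.n) → G.unroll m i = G.unroll l i) ∧
      (G.kind = Kind.path → ∀ i, i < A ∨ B < i → G.unroll m i = G.unroll l i) ∧
      (∀ u, m u = none → l u = none) ∧
      ∀ u, m u ≠ l u → ∃ i, A ≤ i ∧ i ≤ B ∧ G.node i = some u := by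
  classical
  let m : G.V → Option Γ := fun u =>
    if h : ∃ i, (A ≤ i ∧ i ≤ B) ∧ G.node i = some u then some (y h.choose) else l u
  have hout : ∀ u, (¬ ∃ i, (A ≤ i ∧ i ≤ B) ∧ G.node i = some u) → m u = l u :=
    fun u h => dif_neg h
  refine ⟨m, ?_, ?_, ?_, ?_, ?_⟩
  · intro i h1 h2
    obtain ⟨u, hu⟩ := Option.isSome_iff_exists.1 (Inst.node_isSome_mid hA hB h1 h2)
    have h : ∃ i, (A ≤ i ∧ i ≤ B) ∧ G.node i = some u := ⟨i, ⟨h1, h2⟩, hu⟩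
    have e : h.choose = i :=
      Inst.node_inj h.choose_spec.2 hu (by
        have := h.choose_spec.1
        rw [abs_lt]
        omega)
    rw [Inst.unroll_of_node hu]
    simp only [m]
    rw [dif_pos h, e]
  · intro i hi
    cases hu : G.node i with
    | none => rw [Inst.unroll, Inst.unroll, hu]; rfl
    | some u =>
      rw [Inst.unroll_of_node hu, Inst.unroll_of_node hu, hout]
      rintro ⟨j, hj, hj'⟩
      have := Inst.node_inj hu hj' (by rw [abs_lt]; omega)
      omega
  · intro hG i hi
    cases hu : G.node i with
    | none => rw [Inst.unroll, Inst.unroll, hu]; rfl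
    | some u =>
      rw [Inst.unroll_of_node hu, Inst.unroll_of_node hu, hout]
      rintro ⟨j, hj, hj'⟩
      rw [Inst.node_path hG] at hu hj'
      omega
  · intro u hu
    simp only [m] at hu
    split_ifs at hu
    exact hu
  · intro u hu
    by_contra h
    refine hu (hout u ?_)
    rintro ⟨i, hi, hi'⟩
    exact h ⟨i, hi.1, hi.2, hi'⟩

/-- The stopping words on both sides belong to `C`, so primitivity joins them by a walk whose length
is their exact distance. Nodes whose window lies in the walk are happy; all others are handled by
`LeftSide.relaxed` and `RightSide.relaxed`. -/
theorem exists_mend [Nonempty Γ] (hψ : IsLocal K r ψ) {k₀ : ℕ} (hprim : IsPrimitive K r ψ C k₀)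
    (hs : s ∈ C) (E : EndWords K r ψ s) (hN : E.p₀ + E.q₀ + 2 * r + 2 ≤ N) {L : ℕ}
    (hL : r + N + 2 * r + E.p₀ + E.q₀ + k₀ + 1 ≤ L) {G : Inst} (hK : G.kind ∈ K)
    (hn : 4 * (L + r + N + 2) ≤ G.n) {l : G.V → Option Γ}
    (hl : ∀ u, Relaxed (r + N) (Restricted r ψ N C) G l u) (v : G.V) :
    ∃ m, IsMend (r + N) (Restricted r ψ N C) G (L + (r + N)) l m v := by
  set R := r + N with hR
  have hvn := v.isLt
  obtain ⟨a, B, yR, hright, hB1, hB2, hacase⟩ :=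
    exists_rightSide hR.ge hs E hK (by omega) hl v (L := L) (by omega)
  obtain ⟨a', A, yL, hleft, hA1, hA2, hacase'⟩ :=
    exists_leftSide hR.ge hs E hK (by omega) hl v (L := L) (by omega)
  -- By the size of `G` at most one end is near, and `L` outweighs an end segment, the inspected
  -- balls and the words together with `k₀`.
  have hk : (k₀ : ℤ) ≤ a - a' := by
    rcases hacase with ⟨-, h1, h2⟩ | h1 <;> rcases hacase' with ⟨-, h3, h4⟩ | h3 <;> omega
  obtain ⟨x, hx0, hxk, hxf, hxC⟩ := hprim (a - a').toNat (by omega) _ hleft.mem _ hright.mem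
  have hle := hright.le
  have hle' := hleft.le
  let y : ℤ → Γ := fun i => if i < a' then yL i else if i < a + 2 * r then x (i - a') else yR i
  have yl : ∀ i, i < a' + 2 * r → y i = yL i := by
    intro i hi
    simp only [y]
    split_ifs with h1 h2
    · rfl
    · have h3 := congrFun hx0 ⟨(i - a').toNat, by omega⟩
      simp only [word] at h3
      rw [show i - a' = 0 + ((i - a').toNat : ℤ) by omega, h3]
      congr 1
      omega
    · omega
  have yr : ∀ i, a ≤ i → y i = yR i := by
    intro i hi
    simp only [y]
    split_ifs with h1 h2
    · omega
    · have h3 := congrFun hxk ⟨(i - a).toNat, by omega⟩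
      simp only [word] at h3
      rw [show i - a' = ((a - a').toNat : ℤ) + ((i - a).toNat : ℤ) by omega, h3]
      congr 1
      omega
    · rfl
  have ym : ∀ i, a' ≤ i → i < a + 2 * r → y i = x (i - a') := by
    intro i h1 h2
    simp only [y]
    rw [if_neg (by omega), if_pos h2]
  obtain ⟨m, hm1, hm2, hm3, hm4, hm5⟩ :=
    exists_overwrite l y hleft.node hright.node (by omega : B - A < G.n)
  have hcoord : ∀ u : G.V, ∃ i : ℤ, G.node i = some u ∧
      (∀ j, B < j → j ≤ i + R → G.unroll m j = G.unroll l j) ∧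
      ∀ j, j < A → i - R ≤ j → G.unroll m j = G.unroll l j := by
    intro u
    cases hG : G.kind with
    | path =>
      exact ⟨u.val, G.node_val u, fun j h _ => hm3 hG j (Or.inr h), fun j h _ => hm3 hG j (Or.inl h)⟩
    | cycle =>
      have h0 : (0 : ℤ) < G.n := by exact_mod_cast G.n_pos
      -- On a cycle choose the coordinate within half a turn of `v`; then a ball of radius `R`
      -- cannot reach the overwritten stretch from behind.
      set c : ℤ := v.val - (G.n : ℤ) / 2 with hc
      have h1 := Int.emod_nonneg (u.val - c) h0.ne'
      have h2 := Int.emod_lt_of_pos (u.val - c) h0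
      refine ⟨c + (u.val - c) % G.n, ?_, fun j h3 h4 => hm2 j (Or.inr ⟨h3, by omega⟩),
        fun j h3 h4 => hm2 j (Or.inl ⟨h3, by omega⟩)⟩
      rw [Inst.node_cycle hG, Int.add_emod_emod, add_sub_cancel]
      exact Int.emod_eq_of_lt (by omega) (by exact_mod_cast u.isLt)
  refine ⟨m, ⟨fun u => ?_, ?_, hm4, fun u hu => ?_⟩⟩
  · obtain ⟨i, hi, h1, h2⟩ := hcoord u
    rcases lt_or_ge i (a' + r) with h3 | h3
    · refine hleft.relaxed hψ (by omega) (by omega) hK (by omega) hi (hl u) h3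
        (fun j h4 h5 => ?_) h2
      rw [hm1 j h4 (by omega), yl j h5]
    rcases lt_or_ge i (a + r) with h4 | h4
    · refine relaxed_of_getD hi (y 0) fun _ => ?_
      have key : ∀ j : ℕ, j ≤ 2 * r → y (i - r + j) = x ((i - r - a').toNat + j) := by
        intro j hj
        rw [ym _ (by omega) (by omega)]
        congr 1
        omega
      refine restricted_of_mid hψ hK (by omega)
        (w := word (2 * r + 1) x (i - r - a').toNat) (fun j => ?_)
        (hxf _ (by omega)) (hxC (i - r - a').toNat (by omega))
      have hj := j.isLt
      rw [sub_add_eq_add_sub, add_sub_assoc, Inst.unroll_add hi]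
      refine unroll_getD ?_
      rw [hm1 _ (by omega) (by omega)]
      simp only [word]
      rw [← key j.val (by omega)]
      congr 3
      ring
    · refine hright.relaxed hψ (by omega) (by omega) hK (by omega) hi (hl u) h4
        (le_refl a) (fun j h5 h6 => ?_) h1
      rw [hm1 j (by omega) h6, yr j h5]
  · have h1 := hm1 v.val hA1 hB1
    rw [Inst.unroll_val] at h1
    rw [Option.some.inj h1]
    exact Option.some_ne_none _
  · obtain ⟨i, h1, h2, h3⟩ := hm5 u hu
    exact Inst.dist_le_of_node (G.node_val v) h3 (by rw [abs_le]; push_cast; omega)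

theorem exists_verifierMendable [Nonempty Γ] (hψ : IsLocal K r ψ) {k₀ : ℕ}
    (hprim : IsPrimitive K r ψ C k₀) (hs : s ∈ C) (E : EndWords K r ψ s)
    (hN : E.p₀ + E.q₀ + 2 * r + 2 ≤ N)
    (hsol : ∀ G : Inst, G.kind ∈ K → ∃ l, RestrictedProblem r ψ N C G l) :
    ∃ t, VerifierMendable K (r + N) (Restricted r ψ N C) (fun _ => t) := by
  set L := r + N + 2 * r + E.p₀ + E.q₀ + k₀ + 1 with hL
  refine ⟨4 * (L + r + N + 2), fun G hK l hl v => ?_⟩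
  -- On a small graph everything may be replaced by a complete solution, since all distances are
  -- below the constant.
  rcases Nat.lt_or_ge G.n (4 * (L + r + N + 2)) with hn | hn
  · obtain ⟨l', hl'⟩ := hsol G hK
    refine ⟨fun u => some (l' u), fun u => Or.inr ⟨l', fun _ _ => rfl, hl' u⟩,
      Option.some_ne_none _, fun u h => absurd h (Option.some_ne_none _), fun u _ => ?_⟩
    exact (G.dist_lt_n v u).le.trans hn.le
  · obtain ⟨m, hm⟩ := exists_mend hψ hprim hs E hN hL.ge hK hn hl v
    exact ⟨m, hm.accepted, hm.filled, hm.no_new_hole, fun u hu => (hm.near u hu).trans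
      (show _ ≤ 4 * (L + r + N + 2) by omega)⟩

end Mending

/-! ### Sublinearity of `logStar` and transfer of complexities -/

section Main

theorem iterate_clog_le (m : ℕ) : ∀ x ≤ m + 1, (Nat.clog 2)^[m] x ≤ 1 := by
  induction m with
  | zero => intro x hx; simpa using hx
  | succ m ih =>
    intro x hx
    rw [Function.iterate_succ_apply]
    refine ih _ (Nat.clog_le_of_le_pow ?_)
    have := Nat.lt_two_pow_self (n := m + 1)
    omega

theorem logStar_le (n : ℕ) : logStar n ≤ Nat.clog 2 n + 1 := by
  refine Nat.sInf_le ?_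
  simp only [Set.mem_ofPred_eq]
  rw [Function.iterate_succ_apply]
  exact iterate_clog_le _ _ (by omega)

/-- A crude bound suffices: `logStar n` is at most logarithmic, while `n > 2 ^ k ≥ (k / 2 + 1) ^ 2`
grows quadratically in the logarithm. -/
theorem eventually_logStar_le (c₁ c₂ : ℕ) : ∃ n₀, ∀ n ≥ n₀, c₁ * logStar n + c₂ ≤ n := by
  set A := 3 * c₁ + c₂ with hA
  refine ⟨2 ^ (2 * A + 1), fun n hn => ?_⟩
  have h1 := logStar_le n
  have h2 : 2 * A + 1 ≤ Nat.clog 2 n := by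
    have := Nat.clog_mono_right 2 hn
    rwa [Nat.clog_pow 2 _ (by norm_num)] at this
  obtain ⟨k, hk⟩ : ∃ k, Nat.clog 2 n = k + 1 := ⟨Nat.clog 2 n - 1, by omega⟩
  have h3 : 2 ^ k < n := by
    have hn1 : 1 < n := by
      by_contra h
      rw [Nat.clog_of_right_le_one (by omega)] at hk
      omega
    have := Nat.pow_pred_clog_lt_self (b := 2) (by norm_num) hn1
    rwa [hk, Nat.pred_succ] at this
  have h4 : (k / 2 + 1) * (k / 2 + 1) ≤ 2 ^ k := by
    have h5 : k / 2 + 1 ≤ 2 ^ (k / 2) := Nat.lt_two_pow_self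
    calc (k / 2 + 1) * (k / 2 + 1) ≤ 2 ^ (k / 2) * 2 ^ (k / 2) := Nat.mul_le_mul h5 h5
      _ = 2 ^ (k / 2 + k / 2) := by rw [pow_add]
      _ ≤ 2 ^ k := Nat.pow_le_pow_right (by norm_num) (by omega)
  have h6 : A * (k / 2 + 1) ≤ (k / 2 + 1) * (k / 2 + 1) := Nat.mul_le_mul_right _ (by omega)
  have h7 : c₁ * logStar n + c₂ ≤ A * (k / 2 + 1) := by
    have h8 : logStar n ≤ 3 * (k / 2 + 1) := by omega
    have h9 := Nat.mul_le_mul_left c₁ h8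
    have h10 : c₂ ≤ c₂ * (k / 2 + 1) := Nat.le_mul_of_pos_right _ (by omega)
    rw [hA, add_mul]
    linarith
  omega

variable {Γ : Type*} {K : Set Kind} {c r : ℕ} {ψ : Verifier Γ} {P P' : Problem Γ}

theorem Solvable.solvesAt {T : ℕ → ℕ} (h : Solvable K c P T) :
    ∃ A : LocalAlgorithm Γ, ∀ n, SolvesAt K c P A n (T n) := by
  obtain ⟨A, hA⟩ := h
  refine ⟨A, fun n G hG hn ident hi hb => ?_⟩
  subst hn
  exact hA G hG ident hi hb

theorem Solvable.exists_solution {T : ℕ → ℕ} (hc : 1 ≤ c) (h : Solvable K c P T) {G : Inst}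
    (hG : G.kind ∈ K) : ∃ l, P G l := by
  obtain ⟨A, hA⟩ := h
  refine ⟨_, hA G hG (fun v => v.val + 1) (fun u v h => Fin.ext (by simpa using h)) fun v => ?_⟩
  have := v.isLt
  have : G.n ≤ G.n ^ c := Nat.le_self_pow (by omega) _
  omega

theorem Solvable.of_imp {T : ℕ → ℕ} (h : Solvable K c P' T)
    (himp : ∀ G : Inst, G.kind ∈ K → ∀ l : G.V → Γ, P' G l → P G l) : Solvable K c P T := by
  obtain ⟨A, hA⟩ := h
  exact ⟨A, fun G hG ident hi hb => himp G hG _ (hA G hG ident hi hb)⟩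

theorem SolvableO.of_imp {f : ℕ → ℝ} (h : SolvableO K c P' f)
    (himp : ∀ G : Inst, G.kind ∈ K → ∀ l : G.V → Γ, P' G l → P G l) : SolvableO K c P f := by
  obtain ⟨T, hT, hs⟩ := h
  exact ⟨T, hT, hs.of_imp himp⟩

theorem exists_bound_of_isBigO {T g : ℕ → ℕ}
    (h : (fun n => (T n : ℝ)) =O[atTop] fun n => (g n : ℝ)) :
    ∃ B n₀ : ℕ, ∀ n ≥ n₀, T n ≤ B * g n := by
  obtain ⟨b, hb⟩ := h.bound
  obtain ⟨n₀, hn₀⟩ := eventually_atTop.1 hb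
  refine ⟨⌈b⌉₊, n₀, fun n hn => ?_⟩
  have h1 := hn₀ n hn
  simp only [Real.norm_natCast] at h1
  have h2 : b * g n ≤ ⌈b⌉₊ * g n := mul_le_mul_of_nonneg_right (Nat.le_ceil b) (Nat.cast_nonneg _)
  exact_mod_cast h1.trans h2

theorem isBigO_one_of_eventually {f : ℕ → ℝ} (hf : ∀ᶠ n in atTop, 1 ≤ f n) :
    (fun _ : ℕ => (1 : ℝ)) =O[atTop] f := by
  refine IsBigO.of_bound 1 (hf.mono fun n hn => ?_)
  rw [Real.norm_eq_abs, Real.norm_eq_abs, abs_one, one_mul]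
  exact hn.trans (le_abs_self _)

theorem isBigO_piecewise {T : ℕ → ℕ} {f : ℕ → ℝ} (hT : (fun n => (T n : ℝ)) =O[atTop] f)
    (hf : ∀ᶠ n in atTop, 1 ≤ f n) (a b N : ℕ) :
    (fun n => ((if n < N then T n + 1 else T n * a + b : ℕ) : ℝ)) =O[atTop] f := by
  have h1 : (fun n => (T n : ℝ) * a + b) =O[atTop] f := by
    refine IsBigO.add ?_ ?_
    · simpa only [mul_comm] using hT.const_mul_left (a : ℝ)
    · simpa using (isBigO_one_of_eventually hf).const_mul_left (b : ℝ)
  refine h1.congr' ?_ EventuallyEq.rfl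
  filter_upwards [eventually_ge_atTop N] with n hn
  rw [if_neg (by omega)]
  push_cast
  rfl

/-- A usable word with a self-loop makes the problem solvable in constant time. -/
theorem solvableO_of_loop (hψ : IsVerifierFor K r ψ P) {T : ℕ → ℕ} (hT : Solvable K c P T) {a : Γ}
    (ha : Feasible K r ψ fun _ => a) (E : EndWords K r ψ fun _ => a) {N : ℕ}
    (hN : E.p₀ + E.q₀ + 2 * r + 2 ≤ N) :
    SolvableO K c (RestrictedProblem r ψ N {fun _ => a}) fun _ => 1 := by
  obtain ⟨A, hA⟩ := hT.solvesAt
  refine ⟨_, ?_, solvable_restricted (R := fun _ => E.p₀ + E.q₀) hψ hA fun n hn => ?_⟩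
  · have h1 : (fun _ : ℕ => ((E.p₀ + E.q₀ : ℕ) : ℝ)) =O[atTop] fun _ : ℕ => (1 : ℝ) :=
      isBigO_const_const _ one_ne_zero _
    refine h1.congr' ?_ EventuallyEq.rfl
    filter_upwards [eventually_ge_atTop N] with n hn
    rw [if_neg (by omega)]
  · obtain ⟨F, hF, hF'⟩ := exists_solver_of_loop hψ ha E hN hn
    exact ⟨F, hF, fun G hG hGn ident _ _ => hF' G hG hGn ident⟩

theorem restrictedProblem_imp (hψ : IsVerifierFor K r ψ P) {N : ℕ} {C : Set (Fin (2 * r) → Γ)}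
    (G : Inst) (hG : G.kind ∈ K) (l : G.V → Γ) (h : RestrictedProblem r ψ N C G l) : P G l :=
  (hψ.2 G hG l).2 fun v => (h v).1

/-- Everything about the restricted problem except its complexity. -/
theorem restrictedProblem_spec [Nonempty Γ] (hc : 1 ≤ c) (hψ : IsVerifierFor K r ψ P)
    {C : Set (Fin (2 * r) → Γ)} {s : Fin (2 * r) → Γ} (hs : s ∈ C) {k₀ : ℕ}
    (hprim : IsPrimitive K r ψ C k₀) (E : EndWords K r ψ s) {N : ℕ}
    (hN : E.p₀ + E.q₀ + 2 * r + 2 ≤ N) {T : ℕ → ℕ}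
    (hT : Solvable K c (RestrictedProblem r ψ N C) T)
    (hcomp : SameComplexity K c P (RestrictedProblem r ψ N C))
    (hC : IsSmallestFlexiblePart K c P r ψ C) :
    ∃ P' : Problem Γ,
      IsLCL K P' ∧
      (∀ G : Inst, G.kind ∈ K → ∀ l : G.V → Γ, P' G l → P G l) ∧
      SameComplexity K c P P' ∧
      (∃ t : ℕ, Mendable K P' (fun _ => t)) ∧
      ∃ C : Set (Fin (2 * r) → Γ), IsSmallestFlexiblePart K c P r ψ C ∧ IsInducedBy K P P' C := by
  have hver : IsVerifierFor K (r + N) (Restricted r ψ N C) (RestrictedProblem r ψ N C) :=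
    restricted_isVerifierFor hψ.1
  refine ⟨RestrictedProblem r ψ N C, ⟨_, _, hver⟩, restrictedProblem_imp hψ, hcomp, ?_, C, hC,
    restricted_isInducedBy hψ ⟨s, hs⟩⟩
  obtain ⟨t, ht⟩ := exists_verifierMendable hψ.1 hprim hs E hN fun G hG => hT.exists_solution hc hG
  exact ⟨t, _, _, hver, ht⟩

end Main

end LocalMending

theorem mainTheorem4 {Γ : Type*} [Finite Γ] (K : Set Kind) (hK : K.Nonempty)
    (c : ℕ) (hc : 1 ≤ c) (P : Problem Γ) (r : ℕ) (ψ : Verifier Γ) (hψ : IsVerifierFor K r ψ P)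
    (hP : SolvableO K c P (fun n => (logStar n : ℝ))) :
    ∃ P' : Problem Γ,
      IsLCL K P' ∧
      (∀ G : Inst, G.kind ∈ K → ∀ l : G.V → Γ, P' G l → P G l) ∧
      SameComplexity K c P P' ∧
      (∃ t : ℕ, Mendable K P' (fun _ => t)) ∧
      ∃ C : Set (Fin (2 * r) → Γ), IsSmallestFlexiblePart K c P r ψ C ∧ IsInducedBy K P P' C := by
  obtain ⟨T₀, hT₀, hS₀⟩ := hP
  obtain ⟨A₀, hA₀⟩ := hS₀.solvesAt
  have hne : Nonempty Γ := by
    obtain ⟨G, hG, hGn, -⟩ := exists_inst hK (le_refl 3)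
    obtain ⟨l, -⟩ := hS₀.exists_solution hc hG
    exact ⟨l ⟨0, by omega⟩⟩
  obtain ⟨B, n₁, hB⟩ := exists_bound_of_isBigO hT₀
  -- The only place where the `log*` bound enters.
  have hsub : ∀ a b : ℕ, ∃ n₀, ∀ n ≥ n₀, 2 * ((T₀ n + 1 + r) * a) + b ≤ n := by
    intro a b
    obtain ⟨n₂, hn₂⟩ := eventually_logStar_le (2 * B * a) (2 * (1 + r) * a + b)
    refine ⟨n₁ + n₂, fun n hn => le_trans ?_ (hn₂ n (by omega))⟩
    have h1 := Nat.mul_le_mul_right (2 * a) (hB n (by omega))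
    have h2 : 2 * ((T₀ n + 1 + r) * a) = T₀ n * (2 * a) + 2 * (1 + r) * a := by ring
    have h3 : 2 * B * a * logStar n = B * logStar n * (2 * a) := by ring
    omega
  by_cases h : SolvableO K c P (fun _ => 1)
  · obtain ⟨T, hT, hS⟩ := id h
    obtain ⟨A, hA⟩ := hS.solvesAt
    obtain ⟨b, n₂, hb⟩ := exists_bound_of_isBigO (g := fun _ => 1) (by simpa using hT)
    obtain ⟨n₃, hn₃⟩ := exists_const_of_fast hψ hK hc b
    -- A single sufficiently large number of nodes already exhibits the usable constant word.
    obtain ⟨a, ha, hau⟩ := hn₃ (n₂ + n₃) (by omega) _ (by simpa using hb (n₂ + n₃) (by omega)) A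
      (hA _)
    obtain ⟨E⟩ := exists_endWords hψ hau
    have hO := solvableO_of_loop hψ hS ha E le_rfl
    obtain ⟨T', hT', hS'⟩ := id hO
    refine restrictedProblem_spec hc hψ (Set.mem_singleton _) (isPrimitive_const ha) E le_rfl hS'
      ?_ ⟨fun _ => a, isFlexible_of_loop (loop_of_const ha), hau,
        fun _ => ⟨loop_of_const ha, rfl⟩, fun h' => absurd h h'⟩
    intro f hf
    exact ⟨fun _ => ⟨T', hT'.trans (isBigO_one_of_eventually hf), hS'⟩,
      fun h' => h'.of_imp (restrictedProblem_imp hψ)⟩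
  · have hno : ∀ b : Γ, Feasible K r ψ (fun _ => b) →
        ¬ IsUsable K P (fun _ : Fin (2 * r) => b) := by
      intro b hb hbu
      obtain ⟨E⟩ := exists_endWords hψ hbu
      exact h ((solvableO_of_loop hψ hS₀ hb E le_rfl).of_imp (restrictedProblem_imp hψ))
    have hex : {s : Fin (2 * r) → Γ |
        IsFlexible (DiagramEdge K r ψ) s ∧ IsUsable K P s}.Nonempty := by
      obtain ⟨n₀, hn₀⟩ := hsub 2 (6 + 1)
      obtain ⟨s, hs⟩ := exists_flexible_usable hψ hK hc (hA₀ n₀)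
        (by have := hn₀ n₀ le_rfl; omega)
      exact ⟨s, hs⟩
    obtain ⟨s, ⟨hflex, hus⟩, hmin⟩ :=
      (measure fun s => (component (DiagramEdge K r ψ) s).ncard).wf.has_min _ hex
    set C := component (DiagramEdge K r ψ) s with hCdef
    have hsC : s ∈ C := ⟨Relation.ReflTransGen.refl, Relation.ReflTransGen.refl⟩
    obtain ⟨k₀, hk₀⟩ := isPrimitive_component hflex
    obtain ⟨E⟩ := exists_endWords hψ hus
    set a := k₀ + 2 * r + 1 with ha
    have hka : IsPrimitive K r ψ C a := fun k hk => hk₀ k (by omega)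
    obtain ⟨W, hW⟩ := hka.exists_loopFamily hsC
    obtain ⟨c₂, hc₂⟩ := exists_solver hψ hc hno hW (by omega) (by omega) E
    obtain ⟨n₂, hn₂⟩ := hsub a c₂
    set N := c₂ + n₂ + E.p₀ + E.q₀ + 2 * r + 2 with hN
    have key : ∀ T : ℕ → ℕ, Solvable K c P T → Solvable K c (RestrictedProblem r ψ N C)
        (fun n => if n < N then T n + 1 else T n * a + c₂) := by
      intro T hT
      obtain ⟨A, hA⟩ := hT.solvesAt
      refine solvable_restricted hψ hA fun n hn => ?_
      have hsize := hn₂ n (by omega)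
      -- The colouring needs an algorithm that sees only a small part of the graph. Where `A` is
      -- slower than `A₀`, use `A₀` instead; its running time is then below `T n`.
      rcases le_or_gt (T n) (T₀ n) with hle | hgt
      · have h1 := Nat.mul_le_mul_right a (show T n + 1 + r ≤ T₀ n + 1 + r by omega)
        exact hc₂ N n (by omega) hn A (T n) (hA n) (by omega)
      · obtain ⟨F, hF, hF'⟩ := hc₂ N n (by omega) hn A₀ (T₀ n) (hA₀ n) hsize
        have h1 := Nat.mul_le_mul_right a hgt.le
        exact ⟨F, hF.mono (by omega), hF'⟩
    refine restrictedProblem_spec hc hψ hsC hka E (by omega) (key T₀ hS₀) ?_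
      ⟨s, hflex, hus, fun h' => absurd h' h, fun _ => ⟨rfl, fun s' h1 h2 => ?_⟩⟩
    · intro f hf
      refine ⟨?_, fun h' => h'.of_imp (restrictedProblem_imp hψ)⟩
      rintro ⟨T, hT, hS⟩
      exact ⟨_, isBigO_piecewise hT hf a c₂ N, key T hS⟩
    · exact not_lt.1 (hmin s' ⟨h1, h2⟩)
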